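/- **Setting.** Let $H$ be a real separable Hilbert space with inner product $(\cdot,\cdot)$ and norm $\|\cdot\|$, and let $A$ be a positive self-adjoint operator in $H$ with an orthonormal eigenbasis $\{e_k\}_{k\ge1}$, $Ae_k=\lambda_ke_k$, $0<\lambda_1\le\lambda_2\le\dots\to\infty$. Put $F_s=D(A^s)$ with $\|v\|_s=\|A^sv\|$ (so $F_0=H$). Let $\beta>0$, $\nu>0$, $\omega\ge0$, $p\in H$. Let $\mu_1,\mu_2\in C^1(0,\infty)\cap L^1(0,\infty)\cap C[0,\infty)$ satisfy $\mu_i\ge0$ and $\mu_i'+\delta_i\mu_i\le0$ on $(0,\infty)$ with constants $\delta_i>0$; if $\omega=0$, let $\mu_2\not\equiv0$. Let $M\in C^2([0,\infty))$ and suppose that $\mathcal M(z):=\int_0^zM(\xi)\,d\xi\ge -az-b$ for all $z\ge0$, with some $a\in(0,\lambda_1)$ and $b\in\mathbb R$. Let $\mathcal H=F_1\times F_0\times F_0\times L^2_{\mu_1}(\mathbb R_+;F_1)\times L^2_{\mu_2}(\mathbb R_+;F_{1/2})$, with elements $U=(u,w,v,\bar\eta,\eta)$ and the Hilbert norm $$\|U\|_{\mathcal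 H}^2=\beta\|Au\|^2+\|w\|^2+\|v\|^2+\|\bar\eta\|^2_{L^2_{\mu_1}(\mathbb R_+;F_1)}+\|\eta\|^2_{L^2_{\mu_2}(\mathbb R_+;F_{1/2})}.$$ Let $\mathcal L$ be the operator $$\mathcal LU=\Bigl(w,\;-\beta A^2u-\int_0^\infty\mu_1(s)A^2\bar\eta(s)\,ds+\nu Av,\;-\omega Av-\int_0^\infty\mu_2(s)A\eta(s)\,ds-\nu Aw,\;-\bar\eta_s+w,\;-\eta_s+v\Bigr),$$ whose domain consists of all $U\in\mathcal H$ with $w\in F_1$, $v\in F_{1/2}$, $\bar\eta_s\in L^2_{\mu_1}(\mathbb R_+;F_1)$, $\bar\eta(0)=0$, $\eta_s\in L^2_{\mu_2}(\mathbb R_+;F_{1/2})$, $\eta(0)=0$, and whose second and third components of $\mathcal LU$ (a priori elements of $F_{-1}$ and $F_{-1/2}$) lie in $F_0$. Let $f(U)=(0,-M(\|A^{1/2}u\|^2)Au+p,0,0,0)$. A mild solution of $\dot U=\mathcal LU+f(U)$, $U(0)=U_0$, on $[0,T]$ is a function $U\in C([0,T];\mathcal H)$ with $U(t)=e^{t\mathcal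 L}U_0+\int_0^te^{(t-\tau)\mathcal L}f(U(\tau))\,d\tau$ for $t\in[0,T]$. **Theorem 2.9 (strict Lyapunov function).** The operator $\mathcal L$ generates a strongly continuous semigroup $e^{t\mathcal L}$ on $\mathcal H$, for every $U_0\in\mathcal H$ and $T>0$ there is exactly one mild solution on $[0,T]$, and $S_tU_0:=U(t)$ defines a dynamical system $(\mathcal H,S_t)$ (a semigroup of maps, jointly continuous in $(t,U_0)$). Let $$\Phi(U)=\tfrac12\|U\|_{\mathcal H}^2+\tfrac12\,\mathcal M\bigl(\|A^{1/2}u\|^2\bigr)-(p,u).$$ Then: I. $(\mathcal H,S_t)$ is gradient with $\Phi$ as a strict Lyapunov function, i.e. $\Phi$ is continuous on $\mathcal H$ and (i) $t\mapsto\Phi(S_tU_0)$ is nonincreasing on $[0,\infty)$ for every $U_0\in\mathcal H$; (ii) if $U_0\in\mathcal H$ and $\Phi(S_tU_0)=\Phi(U_0)$ for all $t>0$, then $U_0$ is a stationary point: $S_tU_0=U_0$ for all $t\ge0$. II. $\Phi$ is bounded above on every bounded subset of $\mathcal H$; and if $a<\beta\lambda_1$ (which is automatic when $\beta\ge1$),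 then the set $\{U\in\mathcal H:\Phi(U)\le R\}$ is bounded for every $R\in\mathbb R$. -/

import Mathlib

open Set Filter Topology MeasureTheory

namespace BergerPlate

/-- A positive self-adjoint operator `A` in a real Hilbert space `H` with an orthonormal eigenbasis
`e` and eigenvalues `0 < lam 0 ≤ lam 1 ≤ ... → ∞`. (The eigenvalues are indexed from `0`, so
`lam 0` is the smallest one. Positivity of `A` is positivity of the eigenvalues.) -/
structure SpectralOperator (H : Type*) [NormedAddCommGroup H] [InnerProductSpace ℝ H]
    [CompleteSpace H] where
  A : H →ₗ.[ℝ] H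
  selfAdjoint : IsSelfAdjoint A
  e : HilbertBasis ℕ ℝ H
  lam : ℕ → ℝ
  e_mem : ∀ k, e k ∈ A.domain
  eigen : ∀ k, A ⟨e k, e_mem k⟩ = lam k • e k
  lam_pos : ∀ k, 0 < lam k
  lam_mono : Monotone lam
  lam_tendsto : Tendsto lam atTop atTop

namespace SpectralOperator

variable {H : Type*} [NormedAddCommGroup H] [InnerProductSpace ℝ H] [CompleteSpace H]

/-- The Fourier coefficient `(x, e_k)`. -/
noncomputable def coef (D : SpectralOperator H) (x : H) (k : ℕ) : ℝ := inner ℝ (D.e k) x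

theorem coef_eq (D : SpectralOperator H) (x : H) (k : ℕ) : D.coef x k = D.e.repr x k :=
  (D.e.repr_apply_apply x k).symm

/-- The domain of `A^s`: all `v` with `∑ λ_k^{2s} (v, e_k)² < ∞`. -/
noncomputable def domPow (D : SpectralOperator H) (s : ℝ) : Submodule ℝ H where
  carrier := {v | Memℓp (fun k => D.lam k ^ s * D.coef v k) 2}
  zero_mem' := by
    have h : (fun k => D.lam k ^ s * D.coef (0 : H) k) = (0 : ℕ → ℝ) := by
      funext k; simp [coef]
    simp only [Set.mem_ofPred_eq, h]
    exact zero_memℓp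
  add_mem' := by
    intro v w hv hw
    have h : (fun k => D.lam k ^ s * D.coef (v + w) k)
        = (fun k => D.lam k ^ s * D.coef v k) + (fun k => D.lam k ^ s * D.coef w k) := by
      funext k; simp [coef, inner_add_right, mul_add]
    simp only [Set.mem_ofPred_eq, h]
    exact hv.add hw
  smul_mem' := by
    intro c v hv
    have h : (fun k => D.lam k ^ s * D.coef (c • v) k)
        = c • (fun k => D.lam k ^ s * D.coef v k) := by
      funext k; simp [coef, inner_smul_right]; ring
    simp only [Set.mem_ofPred_eq, h]
    exact hv.const_smul c

/-- Membership in `D(A^s)` is square summability with weights `λ_k^{2s}`. -/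
theorem mem_domPow (D : SpectralOperator H) (s : ℝ) (v : H) :
    v ∈ D.domPow s ↔ Summable fun k => D.lam k ^ (2 * s) * D.coef v k ^ 2 := by
  change Memℓp (fun k => D.lam k ^ s * D.coef v k) 2 ↔ _
  rw [memℓp_gen_iff (by norm_num)]
  refine summable_congr fun k => ?_
  have := D.lam_pos k
  rw [mul_comm 2 s, Real.rpow_mul this.le]
  simp [mul_pow]

/-- The space `F_s = D(A^s)`. A separate type, since its norm is not the one of `H`. -/
def F (D : SpectralOperator H) (s : ℝ) : Type _ := ↥(D.domPow s)

noncomputable instance (D : SpectralOperator H) (s : ℝ) : AddCommGroup (D.F s) :=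
  inferInstanceAs (AddCommGroup ↥(D.domPow s))

noncomputable instance (D : SpectralOperator H) (s : ℝ) : Module ℝ (D.F s) :=
  inferInstanceAs (Module ℝ ↥(D.domPow s))

/-- The inclusion `F_s ⊆ H`. -/
noncomputable def toH (D : SpectralOperator H) (s : ℝ) : D.F s →ₗ[ℝ] H := (D.domPow s).subtype

/-- An element of `D(A^s)` as an element of `F_s`. -/
def mkF (D : SpectralOperator H) (s : ℝ) (v : H) (hv : v ∈ D.domPow s) : D.F s := ⟨v, hv⟩

/-- The operator `A^s : F_s → H`, `A^s v = ∑ λ_k^s (v, e_k) e_k`. -/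
noncomputable def pow (D : SpectralOperator H) (s : ℝ) : D.F s →ₗ[ℝ] H where
  toFun v := D.e.repr.symm ⟨fun k => D.lam k ^ s * D.coef (D.toH s v) k, v.2⟩
  map_add' v w := by
    rw [← map_add]
    congr 1
    ext k
    change D.lam k ^ s * D.coef (D.toH s (v + w)) k
      = D.lam k ^ s * D.coef (D.toH s v) k + D.lam k ^ s * D.coef (D.toH s w) k
    simp [coef, inner_add_right, mul_add]
  map_smul' c v := by
    rw [RingHom.id_apply, ← map_smul]
    congr 1
    ext k
    change D.lam k ^ s * D.coef (D.toH s (c • v)) k = c * (D.lam k ^ s * D.coef (D.toH s v) k)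
    simp [coef, inner_smul_right]
    ring

theorem coef_pow (D : SpectralOperator H) (s : ℝ) (v : D.F s) (k : ℕ) :
    D.coef (D.pow s v) k = D.lam k ^ s * D.coef (D.toH s v) k := by
  rw [coef_eq]
  simp [pow]

theorem pow_injective (D : SpectralOperator H) (s : ℝ) : Function.Injective (D.pow s) := by
  intro v w h
  apply Subtype.ext
  apply D.e.repr.injective
  ext k
  have h1 := congrArg (fun x => D.coef x k) h
  simp only [coef_pow] at h1
  have h2 := mul_left_cancel₀ (Real.rpow_pos_of_pos (D.lam_pos k) s).ne' h1
  rw [coef_eq, coef_eq] at h2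
  exact h2

/-- The norm `‖v‖_s = ‖A^s v‖` of `F_s`. -/
noncomputable instance (D : SpectralOperator H) (s : ℝ) : NormedAddCommGroup (D.F s) :=
  NormedAddCommGroup.induced (D.F s) H (D.pow s) (D.pow_injective s)

/-- The inner product `(v, w)_s = (A^s v, A^s w)` of `F_s`. -/
noncomputable instance (D : SpectralOperator H) (s : ℝ) : InnerProductSpace ℝ (D.F s) where
  toModule := inferInstanceAs (Module ℝ (D.F s))
  norm_smul_le c v := by
    change ‖D.pow s (c • v)‖ ≤ ‖c‖ * ‖D.pow s v‖
    rw [map_smul, norm_smul]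
  inner v w := inner ℝ (D.pow s v) (D.pow s w)
  norm_sq_eq_re_inner v := norm_sq_eq_re_inner (𝕜 := ℝ) (D.pow s v)
  conj_inner_symm v w := inner_conj_symm (𝕜 := ℝ) (D.pow s v) (D.pow s w)
  add_left u v w := by simp [inner_add_left]
  smul_left u v c := by simp [inner_smul_left]

theorem norm_F (D : SpectralOperator H) (s : ℝ) (v : D.F s) : ‖v‖ = ‖D.pow s v‖ := rfl

theorem inner_F (D : SpectralOperator H) (s : ℝ) (v w : D.F s) :
    inner ℝ v w = inner ℝ (D.pow s v) (D.pow s w) := rfl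

theorem pow_surjective (D : SpectralOperator H) {s : ℝ} (hs : 0 ≤ s) :
    Function.Surjective (D.pow s) := by
  intro x
  have hx : Memℓp (fun k => D.coef x k) 2 := by
    simp_rw [coef_eq]
    exact lp.memℓp _
  have hm : Memℓp (fun k => D.lam k ^ (-s) * D.coef x k) 2 := by
    have h0 : Memℓp (fun k => D.lam 0 ^ (-s) * D.coef x k) 2 := hx.const_smul (D.lam 0 ^ (-s))
    refine memℓp_gen (Summable.of_nonneg_of_le (fun k => by positivity) (fun k => ?_)
      (h0.summable (by norm_num)))
    refine Real.rpow_le_rpow (norm_nonneg _) ?_ (by norm_num)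
    rw [norm_mul, norm_mul, Real.norm_of_nonneg (Real.rpow_nonneg (D.lam_pos _).le _),
      Real.norm_of_nonneg (Real.rpow_nonneg (D.lam_pos _).le _)]
    exact mul_le_mul_of_nonneg_right (Real.rpow_le_rpow_of_nonpos (D.lam_pos 0)
      (D.lam_mono (Nat.zero_le _)) (neg_nonpos.2 hs)) (norm_nonneg _)
  have hy : ∀ k, D.lam k ^ s * D.coef (D.e.repr.symm ⟨_, hm⟩) k = D.coef x k := by
    intro k
    rw [coef_eq]
    simp only [LinearIsometryEquiv.apply_symm_apply]
    rw [← mul_assoc, ← Real.rpow_add (D.lam_pos k)]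
    simp
  refine ⟨D.mkF s (D.e.repr.symm ⟨_, hm⟩) ?_, ?_⟩
  · change Memℓp _ 2
    simp_rw [hy]
    exact hx
  · apply D.e.repr.injective
    ext k
    rw [← coef_eq, ← coef_eq, coef_pow]
    exact hy k

/-- `F_s` is complete, hence a Hilbert space, for `s ≥ 0`. -/
theorem completeSpace_F (D : SpectralOperator H) {s : ℝ} (hs : 0 ≤ s) : CompleteSpace (D.F s) := by
  let φ : D.F s ≃ₗᵢ[ℝ] H :=
    { LinearEquiv.ofBijective (D.pow s) ⟨D.pow_injective s, D.pow_surjective hs⟩ with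
      norm_map' := fun _ => rfl }
  exact (completeSpace_congr φ.isometry.isUniformEmbedding (e := φ.toEquiv)).2 inferInstance

instance (D : SpectralOperator H) : CompleteSpace (D.F 1) := D.completeSpace_F (by norm_num)

instance (D : SpectralOperator H) : CompleteSpace (D.F (1 / 2)) := D.completeSpace_F (by norm_num)

theorem domPow_mono (D : SpectralOperator H) : D.domPow 1 ≤ D.domPow (1 / 2) := by
  intro v hv
  rw [mem_domPow] at hv ⊢
  refine Summable.of_nonneg_of_le (fun k => ?_) (fun k => ?_) (hv.mul_left (D.lam 0)⁻¹)
  · have := (D.lam_pos k).le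
    positivity
  · have h0 := D.lam_pos 0
    have hk := D.lam_pos k
    have hm : D.lam 0 ≤ D.lam k := D.lam_mono (Nat.zero_le k)
    have e1 : D.lam k ^ ((2 : ℝ) * (1 / 2)) = D.lam k := by norm_num
    have e2 : D.lam k ^ ((2 : ℝ) * 1) = D.lam k ^ 2 := by
      rw [mul_one]; exact_mod_cast Real.rpow_natCast (D.lam k) 2
    rw [e1, e2, ← mul_assoc]
    refine mul_le_mul_of_nonneg_right ?_ (sq_nonneg _)
    rw [inv_mul_eq_div, le_div_iff₀ h0]
    nlinarith

/-- The inclusion `F_1 ⊆ F_{1/2}`. -/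
noncomputable def incl (D : SpectralOperator H) (u : D.F 1) : D.F (1 / 2) :=
  D.mkF (1 / 2) (D.toH 1 u) (D.domPow_mono u.2)

end SpectralOperator

/-- The standing assumptions on a memory kernel: `μ ∈ C¹(0,∞) ∩ L¹(0,∞) ∩ C[0,∞)`, `μ ≥ 0`,
`μ' + δ μ ≤ 0` with a constant `δ > 0`. -/
structure IsMemoryKernel (μ : ℝ → ℝ) (δ : ℝ) : Prop where
  contDiffOn : ContDiffOn ℝ 1 μ (Ioi 0)
  integrableOn : IntegrableOn μ (Ioi 0)
  continuousOn : ContinuousOn μ (Ici 0)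
  nonneg : ∀ s, 0 ≤ s → 0 ≤ μ s
  rate_pos : 0 < δ
  deriv_le : ∀ s, 0 < s → deriv μ s + δ * μ s ≤ 0

/-- The measure `μ(s) ds` on the half-line `(0, ∞)`. -/
noncomputable def weight (μ : ℝ → ℝ) : Measure ℝ :=
  (volume.restrict (Ioi 0)).withDensity fun s => ENNReal.ofReal (μ s)

/-- The weighted space `L²_μ(ℝ₊; E)`. -/
noncomputable abbrev MemorySpace (μ : ℝ → ℝ) (E : Type*) [NormedAddCommGroup E] :=
  Lp E 2 (weight μ)

/-- `η` lies in the domain `{η ∈ L²_μ : η_s ∈ L²_μ, η(0) = 0}` and `η_s = ζ`: the function `η` is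
represented by the locally absolutely continuous function that vanishes at `0` and has
derivative `ζ`. -/
def HasMemoryDeriv {μ : ℝ → ℝ} {E : Type*} [NormedAddCommGroup E] [NormedSpace ℝ E]
    (η ζ : MemorySpace μ E) : Prop :=
  ∀ᵐ s ∂(weight μ), η s = ∫ y in (0 : ℝ)..s, ζ y

section System

variable {H : Type*} [NormedAddCommGroup H] [InnerProductSpace ℝ H] [CompleteSpace H]

/-- The phase space `F_1 × F_0 × F_0 × L²_{μ₁}(ℝ₊; F_1) × L²_{μ₂}(ℝ₊; F_{1/2})`, with `F_0 = H`;
its points are `U = (u, w, v, ηb, η)`. It carries the product topology; the Hilbert norm that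
induces this topology and enters the Lyapunov function is `normSq` below. -/
noncomputable abbrev Phase (D : SpectralOperator H) (μ₁ μ₂ : ℝ → ℝ) :=
  D.F 1 × H × H × MemorySpace μ₁ (D.F 1) × MemorySpace μ₂ (D.F (1 / 2))

/-- The squared norm
`‖U‖² = β ‖A u‖² + ‖w‖² + ‖v‖² + ‖ηb‖²_{L²_{μ₁}(F_1)} + ‖η‖²_{L²_{μ₂}(F_{1/2})}`. -/
noncomputable def normSq (D : SpectralOperator H) (μ₁ μ₂ : ℝ → ℝ) (β : ℝ) :
    Phase D μ₁ μ₂ → ℝ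
  | (u, w, v, ηb, η) => β * ‖D.pow 1 u‖ ^ 2 + ‖w‖ ^ 2 + ‖v‖ ^ 2 + ‖ηb‖ ^ 2 + ‖η‖ ^ 2

/-- The graph of the linear operator `L`: `U ∈ D(L)` and `L U = V`, where for `U = (u,w,v,ηb,η)`
`L U = (w, -β A²u - ∫ μ₁ A² ηb ds + ν A v, -ω A v - ∫ μ₂ A η ds - ν A w, -ηb_s + w, -η_s + v)`.
The domain consists of the `U` with `w ∈ F_1`, `v ∈ F_{1/2}`, `ηb` and `η` in the domains of the
two derivations, and such that the second and the third component, which in general are only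
elements of the extrapolation spaces `F_{-1}` and `F_{-1/2}` and are given by their Fourier
coefficients, lie in `F_0 = H`. -/
def LGraph (D : SpectralOperator H) (μ₁ μ₂ : ℝ → ℝ) (β ν ω : ℝ) :
    Phase D μ₁ μ₂ → Phase D μ₁ μ₂ → Prop
  | (u, w, v, ηb, η), (u', w', v', ηb', η') =>
    ∃ (hw : w ∈ D.domPow 1) (hv : v ∈ D.domPow (1 / 2))
      (ζb : MemorySpace μ₁ (D.F 1)) (ζ : MemorySpace μ₂ (D.F (1 / 2))),
      HasMemoryDeriv ηb ζb ∧ HasMemoryDeriv η ζ ∧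
      u' = D.mkF 1 w hw ∧
      (∀ k, D.coef w' k = -β * (D.lam k ^ 2 * D.coef (D.toH 1 u) k)
        - D.lam k ^ 2 * D.coef (D.toH 1 (∫ s, ηb s ∂(weight μ₁))) k
        + ν * (D.lam k * D.coef v k)) ∧
      (∀ k, D.coef v' k = -ω * (D.lam k * D.coef v k)
        - D.lam k * D.coef (D.toH (1 / 2) (∫ s, η s ∂(weight μ₂))) k
        - ν * (D.lam k * D.coef w k)) ∧
      (∀ᵐ s ∂(weight μ₁), ηb' s = -ζb s + D.mkF 1 w hw) ∧
      (∀ᵐ s ∂(weight μ₂), η' s = -ζ s + D.mkF (1 / 2) v hv)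

/-- The nonlinearity `f(U) = (0, -M(‖A^{1/2}u‖²) A u + p, 0, 0, 0)`. -/
noncomputable def nonlin (D : SpectralOperator H) (μ₁ μ₂ : ℝ → ℝ) (M : ℝ → ℝ) (p : H) :
    Phase D μ₁ μ₂ → Phase D μ₁ μ₂
  | (u, _, _, _, _) =>
    (0, -(M (‖D.pow (1 / 2) (D.incl u)‖ ^ 2)) • D.pow 1 u + p, 0, 0, 0)

/-- The antiderivative `z ↦ ∫₀^z M`. -/
noncomputable def primitive (M : ℝ → ℝ) (z : ℝ) : ℝ := ∫ ξ in (0 : ℝ)..z, M ξ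

/-- The energy functional
`Φ(U) = ½ ‖U‖² + ½ ∫₀^{‖A^{1/2}u‖²} M(ξ) dξ - (p, u)`. -/
noncomputable def lyapunov (D : SpectralOperator H) (μ₁ μ₂ : ℝ → ℝ) (β : ℝ) (M : ℝ → ℝ) (p : H)
    (U : Phase D μ₁ μ₂) : ℝ :=
  1 / 2 * normSq D μ₁ μ₂ β U + 1 / 2 * primitive M (‖D.pow (1 / 2) (D.incl U.1)‖ ^ 2)
    - inner ℝ p (D.toH 1 U.1)

end System

section Semigroups

variable {X : Type*}

/-- A strongly continuous semigroup of bounded operators (only times `t ≥ 0` matter). -/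
structure IsC0Semigroup [NormedAddCommGroup X] [NormedSpace ℝ X] (E : ℝ → X →L[ℝ] X) : Prop where
  zero : E 0 = ContinuousLinearMap.id ℝ X
  add : ∀ s t, 0 ≤ s → 0 ≤ t → E (s + t) = (E s).comp (E t)
  tendsto : ∀ x, Tendsto (fun t => E t x) (𝓝[>] 0) (𝓝 x)

/-- The infinitesimal generator of `E` is the operator with the given graph:
`x` is in its domain with value `y` if and only if `(E(t)x - x)/t → y` as `t ↓ 0`. -/
def HasGenerator [NormedAddCommGroup X] [NormedSpace ℝ X] (E : ℝ → X →L[ℝ] X)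
    (graph : X → X → Prop) : Prop :=
  ∀ x y, graph x y ↔ Tendsto (fun t : ℝ => t⁻¹ • (E t x - x)) (𝓝[>] 0) (𝓝 y)

/-- `U ∈ C([0,T]; X)` is a mild solution of `U' = L U + f(U)`, `U(0) = U₀` on `[0, T]`, where `E` is
the semigroup generated by `L`. -/
def IsMildSolution [NormedAddCommGroup X] [NormedSpace ℝ X] (E : ℝ → X →L[ℝ] X) (f : X → X)
    (U₀ : X) (T : ℝ) (U : ℝ → X) : Prop :=
  ContinuousOn U (Icc 0 T) ∧
    ∀ t ∈ Icc 0 T, U t = E t U₀ + ∫ τ in (0 : ℝ)..t, E (t - τ) (f (U τ))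

/-- `(X, S_t)` is a dynamical system: a semigroup of mappings, jointly continuous in time and
state. -/
structure IsDynamicalSystem [TopologicalSpace X] (S : ℝ → X → X) : Prop where
  zero : ∀ x, S 0 x = x
  add : ∀ s t, 0 ≤ s → 0 ≤ t → ∀ x, S (s + t) x = S s (S t x)
  continuousOn : ContinuousOn (fun q : ℝ × X => S q.1 q.2) (Ici 0 ×ˢ univ)

/-- `x` is a stationary point of `(X, S_t)`. -/
def IsStationary (S : ℝ → X → X) (x : X) : Prop := ∀ t, 0 ≤ t → S t x = x

/-- `Φ` is a strict Lyapunov function of `(X, S_t)`: it is continuous, it does not increase along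
trajectories, and it is constant along a trajectory only if that starts at a stationary point. -/
structure IsStrictLyapunov [TopologicalSpace X] (S : ℝ → X → X) (Φ : X → ℝ) : Prop where
  continuous : Continuous Φ
  nonincreasing : ∀ x, AntitoneOn (fun t => Φ (S t x)) (Ici 0)
  strict : ∀ x, (∀ t, 0 < t → Φ (S t x) = Φ x) → IsStationary S x

/-- A gradient system: a dynamical system that has a strict Lyapunov function. -/
def IsGradient [TopologicalSpace X] (S : ℝ → X → X) : Prop :=
  IsDynamicalSystem S ∧ ∃ Φ : X → ℝ, IsStrictLyapunov S Φ

end Semigroups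

end BergerPlate

/-! In the Hilbert norm of the energy, `L` is maximal dissipative. When `L U` is paired with `U`,
the elastic terms, the two `ν` couplings and the couplings between velocities and histories cancel.
There remain `-ω ‖A^{1/2} v‖²` and the memory terms `-(η_s, η)`, and `μ' + δ μ ≤ 0` turns an
integration by parts into `(η_s, η) ≥ δ/2 ‖η‖²`. Hence the dissipation controls both histories, and
`v` if `ω > 0` (`lGraph_dissip`). For the range condition, the displacement and the histories are
eliminated from the resolvent equation. The remaining system for the velocities in `F_1 × F_{1/2}`
is coercive: the `ν` terms are skew, and in the direction of `v` coercivity comes from `ω`, or from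
`μ₂ ≢ 0` if `ω = 0` (`lGraph_range`). Yosida approximation then gives a contraction semigroup with
generator exactly `L` (`IsMaxDissipative.hasGenerator`).

The nonlinearity is Lipschitz on bounded sets, so global well-posedness reduces to a priori bounds
(`exists_dynamicalSystem`). These come from the energy. Mild solutions need not lie in the domain of
`L`, so the energy inequality is proved for their images under `z (z - L)⁻¹`, and then `z → ∞`
(`IsMaxDissipative.energy_le`). The work of the force is the loss of potential energy, because `u`
is differentiable in `H` with derivative `w` (`IsMotion.integral_power`). Together, `Φ(U(t)) + ∫₀ᵗ
dissipation ≤ Φ(U(0))`. This bounds the norm of `U(t)` by a constant plus a multiple of `‖u(t)‖_H`,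
through `‖A^{1/2} u‖² ≤ ‖u‖ ‖A u‖`. Since `‖u(t)‖_H ≤ ‖u(0)‖_H + ∫ ‖w‖`, Gronwall's inequality
closes the estimate, with no smallness of `a` relative to `β`.

If `Φ` is constant on a trajectory, the dissipation vanishes, and so do both histories. The equation
`η_t = -η_s + v` then forces `v = 0` if `ω = 0` (the kernel is not zero), and if `ω > 0` the
dissipation does so directly. The temperature equation leaves `ν A w = 0`, so `w = 0` and `u` is
constant. As the trajectory is only a mild solution, this is carried out for its time integral,
which does lie in the domain (`IsMotion.eq_of_lyapunov_eq`). -/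

namespace BergerPlate

/-! ### Maximal dissipative relations, their resolvents and Yosida approximations -/

section MaximalDissipative

variable {X : Type*} [NormedAddCommGroup X] [InnerProductSpace ℝ X]

/-- The relation `R` is the graph of a maximal dissipative linear operator in `X`. -/
structure IsMaxDissipative (R : X → X → Prop) : Prop where
  add : ∀ {x y x' y'}, R x y → R x' y' → R (x + x') (y + y')
  smul : ∀ (c : ℝ) {x y}, R x y → R (c • x) (c • y)
  dissip : ∀ {x y}, R x y → inner ℝ x y ≤ 0
  range : ∀ z : ℝ, 0 < z → ∀ g, ∃ x y, R x y ∧ z • x - y = g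
  unique : ∀ {y}, R 0 y → y = 0

namespace IsMaxDissipative

variable {R : X → X → Prop} (hR : IsMaxDissipative R)

include hR in
theorem sub {x y x' y' : X} (h : R x y) (h' : R x' y') : R (x - x') (y - y') := by
  have := hR.add h (hR.smul (-1) h')
  simpa [sub_eq_add_neg] using this

include hR in
-- Pairing `z x - y` with `x` loses only the nonpositive term `(x, y)`; Cauchy-Schwarz does the
-- rest. This gives injectivity of `z - L` and the resolvent bound at once.
theorem norm_le {x y : X} (h : R x y) {z : ℝ} (_ : 0 < z) : z * ‖x‖ ≤ ‖z • x - y‖ := by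
  rcases eq_or_lt_of_le (norm_nonneg x) with h0 | h0
  · rw [← h0]; simp
  have h1 : z * ‖x‖ ^ 2 ≤ inner ℝ x (z • x - y) := by
    rw [inner_sub_right, inner_smul_right, real_inner_self_eq_norm_sq]
    linarith [hR.dissip h]
  have h2 := real_inner_le_norm x (z • x - y)
  by_contra! h3
  nlinarith

include hR in
theorem eq_of_sub_eq {x y x' y' : X} (h : R x y) (h' : R x' y') {z : ℝ} (hz : 0 < z)
    (he : z • x - y = z • x' - y') : x = x' := by
  have h1 := hR.norm_le (hR.sub h h') hz
  have h2 : z • (x - x') - (y - y') = 0 := by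
    rw [smul_sub, sub_sub_sub_comm, he, sub_self]
  rw [h2, norm_zero] at h1
  have : ‖x - x'‖ ≤ 0 := by
    by_contra! h3
    nlinarith
  exact sub_eq_zero.1 (norm_le_zero_iff.1 this)

include hR in
theorem exists_resolvent (z : ℝ) (hz : 0 < z) :
    ∃ J : X →L[ℝ] X, (∀ g, R (J g) (z • J g - g)) ∧ ∀ g, ‖J g‖ ≤ z⁻¹ * ‖g‖ := by
  choose x y hxy hg using hR.range z hz
  have hx : ∀ g, R (x g) (z • x g - g) := fun g => by
    have : y g = z • x g - g := by rw [eq_sub_iff_add_eq', ← eq_sub_iff_add_eq, hg]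
    exact this ▸ hxy g
  have hn : ∀ g, ‖x g‖ ≤ z⁻¹ * ‖g‖ := fun g => by
    have := hR.norm_le (hx g) hz
    rw [sub_sub_cancel] at this
    rwa [inv_mul_eq_div, le_div_iff₀ hz, mul_comm]
  let J : X →ₗ[ℝ] X :=
    { toFun := x
      map_add' := fun a b => hR.eq_of_sub_eq (hx _) (hR.add (hx a) (hx b)) hz (by module)
      map_smul' := fun c a => hR.eq_of_sub_eq (hx _) (hR.smul c (hx a)) hz (by
        simp only [RingHom.id_apply]; module) }
  exact ⟨J.mkContinuous z⁻¹ hn, hx, hn⟩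

open Classical in
/-- The resolvent `(z - L)⁻¹` of the operator `L` with graph `R`, for `z > 0`. -/
noncomputable def resolvent (hR : IsMaxDissipative R) (z : ℝ) : X →L[ℝ] X :=
  if hz : 0 < z then (hR.exists_resolvent z hz).choose else 0

theorem resolvent_mem {z : ℝ} (hz : 0 < z) (g : X) :
    R (hR.resolvent z g) (z • hR.resolvent z g - g) := by
  rw [resolvent, dif_pos hz]
  exact (hR.exists_resolvent z hz).choose_spec.1 g

theorem norm_resolvent_le {z : ℝ} (hz : 0 < z) (g : X) : ‖hR.resolvent z g‖ ≤ z⁻¹ * ‖g‖ := by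
  rw [resolvent, dif_pos hz]
  exact (hR.exists_resolvent z hz).choose_spec.2 g

theorem resolvent_eq {z : ℝ} (hz : 0 < z) {x y : X} (h : R x y) :
    hR.resolvent z (z • x - y) = x :=
  hR.eq_of_sub_eq (hR.resolvent_mem hz _) h hz (by rw [sub_sub_cancel])

include hR in
/-- The range of the resolvent is dense. -/
theorem denseRange_resolvent [CompleteSpace X] {z : ℝ} (hz : 0 < z) :
    DenseRange (hR.resolvent z) := by
  have h : (LinearMap.range (hR.resolvent z : X →ₗ[ℝ] X)).topologicalClosure = ⊤ := by
    -- If `g` is orthogonal to the range, it is orthogonal to `J g`, and dissipativity at `J g`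
    -- leaves `z ‖J g‖² ≤ 0`. So `J g = 0`, and then `L 0 = -g` forces `g = 0`, the relation being
    -- single-valued.
    rw [Submodule.topologicalClosure_eq_top_iff, Submodule.eq_bot_iff]
    intro g hg
    have h1 : inner ℝ (hR.resolvent z g) g = 0 :=
      (Submodule.mem_orthogonal _ _).1 hg _ ⟨g, rfl⟩
    have h2 := hR.dissip (hR.resolvent_mem hz g)
    rw [inner_sub_right, h1, inner_smul_right, real_inner_self_eq_norm_sq, sub_zero] at h2
    have h3 : hR.resolvent z g = 0 := by
      by_contra hne
      have := norm_pos_iff.2 hne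
      have : 0 < z * ‖hR.resolvent z g‖ ^ 2 := by positivity
      linarith
    have h4 := hR.resolvent_mem hz g
    rw [h3, smul_zero, zero_sub] at h4
    exact neg_eq_zero.1 (hR.unique h4)
  have h2 := congrArg (fun S : Submodule ℝ X => (S : Set X)) h
  simp only [Submodule.topologicalClosure_coe, Submodule.top_coe] at h2
  exact dense_iff_closure_eq.2 h2

/-- The resolvent identity `J_z = J_w + (w - z) J_w J_z` also holds with `z` and `w` exchanged;
adding the two shows that the products agree. -/
theorem resolvent_commute {z w : ℝ} (hz : 0 < z) (hw : 0 < w) :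
    Commute (hR.resolvent z) (hR.resolvent w) := by
  have key : ∀ {z w : ℝ}, 0 < z → 0 < w → ∀ g,
      hR.resolvent z g = hR.resolvent w g + (w - z) • hR.resolvent w (hR.resolvent z g) := by
    intro z w hz hw g
    rw [← map_smul, ← map_add]
    conv_lhs => rw [← hR.resolvent_eq hw (hR.resolvent_mem hz g)]
    congr 1
    module
  rcases eq_or_ne z w with rfl | hne
  · exact Commute.refl _
  ext g
  have h1 := key hz hw g
  have h2 := key hw hz g
  have h3 : (w - z) • (hR.resolvent w (hR.resolvent z g) - hR.resolvent z (hR.resolvent w g))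
      = 0 := by
    have : (w - z) • (hR.resolvent w (hR.resolvent z g) - hR.resolvent z (hR.resolvent w g))
      = (w - z) • hR.resolvent w (hR.resolvent z g)
        + (z - w) • hR.resolvent z (hR.resolvent w g) := by module
    rw [this, ← sub_eq_iff_eq_add'.2 h1, ← sub_eq_iff_eq_add'.2 h2]
    abel
  rw [smul_eq_zero] at h3
  rcases h3 with h3 | h3
  · exact absurd (sub_eq_zero.1 h3).symm hne
  · exact (sub_eq_zero.1 h3).symm

/-- The Yosida approximation `z² (z - L)⁻¹ - z`. -/
noncomputable def yosida (hR : IsMaxDissipative R) (z : ℝ) : X →L[ℝ] X :=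
  z • (z • hR.resolvent z - ContinuousLinearMap.id ℝ X)

theorem yosida_apply (z : ℝ) (x : X) :
    hR.yosida z x = z • (z • hR.resolvent z x - x) := rfl

theorem yosida_mem {z : ℝ} (hz : 0 < z) (x : X) :
    R (z • hR.resolvent z x) (hR.yosida z x) := hR.smul z (hR.resolvent_mem hz x)

theorem yosida_commute {z w : ℝ} (hz : 0 < z) (hw : 0 < w) :
    Commute (hR.yosida z) (hR.yosida w) := by
  have h := hR.resolvent_commute hz hw
  refine Commute.smul_left (Commute.smul_right ?_ _) _
  refine Commute.sub_left (Commute.sub_right ?_ ?_) (Commute.sub_right ?_ ?_)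
  · exact (h.smul_left _).smul_right _
  · exact Commute.one_right _
  · exact Commute.one_left _
  · exact Commute.one_left _

/-- With `y = J_z x` one has `x = z y - L y` and `L_z x = z L y`, so `(L_z x, x) = z (z (y, L y) -
‖L y‖²)`. -/
theorem yosida_dissip {z : ℝ} (hz : 0 < z) (x : X) : inner ℝ (hR.yosida z x) x ≤ 0 := by
  set y := hR.resolvent z x with hy
  have h1 := hR.dissip (hR.resolvent_mem hz x)
  rw [← hy] at h1
  have h2 : inner ℝ (hR.yosida z x) x
      = z * (z * inner ℝ y (z • y - x) - inner ℝ (z • y - x) (z • y - x)) := by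
    rw [yosida_apply, ← hy]
    simp only [inner_smul_left, inner_smul_right, inner_sub_left, inner_sub_right,
      real_inner_comm x y, RCLike.conj_to_real]
    ring
  rw [h2]
  have h3 := real_inner_self_nonneg (F := X) (x := z • y - x)
  exact mul_nonpos_of_nonneg_of_nonpos hz.le
    (sub_nonpos.2 ((mul_nonpos_of_nonneg_of_nonpos hz.le h1).trans h3))

theorem norm_smul_resolvent_le {z : ℝ} (hz : 0 < z) (x : X) : ‖z • hR.resolvent z x‖ ≤ ‖x‖ := by
  rw [norm_smul, Real.norm_of_nonneg hz.le]
  have := mul_le_mul_of_nonneg_left (hR.norm_resolvent_le hz x) hz.le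
  rwa [← mul_assoc, mul_inv_cancel₀ hz.ne', one_mul] at this

theorem yosida_eq {z : ℝ} (hz : 0 < z) {x y : X} (h : R x y) :
    hR.yosida z x = z • hR.resolvent z y := by
  rw [yosida_apply]
  congr 1
  have := hR.resolvent_eq hz h
  rw [map_sub, map_smul, sub_eq_iff_eq_add] at this
  rw [this, add_sub_cancel_left]

/-- On the domain, `z J_z x - x = J_z L x` has norm at most `‖L x‖ / z`. Since the operators `z J_z`
are contractions and the domain is dense, convergence extends to all `x`. -/
theorem tendsto_smul_resolvent [CompleteSpace X] (x : X) :
    Tendsto (fun z => z • hR.resolvent z x) atTop (𝓝 x) := by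
  have hd : ∀ x ∈ Set.range (hR.resolvent 1),
      Tendsto (fun z => z • hR.resolvent z x) atTop (𝓝 x) := by
    rintro _ ⟨g, rfl⟩
    set y := (1 : ℝ) • hR.resolvent 1 g - g with hy
    have hm := hR.resolvent_mem one_pos g
    set x := hR.resolvent 1 g
    rw [tendsto_iff_norm_sub_tendsto_zero]
    refine squeeze_zero' (g := fun z => z⁻¹ * ‖y‖) (Eventually.of_forall fun _ => norm_nonneg _)
      ?_ (by simpa using tendsto_inv_atTop_zero.mul_const ‖y‖)
    filter_upwards [eventually_gt_atTop 0] with z hz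
    have := hR.resolvent_eq hz hm
    rw [map_sub, map_smul, sub_eq_iff_eq_add] at this
    rw [this, add_sub_cancel_left]
    exact hR.norm_resolvent_le hz _
  rw [Metric.tendsto_nhds]
  intro ε hε
  obtain ⟨x', hxx⟩ := (hR.denseRange_resolvent one_pos).exists_dist_lt x
    (show 0 < ε / 3 by positivity)
  filter_upwards [Metric.tendsto_nhds.1 (hd _ (mem_range_self x')) (ε / 3) (by positivity),
    eventually_gt_atTop 0] with z h1 hz
  have h2 : dist (z • hR.resolvent z x) (z • hR.resolvent z (hR.resolvent 1 x')) < ε / 3 := by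
    rw [dist_eq_norm, ← smul_sub, ← map_sub]
    exact (hR.norm_smul_resolvent_le hz _).trans_lt (by rwa [← dist_eq_norm])
  have h3 := dist_triangle4 (z • hR.resolvent z x) (z • hR.resolvent z (hR.resolvent 1 x'))
    (hR.resolvent 1 x') x
  rw [dist_comm (hR.resolvent 1 x') x] at h3
  linarith

end IsMaxDissipative

end MaximalDissipative

/-! ### Exponentials of bounded dissipative operators -/

section BoundedExponential

variable {X : Type*} [NormedAddCommGroup X] [InnerProductSpace ℝ X] [CompleteSpace X]

theorem hasDerivAt_exp_smul_apply (B : X →L[ℝ] X) (x : X) (t : ℝ) :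
    HasDerivAt (fun t : ℝ => NormedSpace.exp (t • B) x) (B (NormedSpace.exp (t • B) x)) t :=
  (hasDerivAt_exp_smul_const' (𝕂 := ℝ) B t).clm_apply (hasDerivAt_const t x) |>.congr_deriv (by
    simp)

theorem norm_exp_smul_apply_le {B : X →L[ℝ] X} (hB : ∀ x, inner ℝ (B x) x ≤ 0) (x : X) {t : ℝ}
    (ht : 0 ≤ t) : ‖NormedSpace.exp (t • B) x‖ ≤ ‖x‖ := by
  have hd : ∀ s, HasDerivAt (fun s : ℝ => ‖NormedSpace.exp (s • B) x‖ ^ 2)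
      (2 * inner ℝ (NormedSpace.exp (s • B) x) (B (NormedSpace.exp (s • B) x))) s :=
    fun s => (hasDerivAt_exp_smul_apply B x s).norm_sq
  have hanti : Antitone fun s : ℝ => ‖NormedSpace.exp (s • B) x‖ ^ 2 :=
    antitone_of_hasDerivAt_nonpos hd fun s => by
      have := hB (NormedSpace.exp (s • B) x)
      rw [real_inner_comm] at this
      exact mul_nonpos_of_nonneg_of_nonpos zero_le_two this
  have h := hanti ht
  simp only [zero_smul, NormedSpace.exp_zero, one_apply_eq_self] at h
  exact le_of_sq_le_sq h (norm_nonneg x)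

/-- The path `s ↦ e^{sB} e^{(t-s)C} x` joins the two vectors, and by commutation its velocity is
`e^{sB} e^{(t-s)C} (B - C) x`, where both exponentials are contractions. -/
theorem norm_exp_sub_exp_le {B C : X →L[ℝ] X} (hB : ∀ x, inner ℝ (B x) x ≤ 0)
    (hC : ∀ x, inner ℝ (C x) x ≤ 0) (hBC : Commute B C) (x : X) {t : ℝ} (ht : 0 ≤ t) :
    ‖NormedSpace.exp (t • B) x - NormedSpace.exp (t • C) x‖ ≤ t * ‖B x - C x‖ := by
  have hd : ∀ s, HasDerivAt
      (fun s : ℝ => (NormedSpace.exp (s • B)) (NormedSpace.exp ((t - s) • C) x))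
      (NormedSpace.exp (s • B) (NormedSpace.exp ((t - s) • C) (B x - C x))) s := by
    intro s
    have h1 : HasDerivAt (fun s : ℝ => NormedSpace.exp (s • B)) (NormedSpace.exp (s • B) * B) s :=
      hasDerivAt_exp_smul_const (𝕂 := ℝ) B s
    have h2 : HasDerivAt (fun s : ℝ => NormedSpace.exp ((t - s) • C) x)
        (-(NormedSpace.exp ((t - s) • C) (C x))) s := by
      have h3 := (hasDerivAt_exp_smul_const (𝕂 := ℝ) C (t - s)).clm_apply
        (hasDerivAt_const (t - s) x)
      have h4 := h3.scomp s ((hasDerivAt_id s).const_sub t)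
      refine h4.congr_deriv ?_
      simp
    refine (h1.clm_apply h2).congr_deriv ?_
    have h5 : B (NormedSpace.exp ((t - s) • C) x) = NormedSpace.exp ((t - s) • C) (B x) := by
      have : Commute B (NormedSpace.exp ((t - s) • C)) := (hBC.smul_right _).exp_right
      exact congrArg (fun T : X →L[ℝ] X => T x) this.eq
    rw [mul_apply_eq_comp, h5, map_sub, map_sub, map_neg, ← sub_eq_add_neg]
  have h := Convex.norm_image_sub_le_of_norm_hasDerivWithin_le (s := Icc 0 t)
    (f := fun s : ℝ => (NormedSpace.exp (s • B)) (NormedSpace.exp ((t - s) • C) x))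
    (C := ‖B x - C x‖) (fun s _ => (hd s).hasDerivWithinAt)
    (fun s hs => (norm_exp_smul_apply_le hB _ hs.1).trans
      (norm_exp_smul_apply_le hC _ (sub_nonneg.2 hs.2))) (convex_Icc 0 t)
    (left_mem_Icc.2 ht) (right_mem_Icc.2 ht)
  simp only [sub_self, zero_smul, NormedSpace.exp_zero, one_apply_eq_self, sub_zero,
    Real.norm_of_nonneg ht] at h
  rwa [mul_comm]

end BoundedExponential

/-! ### The semigroup generated by a maximal dissipative operator -/

section HilleYosida

variable {X : Type*} [NormedAddCommGroup X] [InnerProductSpace ℝ X] [CompleteSpace X]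
  {R : X → X → Prop} (hR : IsMaxDissipative R)

/-- A semigroup of contractions, extended by the identity to negative times, which is strongly
continuous. -/
structure IsContractionSemigroup (E : ℝ → X →L[ℝ] X) : Prop where
  zero : ∀ t ≤ 0, E t = ContinuousLinearMap.id ℝ X
  add : ∀ s t, 0 ≤ s → 0 ≤ t → ∀ x, E (s + t) x = E s (E t x)
  norm_le : ∀ t x, ‖E t x‖ ≤ ‖x‖
  continuous : ∀ x, Continuous fun t => E t x

namespace IsMaxDissipative

/-- For `x` in the domain, the distance between the approximations with parameters `z` and `w` is at
most `t ‖L_z x - L_w x‖`, which tends to `0` since `L_z x → L x`. Density and contractivity give the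
Cauchy property for every `x`. -/
theorem exists_tendsto_exp_yosida {t : ℝ} (ht : 0 ≤ t) (x : X) :
    ∃ y, Tendsto (fun z => NormedSpace.exp (t • hR.yosida z) x) atTop (𝓝 y) := by
  rw [← cauchy_map_iff_exists_tendsto, Metric.cauchy_iff]
  refine ⟨inferInstance, fun ε hε => ?_⟩
  obtain ⟨g, hxx⟩ := (hR.denseRange_resolvent one_pos).exists_dist_lt x
    (show 0 < ε / 3 by positivity)
  have hm := hR.resolvent_mem one_pos g
  set x' := hR.resolvent 1 g
  set y' := (1 : ℝ) • x' - g
  have hlim : Tendsto (fun q : ℝ × ℝ => t * ‖hR.yosida q.1 x' - hR.yosida q.2 x'‖)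
      (atTop ×ˢ atTop) (𝓝 0) := by
    have h1 : Tendsto (fun z => hR.yosida z x') atTop (𝓝 y') := by
      refine (hR.tendsto_smul_resolvent y').congr' ?_
      filter_upwards [eventually_gt_atTop 0] with z hz
      exact (hR.yosida_eq hz hm).symm
    have h2 := ((h1.comp tendsto_fst).sub (h1.comp (tendsto_snd (f := atTop)))).norm.const_mul t
    simpa using h2
  have h0 := (hlim.eventually_lt_const (show 0 < ε / 3 by positivity))
  rw [Filter.prod_atTop_atTop_eq, Filter.eventually_atTop] at h0
  obtain ⟨⟨a, b⟩, hab⟩ := h0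
  refine ⟨_, image_mem_map (Ioi_mem_atTop (max 0 (max a b))), ?_⟩
  rintro _ ⟨z, hz, rfl⟩ _ ⟨w, hw, rfl⟩
  simp only [mem_Ioi, max_lt_iff] at hz hw
  have h1 := norm_exp_sub_exp_le (hR.yosida_dissip hz.1) (hR.yosida_dissip hw.1)
    (hR.yosida_commute hz.1 hw.1) x' ht
  have h2 := hab (z, w) ⟨hz.2.1.le, hw.2.2.le⟩
  have h3 := norm_exp_smul_apply_le (hR.yosida_dissip hz.1) (x - x') ht
  have h4 := norm_exp_smul_apply_le (hR.yosida_dissip hw.1) (x - x') ht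
  rw [map_sub] at h3 h4
  rw [dist_eq_norm] at hxx
  have h5 := dist_triangle4 (NormedSpace.exp (t • hR.yosida z) x)
    (NormedSpace.exp (t • hR.yosida z) x') (NormedSpace.exp (t • hR.yosida w) x')
    (NormedSpace.exp (t • hR.yosida w) x)
  rw [dist_comm (NormedSpace.exp (t • hR.yosida w) x')] at h5
  simp only [dist_eq_norm] at h5 h2 ⊢
  linarith

theorem exists_semigroup_aux (t : ℝ) (ht : 0 ≤ t) :
    ∃ E : X →L[ℝ] X, (∀ x, Tendsto (fun z => NormedSpace.exp (t • hR.yosida z) x) atTop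
      (𝓝 (E x))) ∧ ∀ x, ‖E x‖ ≤ ‖x‖ := by
  choose y hy using hR.exists_tendsto_exp_yosida ht
  have hn : ∀ x, ‖y x‖ ≤ ‖x‖ := fun x => le_of_tendsto (hy x).norm (by
    filter_upwards [eventually_gt_atTop 0] with z hz
    exact norm_exp_smul_apply_le (hR.yosida_dissip hz) x ht)
  let J : X →ₗ[ℝ] X :=
    { toFun := y
      map_add' := fun a b => tendsto_nhds_unique (hy (a + b)) (by
        simpa using (hy a).add (hy b))
      map_smul' := fun c a => tendsto_nhds_unique (hy (c • a)) (by
        simpa using (hy a).const_smul c) }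
  exact ⟨J.mkContinuous 1 (fun x => (hn x).trans_eq (one_mul _).symm), hy, hn⟩

/-- The semigroup generated by the maximal dissipative operator with graph `R`, extended by the
identity to negative times. -/
noncomputable def semigroup (hR : IsMaxDissipative R) (t : ℝ) : X →L[ℝ] X :=
  (hR.exists_semigroup_aux (max t 0) (le_max_right _ _)).choose

theorem tendsto_semigroup {t : ℝ} (ht : 0 ≤ t) (x : X) :
    Tendsto (fun z => NormedSpace.exp (t • hR.yosida z) x) atTop (𝓝 (hR.semigroup t x)) := by
  have := (hR.exists_semigroup_aux (max t 0) (le_max_right _ _)).choose_spec.1 x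
  change Tendsto _ _ (𝓝 (hR.semigroup t x)) at this
  rwa [max_eq_left ht] at this

theorem norm_semigroup_le (t : ℝ) (x : X) : ‖hR.semigroup t x‖ ≤ ‖x‖ :=
  (hR.exists_semigroup_aux (max t 0) (le_max_right _ _)).choose_spec.2 x

theorem semigroup_of_nonpos {t : ℝ} (ht : t ≤ 0) :
    hR.semigroup t = ContinuousLinearMap.id ℝ X := by
  ext x
  have := (hR.exists_semigroup_aux (max t 0) (le_max_right _ _)).choose_spec.1 x
  change Tendsto _ _ (𝓝 (hR.semigroup t x)) at this
  rw [max_eq_right ht] at this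
  exact tendsto_nhds_unique this (by simp)

theorem semigroup_max (t : ℝ) : hR.semigroup (max t 0) = hR.semigroup t := by
  rcases le_total t 0 with h | h
  · rw [max_eq_right h, hR.semigroup_of_nonpos h, hR.semigroup_of_nonpos le_rfl]
  · rw [max_eq_left h]

theorem norm_semigroup_sub_le {x y : X} (h : R x y) {s t : ℝ} (hs : 0 ≤ s) (ht : 0 ≤ t) :
    ‖hR.semigroup t x - hR.semigroup s x‖ ≤ ‖y‖ * |t - s| := by
  refine le_of_tendsto ((hR.tendsto_semigroup ht x).sub (hR.tendsto_semigroup hs x)).norm ?_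
  filter_upwards [eventually_gt_atTop 0] with z hz
  refine Convex.norm_image_sub_le_of_norm_hasDerivWithin_le (s := Ici 0)
    (f := fun s : ℝ => NormedSpace.exp (s • hR.yosida z) x)
    (f' := fun s : ℝ => NormedSpace.exp (s • hR.yosida z) (hR.yosida z x))
    (fun s _ => HasDerivAt.hasDerivWithinAt ?_) (fun s hs => ?_) (convex_Ici 0) hs ht
  · exact ((hasDerivAt_exp_smul_const (𝕂 := ℝ) (hR.yosida z) s).clm_apply
      (hasDerivAt_const s x)).congr_deriv (by simp)
  · refine (norm_exp_smul_apply_le (hR.yosida_dissip hz) _ hs).trans ?_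
    rw [hR.yosida_eq hz h]
    exact hR.norm_smul_resolvent_le hz y

theorem continuous_semigroup (x : X) : Continuous fun t => hR.semigroup t x := by
  rw [Metric.continuous_iff]
  intro s ε hε
  obtain ⟨g, hxx⟩ := (hR.denseRange_resolvent one_pos).exists_dist_lt x
    (show 0 < ε / 3 by positivity)
  have hm := hR.resolvent_mem one_pos g
  set x' := hR.resolvent 1 g
  set y' := (1 : ℝ) • x' - g
  refine ⟨ε / 3 / (‖y'‖ + 1), by positivity, fun t ht => ?_⟩
  rw [dist_eq_norm, lt_div_iff₀ (by positivity)] at ht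
  have h1 := hR.norm_semigroup_sub_le hm (le_max_right s 0) (le_max_right t 0)
  rw [hR.semigroup_max, hR.semigroup_max] at h1
  have h2 : |max t 0 - max s 0| ≤ |t - s| := abs_max_sub_max_le_abs t s 0
  have h3 := hR.norm_semigroup_le t (x - x')
  have h4 := hR.norm_semigroup_le s (x - x')
  rw [map_sub] at h3 h4
  rw [dist_eq_norm] at hxx
  have h5 : ‖y'‖ * |max t 0 - max s 0| < ε / 3 := by
    refine lt_of_le_of_lt ?_ ht
    rw [Real.norm_eq_abs]
    nlinarith [norm_nonneg y', abs_nonneg (t - s)]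
  have h6 := dist_triangle4 (hR.semigroup t x) (hR.semigroup t x') (hR.semigroup s x')
    (hR.semigroup s x)
  rw [dist_comm (hR.semigroup s x')] at h6
  simp only [dist_eq_norm] at h6 ⊢
  linarith

/-- The law holds for each `e^{t L_z}`. In the limit the inner vector also varies with `z`, and
contractivity makes the resulting error vanish. -/
theorem semigroup_add {s t : ℝ} (hs : 0 ≤ s) (ht : 0 ≤ t) (x : X) :
    hR.semigroup (s + t) x = hR.semigroup s (hR.semigroup t x) := by
  refine tendsto_nhds_unique (hR.tendsto_semigroup (add_nonneg hs ht) x) ?_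
  have h1 := hR.tendsto_semigroup hs (hR.semigroup t x)
  have h2 : Tendsto (fun z => NormedSpace.exp (s • hR.yosida z)
      (NormedSpace.exp (t • hR.yosida z) x - hR.semigroup t x)) atTop (𝓝 0) := by
    rw [tendsto_zero_iff_norm_tendsto_zero]
    refine squeeze_zero' (Eventually.of_forall fun _ => norm_nonneg _) ?_
      (tendsto_iff_norm_sub_tendsto_zero.1 (hR.tendsto_semigroup ht x))
    filter_upwards [eventually_gt_atTop 0] with z hz
    exact norm_exp_smul_apply_le (hR.yosida_dissip hz) _ hs
  have h3 := h1.add h2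
  rw [add_zero] at h3
  refine h3.congr fun z => ?_
  let _ : NormedAlgebra ℚ (X →L[ℝ] X) := NormedAlgebra.restrictScalars ℚ ℝ (X →L[ℝ] X)
  rw [← map_add, add_sub_cancel, add_smul, NormedSpace.exp_add_of_commute
    (((Commute.refl _).smul_left _).smul_right _)]
  rfl

theorem isContractionSemigroup : IsContractionSemigroup hR.semigroup where
  zero _ ht := hR.semigroup_of_nonpos ht
  add _ _ hs ht x := hR.semigroup_add hs ht x
  norm_le := hR.norm_semigroup_le
  continuous := hR.continuous_semigroup

theorem semigroup_sub_eq_integral {x y : X} (h : R x y) {t : ℝ} (ht : 0 ≤ t) :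
    hR.semigroup t x - x = ∫ s in (0 : ℝ)..t, hR.semigroup s y := by
  have h1 : ∀ z, NormedSpace.exp (t • hR.yosida z) x - x
      = ∫ s in (0 : ℝ)..t, NormedSpace.exp (s • hR.yosida z) (hR.yosida z x) := fun z => by
    rw [intervalIntegral.integral_eq_sub_of_hasDerivAt
      (f := fun s : ℝ => NormedSpace.exp (s • hR.yosida z) x)]
    · simp
    · intro s _
      exact ((hasDerivAt_exp_smul_const (𝕂 := ℝ) (hR.yosida z) s).clm_apply
        (hasDerivAt_const s x)).congr_deriv (by simp)
    · exact (continuous_iff_continuousAt.2 fun s =>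
        (hasDerivAt_exp_smul_apply _ _ s).continuousAt).intervalIntegrable _ _
  refine tendsto_nhds_unique ((hR.tendsto_semigroup ht x).sub_const x) ?_
  simp_rw [h1]
  refine intervalIntegral.tendsto_integral_filter_of_dominated_convergence (fun _ => ‖y‖) ?_ ?_
    (by simp) ?_
  · exact Eventually.of_forall fun z => (continuous_iff_continuousAt.2 fun s =>
        (hasDerivAt_exp_smul_apply _ _ s).continuousAt).aestronglyMeasurable
  · filter_upwards [eventually_gt_atTop 0] with z hz
    refine Eventually.of_forall fun s hs => ?_
    rw [uIoc_of_le ht] at hs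
    refine (norm_exp_smul_apply_le (hR.yosida_dissip hz) _ hs.1.le).trans ?_
    rw [hR.yosida_eq hz h]
    exact hR.norm_smul_resolvent_le hz y
  · refine Eventually.of_forall fun s hs => ?_
    rw [uIoc_of_le ht] at hs
    have h2 : Tendsto (fun z => NormedSpace.exp (s • hR.yosida z) (hR.yosida z x - y)) atTop
        (𝓝 0) := by
      rw [tendsto_zero_iff_norm_tendsto_zero]
      refine squeeze_zero' (Eventually.of_forall fun _ => norm_nonneg _) ?_
        (tendsto_iff_norm_sub_tendsto_zero.1 (hR.tendsto_smul_resolvent y))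
      filter_upwards [eventually_gt_atTop 0] with z hz
      rw [← hR.yosida_eq hz h]
      exact norm_exp_smul_apply_le (hR.yosida_dissip hz) _ hs.1.le
    have h3 := (hR.tendsto_semigroup hs.1.le y).add h2
    rw [add_zero] at h3
    exact h3.congr fun z => by rw [← map_add, add_sub_cancel]

theorem tendsto_slope_semigroup {x y : X} (h : R x y) :
    Tendsto (fun t : ℝ => t⁻¹ • (hR.semigroup t x - x)) (𝓝[>] 0) (𝓝 y) := by
  have hc := hR.continuous_semigroup y
  have h1 : HasDerivAt (fun t => ∫ s in (0 : ℝ)..t, hR.semigroup s y) (hR.semigroup 0 y) 0 :=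
    intervalIntegral.integral_hasDerivAt_right (hc.intervalIntegrable _ _)
      hc.aestronglyMeasurable.stronglyMeasurableAtFilter hc.continuousAt
  rw [hR.semigroup_of_nonpos le_rfl] at h1
  have h2 := h1.tendsto_slope_zero_right
  refine h2.congr' ?_
  filter_upwards [self_mem_nhdsWithin] with t ht
  rw [hR.semigroup_sub_eq_integral h (le_of_lt ht)]
  simp

/-- A maximal dissipative operator has no proper dissipative extension. Given a limit `y` of the
quotients at `x`, take `(x', y')` in the graph with `x' - y' = x - y`. Contractivity gives `(x - x',
y - y') ≤ 0`, while `y - y' = x - x'`, so the two pairs coincide. -/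
theorem hasGenerator : HasGenerator hR.semigroup R := by
  intro x y
  refine ⟨hR.tendsto_slope_semigroup, fun h => ?_⟩
  obtain ⟨x', y', hm, he⟩ := hR.range 1 one_pos (x - y)
  rw [one_smul] at he
  have h1 := h.sub (hR.tendsto_slope_semigroup hm)
  have h2 : inner ℝ (x - x') (y - y') ≤ 0 := by
    refine le_of_tendsto ((tendsto_const_nhds (x := x - x')).inner h1) ?_
    filter_upwards [self_mem_nhdsWithin] with t ht
    have e : t⁻¹ • (hR.semigroup t x - x) - t⁻¹ • (hR.semigroup t x' - x')
        = t⁻¹ • (hR.semigroup t (x - x') - (x - x')) := by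
      rw [map_sub, ← smul_sub]
      congr 1
      abel
    rw [e, inner_smul_right, inner_sub_right, real_inner_self_eq_norm_sq]
    refine mul_nonpos_of_nonneg_of_nonpos (inv_nonneg.2 (le_of_lt ht)) ?_
    have h3 := real_inner_le_norm (x - x') (hR.semigroup t (x - x'))
    have h4 := hR.norm_semigroup_le t (x - x')
    nlinarith [norm_nonneg (x - x')]
  have h3 : y - y' = x - x' := by
    rw [← sub_eq_zero] at he ⊢
    rw [← he]
    abel
  rw [h3, real_inner_self_eq_norm_sq] at h2
  have h4 : x - x' = 0 := by
    rw [← norm_eq_zero]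
    exact pow_eq_zero_iff two_ne_zero |>.1 (le_antisymm h2 (sq_nonneg _))
  rw [h4] at h3
  rw [sub_eq_zero.1 h3, sub_eq_zero.1 h4]
  exact hm

end IsMaxDissipative

end HilleYosida

/-! ### Mild solutions with a prescribed forcing -/

section Duhamel

variable {X : Type*} [NormedAddCommGroup X] [InnerProductSpace ℝ X]

namespace IsContractionSemigroup

variable {E : ℝ → X →L[ℝ] X} (hE : IsContractionSemigroup E)

include hE in
-- Strong continuity becomes joint because contractions are equicontinuous. As the semigroup is the
-- identity at negative times, `τ ↦ E (t - τ) (g τ)` is continuous on all of `ℝ`, which settles the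
-- integrability questions below.
theorem continuous_uncurry : Continuous fun q : ℝ × X => E q.1 q.2 := by
  rw [continuous_iff_continuousAt]
  rintro ⟨t, x⟩
  have h1 : Tendsto (fun q : ℝ × X => E q.1 x) (𝓝 (t, x)) (𝓝 (E t x)) :=
    ((hE.continuous x).comp continuous_fst).continuousAt
  have h2 : Tendsto (fun q : ℝ × X => E q.1 (q.2 - x)) (𝓝 (t, x)) (𝓝 0) := by
    rw [tendsto_zero_iff_norm_tendsto_zero]
    refine squeeze_zero (fun _ => norm_nonneg _) (fun q => hE.norm_le q.1 (q.2 - x)) ?_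
    have : Continuous fun q : ℝ × X => ‖q.2 - x‖ := by fun_prop
    simpa using this.tendsto (t, x)
  have h3 := h1.add h2
  rw [add_zero] at h3
  exact h3.congr fun q => by rw [← map_add, add_sub_cancel]

include hE in
theorem continuous_comp {α : Type*} [TopologicalSpace α] {a : α → ℝ} {b : α → X}
    (ha : Continuous a) (hb : Continuous b) : Continuous fun q => E (a q) (b q) :=
  hE.continuous_uncurry.comp (ha.prodMk hb)

include hE in
theorem continuous_duhamel {g : ℝ → X} (hg : Continuous g) :
    Continuous fun t => ∫ τ in (0 : ℝ)..t, E (t - τ) (g τ) := by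
  refine intervalIntegral.continuous_parametric_intervalIntegral_of_continuous
    (f := fun t τ => E (t - τ) (g τ)) ?_ continuous_id
  exact hE.continuous_comp (continuous_fst.sub continuous_snd) (hg.comp continuous_snd)

include hE in
theorem tendsto_slope_duhamel {g : ℝ → X} (hg : Continuous g) [CompleteSpace X] :
    Tendsto (fun h : ℝ => h⁻¹ • ∫ τ in (0 : ℝ)..h, E (h - τ) (g τ)) (𝓝[>] 0) (𝓝 (g 0)) := by
  have hc : Continuous fun q : ℝ × ℝ => E (q.1 - q.2) (g q.2) :=
    hE.continuous_comp (continuous_fst.sub continuous_snd) (hg.comp continuous_snd)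
  rw [Metric.tendsto_nhds]
  intro ε hε
  have h1 := Metric.continuous_iff.1 hc (0, 0) (ε / 2) (by positivity)
  obtain ⟨δ, hδ, h1⟩ := h1
  simp only [sub_self, hE.zero 0 le_rfl, ContinuousLinearMap.id_apply] at h1
  filter_upwards [Ioo_mem_nhdsGT hδ] with h hh
  have h2 : ‖∫ τ in (0 : ℝ)..h, (E (h - τ) (g τ) - g 0)‖ ≤ ε / 2 * |h - 0| := by
    refine intervalIntegral.norm_integral_le_of_norm_le_const fun τ hτ => ?_
    rw [uIoc_of_le hh.1.le] at hτ
    rw [← dist_eq_norm]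
    refine (h1 (h, τ) ?_).le
    rw [Prod.dist_eq, max_lt_iff]
    simp only [dist_zero_right, Real.norm_eq_abs, abs_of_pos hh.1, abs_of_pos hτ.1]
    exact ⟨hh.2, hτ.2.trans_lt hh.2⟩
  have hi : Continuous fun τ => E (h - τ) (g τ) :=
    hE.continuous_comp (continuous_const.sub continuous_id) hg
  rw [intervalIntegral.integral_sub (hi.intervalIntegrable _ _) (by simp),
    intervalIntegral.integral_const, sub_zero, abs_of_pos hh.1] at h2
  have e : h⁻¹ • (∫ τ in (0 : ℝ)..h, E (h - τ) (g τ)) - g 0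
      = h⁻¹ • ((∫ τ in (0 : ℝ)..h, E (h - τ) (g τ)) - h • g 0) := by
    rw [smul_sub, smul_smul, inv_mul_cancel₀ hh.1.ne', one_smul]
  rw [dist_eq_norm, e, norm_smul, norm_inv, Real.norm_of_nonneg hh.1.le, inv_mul_lt_iff₀ hh.1]
  refine h2.trans_lt ?_
  nlinarith [hh.1]

end IsContractionSemigroup

/-- `U` is the mild solution of `U' = L U + g`, `U(0) = x` on `[0, T]`. -/
structure IsForcedSolution (E : ℝ → X →L[ℝ] X) (g : ℝ → X) (x : X) (T : ℝ) (U : ℝ → X) : Prop where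
  continuous_forcing : Continuous g
  continuous : Continuous U
  eq : ∀ t ∈ Icc 0 T, U t = E t x + ∫ τ in (0 : ℝ)..t, E (t - τ) (g τ)

namespace IsForcedSolution

variable {E : ℝ → X →L[ℝ] X} (hE : IsContractionSemigroup E) {g : ℝ → X} {x : X} {T : ℝ}
  {U : ℝ → X} (hU : IsForcedSolution E g x T U)

include hE hU in
theorem apply_zero (hT : 0 ≤ T) : U 0 = x := by
  rw [hU.eq 0 ⟨le_rfl, hT⟩, hE.zero 0 le_rfl]
  simp

include hE hU in
-- The Duhamel integral over `[0, s + t]` splits at `s`: the semigroup law pulls `E t` out of the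
-- first part, and a translation turns the second into the new Duhamel term.
theorem shift [CompleteSpace X] {s : ℝ} (hs : 0 ≤ s) :
    IsForcedSolution E (fun t => g (s + t)) (U s) (T - s) (fun t => U (s + t)) := by
  have hg := hU.continuous_forcing
  refine ⟨hg.comp (continuous_const.add continuous_id),
    hU.continuous.comp (continuous_const.add continuous_id), fun t ht => ?_⟩
  have hst : s + t ∈ Icc 0 T := ⟨by linarith [ht.1], by linarith [ht.2]⟩
  have hsT : s ∈ Icc 0 T := ⟨hs, by linarith [ht.1, ht.2]⟩
  have hc : ∀ r : ℝ, Continuous fun τ => E (r - τ) (g τ) := fun r =>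
    hE.continuous_comp (continuous_const.sub continuous_id) hg
  rw [hU.eq _ hst, hU.eq s hsT, map_add, ← hE.add t s ht.1 hs, add_comm t s, add_assoc]
  congr 1
  rw [← intervalIntegral.integral_add_adjacent_intervals ((hc (s + t)).intervalIntegrable 0 s)
    ((hc (s + t)).intervalIntegrable s (s + t))]
  congr 1
  · rw [← ContinuousLinearMap.intervalIntegral_comp_comm _ ((hc s).intervalIntegrable 0 s)]
    refine intervalIntegral.integral_congr fun τ hτ => ?_
    rw [uIcc_of_le hs] at hτ
    change E (s + t - τ) (g τ) = E t (E (s - τ) (g τ))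
    rw [← hE.add t (s - τ) ht.1 (sub_nonneg.2 hτ.2)]
    congr 2
    ring
  · have := intervalIntegral.integral_comp_add_left (fun τ => E (s + t - τ) (g τ)) s
      (a := 0) (b := t)
    rw [add_zero] at this
    rw [← this]
    refine intervalIntegral.integral_congr fun τ _ => ?_
    simp only [add_sub_add_left_eq_sub]

end IsForcedSolution

end Duhamel

/-! ### Time integrals and the energy inequality of mild solutions -/

section Energy

variable {X : Type*} [NormedAddCommGroup X] [InnerProductSpace ℝ X] [CompleteSpace X]
  {R : X → X → Prop} (hR : IsMaxDissipative R) {g : ℝ → X} {x : X} {T : ℝ} {U : ℝ → X}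

theorem _root_.Continuous.hasDerivAt_integral_zero {f : ℝ → X} (hf : Continuous f) (t : ℝ) :
    HasDerivAt (fun t => ∫ s in (0 : ℝ)..t, f s) (f t) t :=
  intervalIntegral.integral_hasDerivAt_right (hf.intervalIntegrable _ _)
    hf.aestronglyMeasurable.stronglyMeasurableAtFilter hf.continuousAt

namespace IsMaxDissipative

/-- With `J = (1 - L)⁻¹`, the curve `J U` takes values in the domain of `L`, and `L J U = J U - U`.
A right derivative is all that the semigroup provides, and it suffices for the fundamental theorem
of calculus. -/
theorem hasDerivWithinAt_resolvent_solution (hU : IsForcedSolution hR.semigroup g x T U) {t : ℝ}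
    (ht : t ∈ Ico 0 T) : HasDerivWithinAt (fun t => hR.resolvent 1 (U t))
      (hR.resolvent 1 (U t) - U t + hR.resolvent 1 (g t)) (Ioi t) t := by
  have hE := hR.isContractionSemigroup
  set J := hR.resolvent 1
  have h1 := hU.shift hE ht.1
  have hm := hR.resolvent_mem one_pos (U t)
  rw [one_smul] at hm
  have h2 := hR.tendsto_slope_semigroup hm
  have h3 := hE.tendsto_slope_duhamel h1.continuous_forcing
  rw [add_zero] at h3
  have h4 := h2.add ((J.continuous.tendsto _).comp h3)
  rw [hasDerivWithinAt_iff_tendsto_slope' (by simp)]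
  have h5 : Tendsto (fun r => r - t) (𝓝[>] t) (𝓝[>] 0) := by
    refine tendsto_nhdsWithin_iff.2 ⟨?_, ?_⟩
    · have : Continuous fun r => r - t := by fun_prop
      exact (this.tendsto' t 0 (sub_self t)).mono_left nhdsWithin_le_nhds
    · filter_upwards [self_mem_nhdsWithin] with r hr
      exact mem_Ioi.2 (sub_pos.2 (mem_Ioi.1 hr))
  refine (h4.comp h5).congr' ?_
  filter_upwards [Ioo_mem_nhdsGT ht.2] with r hr
  have h6 := h1.eq (r - t) ⟨sub_nonneg.2 hr.1.le, sub_le_sub_right hr.2.le t⟩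
  simp only [add_sub_cancel] at h6
  have hcomm : J (hR.semigroup (r - t) (U t)) = hR.semigroup (r - t) (J (U t)) := by
    have hs : 0 ≤ r - t := sub_nonneg.2 hr.1.le
    refine tendsto_nhds_unique ((J.continuous.tendsto _).comp (hR.tendsto_semigroup hs (U t))) ?_
    refine (hR.tendsto_semigroup hs (J (U t))).congr' ?_
    filter_upwards [eventually_gt_atTop 0] with z hz
    have hc : Commute J (NormedSpace.exp ((r - t) • hR.yosida z)) := by
      refine Commute.exp_right (Commute.smul_right ?_ _)
      exact Commute.smul_right (Commute.sub_right
        ((hR.resolvent_commute one_pos hz).smul_right _) (Commute.one_right _)) _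
    exact (congrArg (fun T : X →L[ℝ] X => T (U t)) hc.eq).symm
  rw [slope_def_module, h6, map_add, hcomm]
  simp only [Function.comp_apply, map_smul]
  rw [← smul_add]
  congr 1
  abel

/-- The time integral `Y` of a mild solution lies in the domain of `L`, and
`L Y(t) = U(t) - U(0) - ∫₀ᵗ g`. -/
theorem integral_mem (hU : IsForcedSolution hR.semigroup g x T U) {t : ℝ} (ht : t ∈ Icc 0 T) :
    R (∫ s in (0 : ℝ)..t, U s) (U t - x - ∫ s in (0 : ℝ)..t, g s) := by
  have hE := hR.isContractionSemigroup
  set J := hR.resolvent 1 with hJ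
  have hc : Continuous fun t => J (U t) - U t + J (g t) :=
    ((J.continuous.comp hU.continuous).sub hU.continuous).add
      (J.continuous.comp hU.continuous_forcing)
  have h1 := intervalIntegral.integral_eq_sub_of_hasDeriv_right (a := 0) (b := t)
    (f := fun t => J (U t)) (f' := fun t => J (U t) - U t + J (g t))
    (J.continuous.comp hU.continuous).continuousOn (fun r hr => by
      rw [min_eq_left ht.1, max_eq_right ht.1] at hr
      exact hR.hasDerivWithinAt_resolvent_solution hU ⟨hr.1.le, hr.2.trans_le ht.2⟩)
    (hc.intervalIntegrable _ _)
  have hJU : IntervalIntegrable (fun s => J (U s)) volume 0 t :=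
    (J.continuous.comp hU.continuous).intervalIntegrable _ _
  have hJg : IntervalIntegrable (fun s => J (g s)) volume 0 t :=
    (J.continuous.comp hU.continuous_forcing).intervalIntegrable _ _
  have hUi := hU.continuous.intervalIntegrable (μ := volume) 0 t
  have hgi := hU.continuous_forcing.intervalIntegrable (μ := volume) 0 t
  rw [intervalIntegral.integral_add (hJU.sub hUi) hJg, intervalIntegral.integral_sub hJU hUi] at h1
  rw [J.intervalIntegral_comp_comm hUi, J.intervalIntegral_comp_comm hgi,
    hU.apply_zero hE (ht.1.trans ht.2)] at h1
  set Y := ∫ s in (0 : ℝ)..t, U s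
  set G := ∫ s in (0 : ℝ)..t, g s
  -- The integrated identity says that `Y` is the resolvent of `Y - (U t - x - G)`, that is, `Y` is
  -- in the domain and `Y - L Y` is this vector.
  have h2 : J (Y - (U t - x - G)) = Y := by
    simp only [map_sub]
    rw [← sub_eq_zero] at h1 ⊢
    rw [← h1]
    abel
  have h3 := hR.resolvent_mem one_pos (Y - (U t - x - G))
  rw [← hJ, h2, one_smul, sub_sub_cancel] at h3
  exact h3

/-- The regularized curve `z J_z U` is continuously differentiable and lies in the domain of `L`,
where `L (z J_z U) = L_z U` is bounded in `U`. So the pointwise inequality for `q` may be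
integrated. -/
theorem energy_yosida_le (hU : IsForcedSolution hR.semigroup g x T U) {q : X → ℝ}
    (hq : Continuous q) (hqR : ∀ {x y}, R x y → inner ℝ x y ≤ -q x) {t : ℝ} (ht : t ∈ Icc 0 T)
    {z : ℝ} (hz : 0 < z) :
    1 / 2 * ‖z • hR.resolvent z (U t)‖ ^ 2 + (∫ s in (0 : ℝ)..t, q (z • hR.resolvent z (U s)))
      ≤ 1 / 2 * ‖z • hR.resolvent z x‖ ^ 2
        + ∫ s in (0 : ℝ)..t, inner ℝ (z • hR.resolvent z (U s)) (z • hR.resolvent z (g s)) := by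
  set J : X →L[ℝ] X := z • hR.resolvent z with hJ
  set L := hR.yosida z with hL
  change 1 / 2 * ‖J (U t)‖ ^ 2 + (∫ s in (0 : ℝ)..t, q (J (U s)))
      ≤ 1 / 2 * ‖J x‖ ^ 2 + ∫ s in (0 : ℝ)..t, inner ℝ (J (U s)) (J (g s))
  have hUc := hU.continuous
  have hgc := hU.continuous_forcing
  -- This is the regularized curve written as an integral, with `L` moved onto `∫ U` through its
  -- bounded approximation. It is differentiable for all times and agrees with `J (U s)` on `[0,
  -- T]`.
  let W : ℝ → X := fun t => J x + J (∫ s in (0 : ℝ)..t, g s) + L (∫ s in (0 : ℝ)..t, U s)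
  have hW : ∀ s ∈ Icc 0 T, W s = J (U s) := fun s hs => by
    have h1 : L (∫ s in (0 : ℝ)..s, U s) = J (U s - x - ∫ s in (0 : ℝ)..s, g s) :=
      hR.yosida_eq hz (hR.integral_mem hU hs)
    simp only [W, h1, map_sub]
    abel
  have hWd : ∀ s, HasDerivAt W (J (g s) + L (U s)) s := fun s =>
    ((J.hasFDerivAt.comp_hasDerivAt s (hgc.hasDerivAt_integral_zero s)).const_add (J x)).add
      (L.hasFDerivAt.comp_hasDerivAt s (hUc.hasDerivAt_integral_zero s))
  have hWc : Continuous W := continuous_iff_continuousAt.2 fun s => (hWd s).continuousAt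
  have hdc : Continuous fun s => J (g s) + L (U s) :=
    (J.continuous.comp hgc).add (L.continuous.comp hUc)
  have h1 := intervalIntegral.integral_eq_sub_of_hasDerivAt (a := 0) (b := t)
    (f := fun s => ‖W s‖ ^ 2) (f' := fun s => 2 * inner ℝ (W s) (J (g s) + L (U s)))
    (fun s _ => (hWd s).norm_sq) ((continuous_const.mul (hWc.inner hdc)).intervalIntegrable _ _)
  have hW0 : W 0 = J x := by simp [W]
  rw [hW t ht, hW0, intervalIntegral.integral_const_mul] at h1
  have hJU : Continuous fun s => J (U s) := J.continuous.comp hUc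
  have hJg : Continuous fun s => J (g s) := J.continuous.comp hgc
  have hqJ : Continuous fun s => q (J (U s)) := hq.comp hJU
  have h2 : (∫ s in (0 : ℝ)..t, inner ℝ (W s) (J (g s) + L (U s)))
      ≤ ∫ s in (0 : ℝ)..t, (inner ℝ (J (U s)) (J (g s)) - q (J (U s))) := by
    refine intervalIntegral.integral_mono_on ht.1 ((hWc.inner hdc).intervalIntegrable _ _)
      (((hJU.inner hJg).sub hqJ).intervalIntegrable _ _) fun s hs => ?_
    rw [hW s ⟨hs.1, hs.2.trans ht.2⟩, inner_add_right]
    have := hqR (hR.yosida_mem hz (U s))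
    change inner ℝ (J (U s)) (L (U s)) ≤ -q (J (U s)) at this
    linarith
  rw [intervalIntegral.integral_sub ((hJU.inner hJg).intervalIntegrable _ _)
    (hqJ.intervalIntegrable _ _)] at h2
  linarith

/-- The energy inequality for mild solutions of the linear problem. -/
theorem energy_le (hU : IsForcedSolution hR.semigroup g x T U) {q : X → ℝ}
    (hq : Continuous q) (hqR : ∀ {x y}, R x y → inner ℝ x y ≤ -q x) {C : ℝ}
    (hqC : ∀ x, |q x| ≤ C * ‖x‖ ^ 2) {t : ℝ} (ht : t ∈ Icc 0 T) :
    1 / 2 * ‖U t‖ ^ 2 + (∫ s in (0 : ℝ)..t, q (U s))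
      ≤ 1 / 2 * ‖x‖ ^ 2 + ∫ s in (0 : ℝ)..t, inner ℝ (U s) (g s) := by
  have hUc := hU.continuous
  have hgc := hU.continuous_forcing
  have hcJ : ∀ (z : ℝ) {h : ℝ → X}, Continuous h → Continuous fun s => z • hR.resolvent z (h s) :=
    fun z h hh => ((hR.resolvent z).continuous.comp hh).const_smul z
  have hlim := fun y => hR.tendsto_smul_resolvent y
  have h1 : Tendsto (fun z => ∫ s in (0 : ℝ)..t, q (z • hR.resolvent z (U s))) atTop
      (𝓝 (∫ s in (0 : ℝ)..t, q (U s))) := by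
    refine intervalIntegral.tendsto_integral_filter_of_dominated_convergence
      (fun s => |C| * ‖U s‖ ^ 2) (Eventually.of_forall fun z =>
        (hq.comp (hcJ z hUc)).aestronglyMeasurable) ?_
      ((continuous_const.mul (hUc.norm.pow 2)).intervalIntegrable _ _)
      (Eventually.of_forall fun s _ => (hq.tendsto _).comp (hlim (U s)))
    filter_upwards [eventually_gt_atTop 0] with z hz
    refine Eventually.of_forall fun s _ => ?_
    rw [Real.norm_eq_abs]
    refine (hqC _).trans (mul_le_mul (le_abs_self C) ?_ (by positivity) (abs_nonneg C))
    exact pow_le_pow_left₀ (norm_nonneg _) (hR.norm_smul_resolvent_le hz _) 2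
  have h2 : Tendsto (fun z => ∫ s in (0 : ℝ)..t,
      inner ℝ (z • hR.resolvent z (U s)) (z • hR.resolvent z (g s))) atTop
      (𝓝 (∫ s in (0 : ℝ)..t, inner ℝ (U s) (g s))) := by
    refine intervalIntegral.tendsto_integral_filter_of_dominated_convergence
      (fun s => ‖U s‖ * ‖g s‖) (Eventually.of_forall fun z =>
        ((hcJ z hUc).inner (hcJ z hgc)).aestronglyMeasurable) ?_
      ((hUc.norm.mul hgc.norm).intervalIntegrable _ _)
      (Eventually.of_forall fun s _ => (hlim (U s)).inner (hlim (g s)))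
    filter_upwards [eventually_gt_atTop 0] with z hz
    refine Eventually.of_forall fun s _ => ?_
    exact (norm_inner_le_norm _ _).trans (mul_le_mul (hR.norm_smul_resolvent_le hz _)
      (hR.norm_smul_resolvent_le hz _) (norm_nonneg _) (norm_nonneg _))
  refine le_of_tendsto_of_tendsto ((((hlim (U t)).norm.pow 2).const_mul (1 / 2)).add h1)
    ((((hlim x).norm.pow 2).const_mul (1 / 2)).add h2) ?_
  filter_upwards [eventually_gt_atTop 0] with z hz
  exact hR.energy_yosida_le hU hq hqR ht hz

end IsMaxDissipative

end Energy

/-! ### Gronwall's inequality -/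

/-- The right-hand side of the integral inequality times `e^{-Bt}` is nonincreasing. No sign of `y`
or `A` is needed. -/
theorem le_mul_exp_of_le_add_mul_integral {y : ℝ → ℝ} (hy : Continuous y) {A B T : ℝ}
    (hB : 0 ≤ B) (h : ∀ t ∈ Icc 0 T, y t ≤ A + B * ∫ s in (0 : ℝ)..t, y s) {t : ℝ}
    (ht : t ∈ Icc 0 T) : y t ≤ A * Real.exp (B * t) := by
  let F : ℝ → ℝ := fun t => Real.exp (-(B * t)) * (A + B * ∫ s in (0 : ℝ)..t, y s)
  have hd : ∀ s, HasDerivAt F (Real.exp (-(B * s)) * (B * (y s - (A + B * ∫ r in (0 : ℝ)..s, y r))))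
      s := fun s => by
    have h1 : HasDerivAt (fun t => Real.exp (-(B * t))) (Real.exp (-(B * s)) * -(B * 1)) s :=
      (((hasDerivAt_id s).const_mul B).neg).exp
    refine (h1.mul (((hy.hasDerivAt_integral_zero s).const_mul B).const_add A)).congr_deriv ?_
    ring
  have hanti : AntitoneOn F (Icc 0 T) := by
    refine antitoneOn_of_deriv_nonpos (convex_Icc 0 T)
      (fun s _ => (hd s).continuousAt.continuousWithinAt)
      (fun s _ => (hd s).differentiableAt.differentiableWithinAt) fun s hs => ?_
    rw [interior_Icc] at hs
    rw [(hd s).deriv]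
    exact mul_nonpos_of_nonneg_of_nonpos (Real.exp_pos _).le
      (mul_nonpos_of_nonneg_of_nonpos hB (sub_nonpos.2 (h s ⟨hs.1.le, hs.2.le⟩)))
  have h1 := hanti (left_mem_Icc.2 (ht.1.trans ht.2)) ht ht.1
  have h2 : F 0 = A := by simp [F]
  rw [h2] at h1
  refine (h t ht).trans ?_
  have h3 := mul_le_mul_of_nonneg_right h1 (Real.exp_pos (B * t)).le
  simp only [F] at h3
  rwa [mul_right_comm, ← Real.exp_add, neg_add_cancel, Real.exp_zero, one_mul] at h3

/-! ### Radial truncation of locally Lipschitz maps -/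

section Truncation

variable {X : Type*} [NormedAddCommGroup X] [NormedSpace ℝ X]

/-- The radial retraction onto the ball of radius `r`. -/
noncomputable def radialRetraction (r : ℝ) (x : X) : X := (r / max r ‖x‖) • x

theorem radialRetraction_eq_self {r : ℝ} (hr : 0 < r) {x : X} (hx : ‖x‖ ≤ r) :
    radialRetraction r x = x := by
  rw [radialRetraction, max_eq_left hx, div_self hr.ne', one_smul]

theorem norm_radialRetraction_le {r : ℝ} (hr : 0 < r) (x : X) : ‖radialRetraction r x‖ ≤ r := by
  have h : 0 < max r ‖x‖ := hr.trans_le (le_max_left _ _)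
  rw [radialRetraction, norm_smul, Real.norm_of_nonneg (by positivity), div_mul_eq_mul_div,
    div_le_iff₀ h]
  exact mul_le_mul_of_nonneg_left (le_max_right _ _) hr.le

/-- The difference splits into a contracted `x - y` and a change of the scaling factor acting on
`y`. Each contributes at most `‖x - y‖`, because `x ↦ max r ‖x‖` is `1`-Lipschitz and `‖y‖ ≤ max r
‖y‖`. -/
theorem norm_radialRetraction_sub_le {r : ℝ} (hr : 0 < r) (x y : X) :
    ‖radialRetraction r x - radialRetraction r y‖ ≤ 2 * ‖x - y‖ := by
  have hx : 0 < max r ‖x‖ := hr.trans_le (le_max_left _ _)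
  have hy : 0 < max r ‖y‖ := hr.trans_le (le_max_left _ _)
  have e : radialRetraction r x - radialRetraction r y
      = (r / max r ‖x‖) • (x - y) + (r / max r ‖x‖ - r / max r ‖y‖) • y := by
    simp only [radialRetraction]
    module
  have h1 : ‖(r / max r ‖x‖) • (x - y)‖ ≤ ‖x - y‖ := by
    rw [norm_smul, Real.norm_of_nonneg (by positivity)]
    exact mul_le_of_le_one_left (norm_nonneg _) ((div_le_one hx).2 (le_max_left _ _))
  have h2 : ‖(r / max r ‖x‖ - r / max r ‖y‖) • y‖ ≤ ‖x - y‖ := by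
    have e2 : r / max r ‖x‖ - r / max r ‖y‖
        = r / max r ‖x‖ * ((max r ‖y‖ - max r ‖x‖) / max r ‖y‖) := by
      field_simp
    have h3 : |max r ‖y‖ - max r ‖x‖| ≤ ‖x - y‖ := by
      rw [max_comm r ‖y‖, max_comm r ‖x‖, norm_sub_rev]
      exact (abs_max_sub_max_le_abs _ _ _).trans (abs_norm_sub_norm_le y x)
    rw [norm_smul, e2, norm_mul, Real.norm_of_nonneg (show 0 ≤ r / max r ‖x‖ by positivity),
      norm_div, Real.norm_of_nonneg hy.le, Real.norm_eq_abs, mul_assoc]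
    have h4 : |max r ‖y‖ - max r ‖x‖| / max r ‖y‖ * ‖y‖ ≤ ‖x - y‖ := by
      rw [div_mul_eq_mul_div, div_le_iff₀ hy]
      exact mul_le_mul h3 (le_max_right _ _) (norm_nonneg _) (norm_nonneg _)
    refine (mul_le_of_le_one_left (by positivity) ((div_le_one hx).2 (le_max_left _ _))).trans h4
  rw [e]
  linarith [norm_add_le ((r / max r ‖x‖) • (x - y)) ((r / max r ‖x‖ - r / max r ‖y‖) • y)]

/-- Lipschitz continuity on bounded sets. -/
def IsLocallyLipschitz (f : X → X) : Prop :=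
  ∀ r : ℝ, ∃ K : ℝ, 0 ≤ K ∧ ∀ x y, ‖x‖ ≤ r → ‖y‖ ≤ r → ‖f x - f y‖ ≤ K * ‖x - y‖

theorem continuous_of_norm_sub_le {X : Type*} [NormedAddCommGroup X] {f : X → X} {K : ℝ}
    (h : ∀ x y, ‖f x - f y‖ ≤ K * ‖x - y‖) : Continuous f := by
  refine (LipschitzWith.of_dist_le_mul (K := K.toNNReal) fun x y => ?_).continuous
  rw [dist_eq_norm, dist_eq_norm]
  exact (h x y).trans (mul_le_mul_of_nonneg_right (Real.le_coe_toNNReal K) (norm_nonneg _))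

theorem IsLocallyLipschitz.comp_radialRetraction {f : X → X} (hf : IsLocallyLipschitz f) {r : ℝ}
    (hr : 0 < r) :
    ∃ K : ℝ, 0 ≤ K ∧
      ∀ x y, ‖f (radialRetraction r x) - f (radialRetraction r y)‖ ≤ K * ‖x - y‖ := by
  obtain ⟨K, hK, h⟩ := hf r
  refine ⟨K * 2, by positivity, fun x y => ?_⟩
  refine (h _ _ (norm_radialRetraction_le hr x) (norm_radialRetraction_le hr y)).trans ?_
  rw [mul_assoc]
  exact mul_le_mul_of_nonneg_left (norm_radialRetraction_sub_le hr x y) hK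

theorem IsLocallyLipschitz.continuous {f : X → X} (hf : IsLocallyLipschitz f) : Continuous f := by
  rw [continuous_iff_continuousAt]
  intro x
  have hr : 0 < ‖x‖ + 1 := by positivity
  obtain ⟨K, _, h⟩ := hf.comp_radialRetraction hr
  refine (continuous_of_norm_sub_le h).continuousAt.congr ?_
  have : ∀ᶠ y in 𝓝 x, ‖y‖ < ‖x‖ + 1 :=
    continuous_norm.continuousAt.eventually_lt_const (lt_add_one ‖x‖)
  filter_upwards [this] with y hy
  rw [radialRetraction_eq_self hr hy.le]

end Truncation

/-! ### Global well-posedness of the semilinear problem -/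

section Semilinear

variable {X : Type*} [NormedAddCommGroup X] [InnerProductSpace ℝ X]
  {E : ℝ → X →L[ℝ] X} {f : X → X}

/-- A mild solution on `[0, T]` of `U' = L U + f(U)` that is continuously extended to `ℝ`. -/
abbrev IsExtendedSolution (E : ℝ → X →L[ℝ] X) (f : X → X) (x : X) (T : ℝ) (U : ℝ → X) : Prop :=
  IsForcedSolution E (fun t => f (U t)) x T U

theorem IsExtendedSolution.isMildSolution {x : X} {T : ℝ} {U : ℝ → X}
    (h : IsExtendedSolution E f x T U) : IsMildSolution E f x T U :=
  ⟨h.continuous.continuousOn, h.eq⟩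

/-- The values at the endpoints are continued constantly. The Duhamel formula on `[0, T]` sees only
times in `[0, T]`. -/
theorem IsMildSolution.exists_extension (hf : Continuous f) {x : X} {T : ℝ} (hT : 0 ≤ T)
    {U : ℝ → X} (h : IsMildSolution E f x T U) :
    ∃ V, IsExtendedSolution E f x T V ∧ ∀ t ∈ Icc 0 T, V t = U t := by
  have hV : Continuous (IccExtend hT ((Icc 0 T).domRestrict U)) :=
    (continuousOn_iff_continuous_domRestrict.1 h.1).Icc_extend'
  have heq : ∀ t ∈ Icc 0 T, IccExtend hT ((Icc 0 T).domRestrict U) t = U t := fun t ht =>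
    IccExtend_of_mem hT _ ht
  refine ⟨_, ⟨hf.comp hV, hV, fun t ht => ?_⟩, heq⟩
  rw [heq t ht, h.2 t ht]
  congr 1
  refine intervalIntegral.integral_congr fun τ hτ => ?_
  rw [uIcc_of_le ht.1] at hτ
  simp only [heq τ ⟨hτ.1, hτ.2.trans ht.2⟩]

theorem IsExtendedSolution.mono {x : X} {T T' : ℝ} {U : ℝ → X} (h : IsExtendedSolution E f x T U)
    (hT : T' ≤ T) : IsExtendedSolution E f x T' U :=
  ⟨h.continuous_forcing, h.continuous, fun t ht => h.eq t ⟨ht.1, ht.2.trans hT⟩⟩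

/-- Continuous dependence on the initial state. -/
theorem IsExtendedSolution.norm_sub_le (hE : IsContractionSemigroup E) {r K : ℝ} (hK : 0 ≤ K)
    (hf : ∀ x y, ‖x‖ ≤ r → ‖y‖ ≤ r → ‖f x - f y‖ ≤ K * ‖x - y‖) {x y : X} {T : ℝ} {U V : ℝ → X}
    (hU : IsExtendedSolution E f x T U) (hV : IsExtendedSolution E f y T V)
    (hUr : ∀ t ∈ Icc 0 T, ‖U t‖ ≤ r) (hVr : ∀ t ∈ Icc 0 T, ‖V t‖ ≤ r) {t : ℝ}
    (ht : t ∈ Icc 0 T) : ‖U t - V t‖ ≤ ‖x - y‖ * Real.exp (K * t) := by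
  refine le_mul_exp_of_le_add_mul_integral (y := fun t => ‖U t - V t‖)
    (hU.continuous.sub hV.continuous).norm hK (fun t ht => ?_) ht
  have hc : ∀ {g : ℝ → X}, Continuous g →
      IntervalIntegrable (fun τ => E (t - τ) (g τ)) volume 0 t := fun hg =>
    (hE.continuous_comp (continuous_const.sub continuous_id) hg).intervalIntegrable _ _
  have e : U t - V t = E t (x - y)
      + ∫ τ in (0 : ℝ)..t, (E (t - τ) (f (U τ)) - E (t - τ) (f (V τ))) := by
    rw [intervalIntegral.integral_sub (hc hU.continuous_forcing) (hc hV.continuous_forcing),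
      hU.eq t ht, hV.eq t ht, map_sub]
    abel
  rw [e]
  refine (norm_add_le _ _).trans (add_le_add (hE.norm_le _ _) ?_)
  rw [← intervalIntegral.integral_const_mul]
  refine intervalIntegral.norm_integral_le_of_norm_le ht.1 (Eventually.of_forall fun τ hτ => ?_)
    ((continuous_const.mul (hU.continuous.sub hV.continuous).norm).intervalIntegrable _ _)
  have hτ' : τ ∈ Icc 0 T := ⟨hτ.1.le, hτ.2.trans ht.2⟩
  rw [← map_sub]
  exact (hE.norm_le _ _).trans (hf _ _ (hUr τ hτ') (hVr τ hτ'))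

theorem IsExtendedSolution.eq_of_eq (hE : IsContractionSemigroup E) (hf : IsLocallyLipschitz f)
    {x : X} {T : ℝ} {U V : ℝ → X} (hU : IsExtendedSolution E f x T U)
    (hV : IsExtendedSolution E f x T V) {t : ℝ} (ht : t ∈ Icc 0 T) : U t = V t := by
  obtain ⟨a, ha⟩ := isCompact_Icc.exists_bound_of_continuousOn (s := Icc 0 T)
    hU.continuous.continuousOn
  obtain ⟨b, hb⟩ := isCompact_Icc.exists_bound_of_continuousOn (s := Icc 0 T)
    hV.continuous.continuousOn
  obtain ⟨K, hK, h⟩ := hf (max a b)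
  have := hU.norm_sub_le hE hK h hV (fun t ht => (ha t ht).trans (le_max_left _ _))
    (fun t ht => (hb t ht).trans (le_max_right _ _)) ht
  rw [sub_self, norm_zero, zero_mul] at this
  exact sub_eq_zero.1 (norm_le_zero_iff.1 this)

/-- Banach's fixed point theorem for `e^{-κt} U(t)`: the exponential weight makes the Duhamel map a
contraction on the whole interval, however long. -/
theorem exists_isExtendedSolution_of_lipschitz [CompleteSpace X] (hE : IsContractionSemigroup E)
    {K : ℝ} (hK : 0 ≤ K) (hf : ∀ x y, ‖f x - f y‖ ≤ K * ‖x - y‖) (x : X) {T : ℝ} (hT : 0 ≤ T) :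
    ∃ U, IsExtendedSolution E f x T U := by
  have hfc := continuous_of_norm_sub_le hf
  -- The contraction constant is at most `K / κ`. The factor `2` makes it at most `1/2`, and the
  -- summand `1` keeps `κ` positive when `K = 0`.
  set κ : ℝ := 2 * K + 1 with hκ
  have hκ0 : 0 < κ := by positivity
  have hext : ∀ V : C(Icc (0 : ℝ) T, X), Continuous (IccExtend hT V) := fun V =>
    V.continuous.Icc_extend'
  have hforce : ∀ V : C(Icc (0 : ℝ) T, X),
      Continuous fun τ => f (Real.exp (κ * τ) • IccExtend hT V τ) := fun V =>
    hfc.comp ((by fun_prop : Continuous fun τ : ℝ => Real.exp (κ * τ)).smul (hext V))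
  let P : C(Icc (0 : ℝ) T, X) → ℝ → X := fun V t => Real.exp (-(κ * t)) •
    (E t x + ∫ τ in (0 : ℝ)..t, E (t - τ) (f (Real.exp (κ * τ) • IccExtend hT V τ)))
  have hP : ∀ V, Continuous (P V) := fun V =>
    (by fun_prop : Continuous fun τ : ℝ => Real.exp (-(κ * τ))).smul
      ((hE.continuous x).add (hE.continuous_duhamel (hforce V)))
  let Q : C(Icc (0 : ℝ) T, X) → C(Icc (0 : ℝ) T, X) := fun V =>
    ⟨fun t => P V t, (hP V).comp continuous_subtype_val⟩
  have hQ : ContractingWith (1 / 2) Q := by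
    refine ⟨by norm_num, LipschitzWith.of_dist_le_mul fun V W => ?_⟩
    rw [ContinuousMap.dist_le (by positivity)]
    rintro ⟨t, ht⟩
    change dist (P V t) (P W t) ≤ _
    have hc : ∀ V : C(Icc (0 : ℝ) T, X), IntervalIntegrable
        (fun τ => E (t - τ) (f (Real.exp (κ * τ) • IccExtend hT V τ))) volume 0 t := fun V =>
      (hE.continuous_comp (continuous_const.sub continuous_id) (hforce V)).intervalIntegrable _ _
    rw [dist_eq_norm]
    simp only [P]
    rw [← smul_sub, add_sub_add_left_eq_sub, ← intervalIntegral.integral_sub (hc V) (hc W),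
      norm_smul, Real.norm_of_nonneg (Real.exp_pos _).le]
    have hce : Continuous fun τ : ℝ => K * dist V W * Real.exp (κ * τ) := by fun_prop
    have h1 : ‖∫ τ in (0 : ℝ)..t, (E (t - τ) (f (Real.exp (κ * τ) • IccExtend hT V τ))
        - E (t - τ) (f (Real.exp (κ * τ) • IccExtend hT W τ)))‖
        ≤ ∫ τ in (0 : ℝ)..t, K * dist V W * Real.exp (κ * τ) := by
      refine intervalIntegral.norm_integral_le_of_norm_le ht.1
        (Eventually.of_forall fun τ _ => ?_) (hce.intervalIntegrable _ _)
      rw [← map_sub]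
      refine (hE.norm_le _ _).trans ((hf _ _).trans ?_)
      rw [mul_assoc, ← smul_sub, norm_smul, Real.norm_of_nonneg (Real.exp_pos _).le,
        mul_comm (dist V W), ← dist_eq_norm]
      refine mul_le_mul_of_nonneg_left (mul_le_mul_of_nonneg_left ?_ (Real.exp_pos _).le) hK
      exact ContinuousMap.dist_apply_le_dist _
    have h2 : (∫ τ in (0 : ℝ)..t, K * dist V W * Real.exp (κ * τ))
        = K * dist V W * (κ⁻¹ * (Real.exp (κ * t) - 1)) := by
      rw [intervalIntegral.integral_const_mul,
        intervalIntegral.integral_comp_mul_left (fun τ => Real.exp τ) hκ0.ne', integral_exp]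
      simp
    rw [h2] at h1
    have h3 : Real.exp (-(κ * t)) * (Real.exp (κ * t) - 1) ≤ 1 := by
      rw [mul_sub, ← Real.exp_add, neg_add_cancel, Real.exp_zero, mul_one]
      linarith [Real.exp_pos (-(κ * t))]
    have h4 : K * κ⁻¹ ≤ 1 / 2 := by
      rw [← div_eq_mul_inv, div_le_iff₀ hκ0]
      linarith
    calc _ ≤ Real.exp (-(κ * t)) * (K * dist V W * (κ⁻¹ * (Real.exp (κ * t) - 1))) :=
          mul_le_mul_of_nonneg_left h1 (Real.exp_pos _).le
      _ = (K * κ⁻¹) * dist V W * (Real.exp (-(κ * t)) * (Real.exp (κ * t) - 1)) := by ring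
      _ ≤ (K * κ⁻¹) * dist V W * 1 := mul_le_mul_of_nonneg_left h3 (by positivity)
      _ ≤ 1 / 2 * dist V W := by
          rw [mul_one]
          exact mul_le_mul_of_nonneg_right h4 dist_nonneg
      _ = _ := by norm_num
  obtain ⟨V, hV⟩ : ∃ V, Q V = V := ⟨_, hQ.fixedPoint_isFixedPt⟩
  have hV' : ∀ t ∈ Icc 0 T, IccExtend hT V t = P V t := fun t ht => by
    rw [IccExtend_of_mem hT _ ht]
    exact (congrArg (fun W : C(Icc (0 : ℝ) T, X) => W ⟨t, ht⟩) hV).symm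
  refine ⟨fun t => Real.exp (κ * t) • IccExtend hT V t, hforce V,
    (by fun_prop : Continuous fun τ : ℝ => Real.exp (κ * τ)).smul (hext V), fun t ht => ?_⟩
  rw [hV' t ht]
  simp only [P]
  rw [smul_smul, ← Real.exp_add, add_neg_cancel, Real.exp_zero, one_smul]

/-- Solutions that start in a ball remain in a ball, on bounded intervals of time. -/
def HasAprioriBounds (E : ℝ → X →L[ℝ] X) (f : X → X) : Prop :=
  ∀ T r : ℝ, ∃ C : ℝ, ∀ x, ‖x‖ ≤ r → ∀ T' U, T' ≤ T → IsExtendedSolution E f x T' U →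
    ∀ t ∈ Icc 0 T', ‖U t‖ ≤ C

/-- The nonlinearity truncated outside a ball is globally Lipschitz, and its solution solves the
original equation while it stays in that ball. With a radius above the a priori bound, it can never
reach the boundary. -/
theorem exists_isExtendedSolution [CompleteSpace X] (hE : IsContractionSemigroup E)
    (hf : IsLocallyLipschitz f) (hap : HasAprioriBounds E f) (x : X) {T : ℝ} (hT : 0 ≤ T) :
    ∃ U, IsExtendedSolution E f x T U := by
  obtain ⟨C, hC⟩ := hap T ‖x‖
  set ρ := max C ‖x‖ + 1 with hρ
  have hρC : C < ρ := (le_max_left C ‖x‖).trans_lt (lt_add_one _)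
  have hρx : ‖x‖ < ρ := (le_max_right C ‖x‖).trans_lt (lt_add_one _)
  have hρ0 : 0 < ρ := (norm_nonneg x).trans_lt hρx
  obtain ⟨K, hK, hKf⟩ := hf.comp_radialRetraction hρ0
  obtain ⟨V, hV⟩ := exists_isExtendedSolution_of_lipschitz hE hK hKf x hT
  have hfV : Continuous fun t => f (V t) := hf.continuous.comp hV.continuous
  have key : ∀ T' ≤ T, (∀ t ∈ Icc 0 T', ‖V t‖ ≤ ρ) → IsExtendedSolution E f x T' V := by
    intro T' hT' h
    refine ⟨hfV, hV.continuous, fun t ht => ?_⟩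
    rw [hV.eq t ⟨ht.1, ht.2.trans hT'⟩]
    congr 1
    refine intervalIntegral.integral_congr fun τ hτ => ?_
    rw [uIcc_of_le ht.1] at hτ
    simp only [radialRetraction_eq_self hρ0 (h τ ⟨hτ.1, hτ.2.trans ht.2⟩)]
  have hV0 : ‖V 0‖ < ρ := by rwa [hV.apply_zero hE hT]
  refine ⟨V, key T le_rfl ?_⟩
  by_contra! hcon
  obtain ⟨t₁, ht₁, h₁⟩ := hcon
  have hcn : Continuous fun t => ‖V t‖ := hV.continuous.norm
  have hne : ({t | ‖V t‖ = ρ} ∩ Icc 0 T).Nonempty := by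
    obtain ⟨t, ht, h⟩ := intermediate_value_Icc ht₁.1 hcn.continuousOn ⟨hV0.le, h₁.le⟩
    exact ⟨t, h, ht.1, ht.2.trans ht₁.2⟩
  have hcomp : IsCompact ({t | ‖V t‖ = ρ} ∩ Icc 0 T) :=
    isCompact_Icc.inter_left (isClosed_eq hcn continuous_const)
  -- Here `s` is the first time with `‖V s‖ = ρ`. Up to `s` the truncation is inactive, so the a
  -- priori bound `C < ρ` applies at `s` itself.
  obtain ⟨s, ⟨hs, hsT⟩, hmin⟩ := hcomp.exists_isLeast hne
  have hle : ∀ t ∈ Icc 0 s, ‖V t‖ ≤ ρ := by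
    intro t ht
    by_contra! hlt
    obtain ⟨t', ht', h'⟩ := intermediate_value_Icc ht.1 hcn.continuousOn ⟨hV0.le, hlt.le⟩
    have h2 := hmin ⟨h', ht'.1, ht'.2.trans (ht.2.trans hsT.2)⟩
    have h3 : t = s := le_antisymm ht.2 (h2.trans ht'.2)
    rw [h3] at hlt
    exact hlt.ne' hs
  have := hC x le_rfl s V hsT.2 (key s hsT.2 hle) s (right_mem_Icc.2 hsT.1)
  rw [mem_ofPred_eq] at hs
  linarith

/-- Global well-posedness: the mild solutions form a dynamical system. -/
theorem exists_dynamicalSystem [CompleteSpace X] (hE : IsContractionSemigroup E)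
    (hf : IsLocallyLipschitz f) (hap : HasAprioriBounds E f) :
    ∃ S : ℝ → X → X, (∀ x T, 0 ≤ T → ∃ U, IsExtendedSolution E f x T U ∧
      ∀ t ∈ Icc 0 T, U t = S t x) ∧ IsDynamicalSystem S := by
  choose V hV using fun (x : X) (T : ℝ) =>
    exists_isExtendedSolution hE hf hap x (abs_nonneg T)
  -- For each `t` a separate solution on `[0, |t|]` is evaluated at its endpoint; uniqueness glues
  -- these values into trajectories.
  let S : ℝ → X → X := fun t x => V x t t
  have hS : ∀ {x : X} {T : ℝ} {U : ℝ → X}, IsExtendedSolution E f x T U → ∀ t ∈ Icc 0 T,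
      U t = S t x := by
    intro x T U hU t ht
    have h1 := hV x t
    rw [abs_of_nonneg ht.1] at h1
    exact (hU.mono ht.2).eq_of_eq hE hf h1 (right_mem_Icc.2 ht.1)
  have hex : ∀ x T, 0 ≤ T → ∃ U, IsExtendedSolution E f x T U ∧ ∀ t ∈ Icc 0 T, U t = S t x := by
    intro x T hT
    obtain ⟨U, hU⟩ := exists_isExtendedSolution hE hf hap x hT
    exact ⟨U, hU, hS hU⟩
  refine ⟨S, hex, ⟨fun x => ?_, fun s t hs ht x => ?_, ?_⟩⟩
  · obtain ⟨U, hU, h⟩ := hex x 0 le_rfl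
    rw [← h 0 ⟨le_rfl, le_rfl⟩, hU.apply_zero hE le_rfl]
  · obtain ⟨U, hU, h⟩ := hex x (s + t) (by positivity)
    have h1 : IsExtendedSolution E f (U t) s (fun r => U (t + r)) := by
      have := IsForcedSolution.shift hE hU ht
      rwa [add_sub_cancel_right] at this
    rw [← h (s + t) ⟨by positivity, le_rfl⟩, ← h t ⟨ht, by linarith⟩,
      ← hS h1 s (right_mem_Icc.2 hs), add_comm]
  · rintro ⟨t₀, x₀⟩ ⟨ht₀, -⟩
    simp only [mem_Ici] at ht₀
    obtain ⟨C, hC⟩ := hap (t₀ + 1) (‖x₀‖ + 1)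
    obtain ⟨K, hK, hKf⟩ := hf C
    obtain ⟨U, hU, hUS⟩ := hex x₀ (t₀ + 1) (by positivity)
    have hUC := hC x₀ (by linarith) _ U le_rfl hU
    -- Joint continuity: the first term bounds the dependence on the initial state, uniformly on
    -- `[0, t₀ + 1]`, and the second is the continuity in time of the reference trajectory.
    have hlim : Tendsto (fun q : ℝ × X => ‖q.2 - x₀‖ * Real.exp (K * (t₀ + 1))
        + ‖U q.1 - U t₀‖) (𝓝 (t₀, x₀)) (𝓝 0) := by
      have hc := hU.continuous
      have : Continuous fun q : ℝ × X => ‖q.2 - x₀‖ * Real.exp (K * (t₀ + 1))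
        + ‖U q.1 - U t₀‖ := by fun_prop
      exact this.tendsto' _ _ (by simp)
    rw [ContinuousWithinAt, tendsto_iff_norm_sub_tendsto_zero]
    refine squeeze_zero' (Eventually.of_forall fun _ => norm_nonneg _) ?_
      (hlim.mono_left nhdsWithin_le_nhds)
    have h1 : ∀ᶠ q : ℝ × X in 𝓝 (t₀, x₀), q.1 < t₀ + 1 :=
      continuous_fst.continuousAt.eventually_lt_const (lt_add_one t₀)
    have h2 : ∀ᶠ q : ℝ × X in 𝓝 (t₀, x₀), ‖q.2‖ < ‖x₀‖ + 1 :=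
      continuous_snd.norm.continuousAt.eventually_lt_const (lt_add_one ‖x₀‖)
    filter_upwards [self_mem_nhdsWithin, nhdsWithin_le_nhds h1, nhdsWithin_le_nhds h2]
      with q hq0 hq1 hq2
    have hq : q.1 ∈ Icc 0 (t₀ + 1) := ⟨hq0.1, hq1.le⟩
    obtain ⟨W, hW, hWS⟩ := hex q.2 (t₀ + 1) (by positivity)
    have hWC := hC q.2 hq2.le _ W le_rfl hW
    have h3 := hW.norm_sub_le hE hK hKf hU hWC hUC hq
    rw [← hWS _ hq, ← hUS t₀ ⟨ht₀, by linarith⟩]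
    refine (norm_sub_le_norm_sub_add_norm_sub _ (U q.1) _).trans (add_le_add_left ?_ _)
    refine h3.trans (mul_le_mul_of_nonneg_left (Real.exp_le_exp.2 ?_) (norm_nonneg _))
    exact mul_le_mul_of_nonneg_left hq.2 hK

end Semilinear

/-! ### Memory kernels and the Volterra operator of the history space -/

namespace IsMemoryKernel

variable {μ : ℝ → ℝ} {δ : ℝ} (hμ : IsMemoryKernel μ δ)

include hμ in
theorem antitoneOn : AntitoneOn μ (Ici 0) := by
  refine antitoneOn_of_deriv_nonpos (convex_Ici 0) hμ.continuousOn ?_ fun s hs => ?_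
  · rw [interior_Ici]
    exact hμ.contDiffOn.differentiableOn one_ne_zero
  · rw [interior_Ici] at hs
    have h1 := hμ.deriv_le s hs
    have h2 := mul_nonneg hμ.rate_pos.le (hμ.nonneg s (le_of_lt hs))
    linarith

include hμ in
theorem hasDerivAt {s : ℝ} (hs : 0 < s) : HasDerivAt μ (deriv μ s) s :=
  ((hμ.contDiffOn.differentiableOn one_ne_zero).differentiableAt (Ioi_mem_nhds hs)).hasDerivAt

include hμ in
theorem isFiniteMeasure : IsFiniteMeasure (weight μ) :=
  isFiniteMeasure_withDensity_ofReal hμ.integrableOn.hasFiniteIntegral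

include hμ in
theorem aemeasurable : AEMeasurable (fun s => ENNReal.ofReal (μ s)) (volume.restrict (Ioi 0)) :=
  hμ.integrableOn.aestronglyMeasurable.aemeasurable.ennreal_ofReal

include hμ in
theorem ae_weight_iff {p : ℝ → Prop} :
    (∀ᵐ s ∂(weight μ), p s) ↔ ∀ᵐ s, 0 < s → 0 < μ s → p s := by
  rw [weight, ae_withDensity_iff' hμ.aemeasurable, ae_restrict_iff' measurableSet_Ioi]
  simp only [ne_eq, ENNReal.ofReal_eq_zero, not_le, mem_Ioi]

include hμ in
theorem ae_weight_pos : ∀ᵐ s ∂(weight μ), 0 < s ∧ 0 < μ s :=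
  hμ.ae_weight_iff.2 (Eventually.of_forall fun _ h1 h2 => ⟨h1, h2⟩)

include hμ in
theorem integral_weight {E : Type*} [NormedAddCommGroup E] [NormedSpace ℝ E] (g : ℝ → E) :
    ∫ s, g s ∂(weight μ) = ∫ s in Ioi 0, μ s • g s := by
  rw [weight, integral_withDensity_eq_integral_toReal_smul₀ hμ.aemeasurable (by simp)]
  refine setIntegral_congr_fun measurableSet_Ioi fun s hs => ?_
  simp only [ENNReal.toReal_ofReal (hμ.nonneg s (le_of_lt hs))]

include hμ in
theorem integrable_weight_iff {E : Type*} [NormedAddCommGroup E] [NormedSpace ℝ E] {g : ℝ → E} :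
    Integrable g (weight μ) ↔ IntegrableOn (fun s => μ s • g s) (Ioi 0) := by
  rw [weight, integrable_withDensity_iff_integrable_smul₀' hμ.aemeasurable (by simp)]
  refine integrableOn_congr_fun (fun s hs => ?_) measurableSet_Ioi
  simp only [ENNReal.toReal_ofReal (hμ.nonneg s (le_of_lt hs))]

include hμ in
-- A nonincreasing kernel is at least `μ s` on `(0, s]`. Hence elements of the weighted space are
-- integrable on `(0, s]` whenever `μ s > 0`, and their primitives make sense.
theorem restrict_Ioc_le {s : ℝ} (hs' : 0 < μ s) :
    volume.restrict (Ioc 0 s) ≤ (ENNReal.ofReal (μ s))⁻¹ • weight μ := by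
  have hne : ENNReal.ofReal (μ s) ≠ 0 := by simpa using hs'
  rw [Measure.le_iff]
  intro A hA
  rw [Measure.restrict_apply hA, Measure.smul_apply, smul_eq_mul, ← ENNReal.div_eq_inv_mul,
    ENNReal.le_div_iff_mul_le (Or.inl hne) (Or.inl ENNReal.ofReal_ne_top), weight,
    withDensity_apply _ hA, Measure.restrict_restrict hA, mul_comm, ← setLIntegral_const]
  refine (setLIntegral_mono_ae' (hA.inter measurableSet_Ioc) (Eventually.of_forall
    fun x hx => ?_)).trans (lintegral_mono_set (inter_subset_inter_right A Ioc_subset_Ioi_self))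
  exact ENNReal.ofReal_le_ofReal
    (hμ.antitoneOn hx.2.1.le (hx.2.1.le.trans hx.2.2) hx.2.2)

section Primitive

variable {E : Type*} [NormedAddCommGroup E]

include hμ in
theorem integrableOn_of_memLp {s : ℝ} (hs' : 0 < μ s) {f : ℝ → E}
    (hf : MemLp f 2 (weight μ)) : IntegrableOn f (Ioc 0 s) := by
  have := hμ.isFiniteMeasure
  have h1 : Integrable f (weight μ) := hf.integrable one_le_two
  exact (h1.smul_measure (ENNReal.inv_ne_top.2 (by simpa using hs'))).mono_measure
    (hμ.restrict_Ioc_le hs')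

include hμ in
theorem intervalIntegrable_of_memLp {s : ℝ} (hs : 0 < s) (hs' : 0 < μ s) {f : ℝ → E}
    (hf : MemLp f 2 (weight μ)) : IntervalIntegrable f volume 0 s :=
  (intervalIntegrable_iff_integrableOn_Ioc_of_le hs.le).2 (hμ.integrableOn_of_memLp hs' hf)

variable [NormedSpace ℝ E]

include hμ in
-- The constant depends on `s` but not on `f`, so convergence in the memory space passes to the
-- primitives pointwise.
theorem exists_norm_integral_le {s : ℝ} (hs : 0 < s) (hs' : 0 < μ s) :
    ∃ K : ℝ, ∀ f : ℝ → E, MemLp f 2 (weight μ) →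
      ‖∫ y in (0 : ℝ)..s, f y‖ ≤ K * (eLpNorm f 2 (weight μ)).toReal := by
  have := hμ.isFiniteMeasure
  let c : ENNReal := (ENNReal.ofReal (μ s))⁻¹ *
    weight μ univ ^ (1 / (1 : ENNReal).toReal - 1 / (2 : ENNReal).toReal)
  have hc : c ≠ ⊤ := ENNReal.mul_ne_top (ENNReal.inv_ne_top.2 (by simpa using hs'))
    (ENNReal.rpow_ne_top_of_nonneg (by norm_num) (measure_ne_top _ _))
  refine ⟨c.toReal, fun f hf => ?_⟩
  rw [← ENNReal.toReal_mul, ← toReal_enorm,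
    ENNReal.toReal_le_toReal enorm_ne_top (ENNReal.mul_ne_top hc hf.eLpNorm_ne_top),
    intervalIntegral.integral_of_le hs.le]
  calc _ ≤ ∫⁻ y in Ioc 0 s, ‖f y‖ₑ := enorm_integral_le_lintegral_enorm _
    _ ≤ ∫⁻ y, ‖f y‖ₑ ∂((ENNReal.ofReal (μ s))⁻¹ • weight μ) :=
        lintegral_mono' (hμ.restrict_Ioc_le hs') le_rfl
    _ = (ENNReal.ofReal (μ s))⁻¹ * eLpNorm f 1 (weight μ) := by
        rw [lintegral_smul_measure, eLpNorm_one_eq_lintegral_enorm, smul_eq_mul]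
    _ ≤ (ENNReal.ofReal (μ s))⁻¹ * (eLpNorm f 2 (weight μ) *
          weight μ univ ^ (1 / (1 : ENNReal).toReal - 1 / (2 : ENNReal).toReal)) := by
        gcongr
        exact eLpNorm_le_eLpNorm_mul_rpow_measure_univ one_le_two hf.1
    _ = c * eLpNorm f 2 (weight μ) := by simp only [c]; ring

include hμ in
theorem intervalIntegral_congr {s : ℝ} (hs : 0 < s) (hs' : 0 < μ s) {f g : ℝ → E}
    (h : f =ᵐ[weight μ] g) : ∫ y in (0 : ℝ)..s, f y = ∫ y in (0 : ℝ)..s, g y := by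
  refine intervalIntegral.integral_congr_ae ?_
  filter_upwards [hμ.ae_weight_iff.1 h] with y hy hys
  rw [uIoc_of_le hs.le] at hys
  exact hy hys.1 (hs'.trans_le (hμ.antitoneOn hys.1.le hs.le hys.2))

include hμ in
/-- The primitive that vanishes at `0` depends linearly on the element of the memory space. -/
theorem integral_add {s : ℝ} (hs : 0 < s) (hs' : 0 < μ s) (ζ ζ' : MemorySpace μ E) :
    ∫ y in (0 : ℝ)..s, (ζ + ζ') y = (∫ y in (0 : ℝ)..s, ζ y) + ∫ y in (0 : ℝ)..s, ζ' y := by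
  rw [← intervalIntegral.integral_add (hμ.intervalIntegrable_of_memLp hs hs' (Lp.memLp ζ))
    (hμ.intervalIntegrable_of_memLp hs hs' (Lp.memLp ζ'))]
  exact hμ.intervalIntegral_congr hs hs' (Lp.coeFn_add ζ ζ')

include hμ in
theorem integral_smul {s : ℝ} (hs : 0 < s) (hs' : 0 < μ s) (c : ℝ) (ζ : MemorySpace μ E) :
    ∫ y in (0 : ℝ)..s, (c • ζ) y = c • ∫ y in (0 : ℝ)..s, ζ y := by
  rw [← intervalIntegral.integral_smul]
  exact hμ.intervalIntegral_congr hs hs' (Lp.coeFn_smul c ζ)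

include hμ in
theorem hasMemoryDeriv_add {η ζ η' ζ' : MemorySpace μ E} (h : HasMemoryDeriv η ζ)
    (h' : HasMemoryDeriv η' ζ') : HasMemoryDeriv (η + η') (ζ + ζ') := by
  unfold HasMemoryDeriv at h h' ⊢
  filter_upwards [h, h', hμ.ae_weight_pos, Lp.coeFn_add η η'] with s h1 h2 h3 h4
  rw [h4, Pi.add_apply, h1, h2, hμ.integral_add h3.1 h3.2]

include hμ in
theorem hasMemoryDeriv_smul (c : ℝ) {η ζ : MemorySpace μ E} (h : HasMemoryDeriv η ζ) :
    HasMemoryDeriv (c • η) (c • ζ) := by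
  unfold HasMemoryDeriv at h ⊢
  filter_upwards [h, hμ.ae_weight_pos, Lp.coeFn_smul c η] with s h1 h3 h4
  rw [h4, Pi.smul_apply, h1, hμ.integral_smul h3.1 h3.2]

theorem _root_.BergerPlate.HasMemoryDeriv.eq {η η' ζ : MemorySpace μ E} (h : HasMemoryDeriv η ζ)
    (h' : HasMemoryDeriv η' ζ) : η = η' := by
  refine Lp.ext ?_
  filter_upwards [h, h'] with s h1 h2
  rw [h1, h2]

include hμ in
-- The primitive of `ζ` is continuous and vanishes almost everywhere where `μ > 0`, hence
-- identically on each such initial interval, and Lebesgue differentiation returns `ζ = 0`. So the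
-- derivative `η_s` is determined by `η`.
theorem eq_zero_of_hasMemoryDeriv_zero [CompleteSpace E] {ζ : MemorySpace μ E}
    (h : HasMemoryDeriv 0 ζ) : ζ = 0 := by
  have h0 : ∀ᵐ s, 0 < s → 0 < μ s → ∫ y in (0 : ℝ)..s, ζ y = 0 := by
    refine hμ.ae_weight_iff.1 ?_
    filter_upwards [h, Lp.coeFn_zero E 2 (weight μ)] with s h1 h2
    rw [← h1, h2, Pi.zero_apply]
  have key : ∀ b, 0 < b → 0 < μ b → ∀ᵐ s, s ∈ Ioo 0 b → ζ s = 0 := by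
    intro b hb hb'
    have hi := hμ.intervalIntegrable_of_memLp hb hb' (Lp.memLp ζ)
    have hc : ContinuousOn (fun s => ∫ y in (0 : ℝ)..s, ζ y) (Ioo 0 b) := by
      refine (intervalIntegral.continuousOn_primitive_interval (μ := volume) (a := 0) (b := b)
        ?_).mono ?_
      · rw [uIcc_of_le hb.le, integrableOn_Icc_iff_integrableOn_Ioc]
        exact hμ.integrableOn_of_memLp hb' (Lp.memLp ζ)
      · rw [uIcc_of_le hb.le]
        exact Ioo_subset_Icc_self
    have hz : EqOn (fun s => ∫ y in (0 : ℝ)..s, ζ y) (fun _ => 0) (Ioo 0 b) := by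
      refine Measure.eqOn_open_of_ae_eq (μ := volume) ?_ isOpen_Ioo hc continuousOn_const
      refine (ae_restrict_iff' measurableSet_Ioo).2 ?_
      filter_upwards [h0] with s hs hsb
      exact hs hsb.1 (hb'.trans_le (hμ.antitoneOn hsb.1.le hb.le hsb.2.le))
    filter_upwards [hi.ae_hasDerivAt_integral] with s hs hsb
    have h1 := hs (by rw [uIcc_of_le hb.le]; exact Ioo_subset_Icc_self hsb) 0 left_mem_uIcc
    have h2 : HasDerivAt (fun s => ∫ y in (0 : ℝ)..s, ζ y) 0 s :=
      (hasDerivAt_const s (0 : E)).congr_of_eventuallyEq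
        (hz.eventuallyEq_of_mem (isOpen_Ioo.mem_nhds hsb))
    exact h1.unique h2
  -- Rational endpoints suffice to exhaust the set `μ > 0` and keep the exceptional set null: `μ` is
  -- continuous, so it is still positive at some rational just above `s`.
  have hall : ∀ᵐ s, ∀ q : ℚ, 0 < (q : ℝ) → 0 < μ q → s ∈ Ioo 0 (q : ℝ) → ζ s = 0 := by
    rw [ae_all_iff]
    intro q
    by_cases h1 : 0 < (q : ℝ)
    · by_cases h2 : 0 < μ q
      · filter_upwards [key q h1 h2] with s hs _ _ using hs
      · exact Eventually.of_forall fun s _ h => absurd h h2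
    · exact Eventually.of_forall fun s h => absurd h h1
  refine Lp.ext (EventuallyEq.trans ?_ (Lp.coeFn_zero E 2 (weight μ)).symm)
  refine hμ.ae_weight_iff.2 ?_
  filter_upwards [hall] with s hs hs0 hsμ
  obtain ⟨ε, hε, h1⟩ := Metric.eventually_nhds_iff.1
    ((hμ.hasDerivAt hs0).continuousAt.eventually_const_lt hsμ)
  obtain ⟨q, hq1, hq2⟩ := exists_rat_btwn (lt_add_of_pos_right s hε)
  refine hs q (hs0.trans hq1) (h1 ?_) ⟨hs0, hq1⟩
  rw [Real.dist_eq, abs_of_pos (sub_pos.2 hq1)]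
  linarith

end Primitive

section Hilbert

variable {E : Type*} [NormedAddCommGroup E] [InnerProductSpace ℝ E]

include hμ in
theorem memLp_of_continuous {E : Type*} [NormedAddCommGroup E] {f : ℝ → E}
    (hf : Continuous f) {C : ℝ} (hC : ∀ s, ‖f s‖ ≤ C) :
    MemLp f 2 (weight μ) :=
  have := hμ.isFiniteMeasure
  MemLp.of_bound hf.aestronglyMeasurable C (Eventually.of_forall hC)

include hμ in
-- By `μ' ≤ -δ μ`, the derivative of `½ μ ‖η‖²` is at most `μ ((η, η_s) - δ/2 ‖η‖²)`. Integrate from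
-- `0`, where `η` vanishes, and drop the nonnegative boundary term at the upper end.
theorem integral_inner_primitive_nonneg [CompleteSpace E] {h : ℝ → E} (hh : Continuous h)
    {C C' : ℝ} (hC : ∀ s, ‖h s‖ ≤ C) (hC' : ∀ s, ‖∫ y in (0 : ℝ)..s, h y‖ ≤ C') :
    0 ≤ ∫ s, (inner ℝ (∫ y in (0 : ℝ)..s, h y) (h s)
      - δ / 2 * ‖∫ y in (0 : ℝ)..s, h y‖ ^ 2) ∂(weight μ) := by
  have := hμ.isFiniteMeasure
  set η : ℝ → E := fun s => ∫ y in (0 : ℝ)..s, h y with hη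
  have hηd : ∀ s, HasDerivAt η (h s) s := fun s => hh.hasDerivAt_integral_zero s
  have hηc : Continuous η := continuous_iff_continuousAt.2 fun s => (hηd s).continuousAt
  set φ : ℝ → ℝ := fun s => inner ℝ (η s) (h s) - δ / 2 * ‖η s‖ ^ 2 with hφ
  have hφc : Continuous φ := (hηc.inner hh).sub (continuous_const.mul (hηc.norm.pow 2))
  have hφb : ∀ s, ‖φ s‖ ≤ C' * C + δ / 2 * C' ^ 2 := fun s => by
    have hδ := hμ.rate_pos
    refine (norm_sub_le _ _).trans (_root_.add_le_add ?_ ?_)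
    · exact (norm_inner_le_norm _ _).trans (mul_le_mul (hC' s) (hC s) (norm_nonneg _)
        ((norm_nonneg _).trans (hC' s)))
    · rw [Real.norm_of_nonneg (by positivity)]
      exact mul_le_mul_of_nonneg_left (pow_le_pow_left₀ (norm_nonneg _) (hC' s) 2) (by positivity)
  have hφi : Integrable φ (weight μ) :=
    (MemLp.of_bound (p := 1) hφc.aestronglyMeasurable _ (Eventually.of_forall hφb)).integrable
      le_rfl
  -- Freezing the kernel at negative arguments makes it continuous on `ℝ`, so the integrals below
  -- are differentiable everywhere.
  set m : ℝ → ℝ := fun s => μ (max s 0) with hm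
  have hmc : Continuous m := hμ.continuousOn.comp_continuous
    (continuous_id.max continuous_const) fun s => mem_Ici.2 (le_max_right _ _)
  have hmφ : Continuous fun s => m s * φ s := hmc.mul hφc
  let F : ℝ → ℝ := fun s => (∫ y in (0 : ℝ)..s, m y * φ y) - 1 / 2 * (m s * ‖η s‖ ^ 2)
  have hmd : ∀ s, 0 < s → HasDerivAt m (deriv μ s) s := fun s hs =>
    (hμ.hasDerivAt hs).congr_of_eventuallyEq (by
      filter_upwards [Ioi_mem_nhds hs] with y hy
      simp only [hm, max_eq_left (mem_Ioi.1 hy).le])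
  have hFd : ∀ s, 0 < s → HasDerivAt F (-(1 / 2) * (deriv μ s + δ * μ s) * ‖η s‖ ^ 2) s := by
    intro s hs
    refine ((hmφ.hasDerivAt_integral_zero s).sub
      (((hmd s hs).mul (hηd s).norm_sq).const_mul (1 / 2))).congr_deriv ?_
    simp only [hm, hφ, max_eq_left hs.le]
    ring
  have hFc : Continuous F := (continuous_iff_continuousAt.2 fun s =>
    (hmφ.hasDerivAt_integral_zero s).continuousAt).sub
      (continuous_const.mul (hmc.mul (hηc.norm.pow 2)))
  have hmono : MonotoneOn F (Ici 0) := by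
    refine monotoneOn_of_deriv_nonneg (convex_Ici 0) hFc.continuousOn ?_ fun s hs => ?_
    · rw [interior_Ici]
      exact fun s hs => (hFd s hs).differentiableAt.differentiableWithinAt
    · rw [interior_Ici] at hs
      rw [(hFd s hs).deriv]
      have := hμ.deriv_le s hs
      exact mul_nonneg (mul_nonneg_of_nonpos_of_nonpos (by norm_num) this) (sq_nonneg _)
  have hpos : ∀ s, 0 ≤ s → 0 ≤ ∫ y in (0 : ℝ)..s, μ y * φ y := by
    intro s hs
    have h1 := hmono (mem_Ici.2 le_rfl) (mem_Ici.2 hs) hs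
    have h2 : F 0 = 0 := by simp [F, hη]
    have h3 : (∫ y in (0 : ℝ)..s, m y * φ y) = ∫ y in (0 : ℝ)..s, μ y * φ y := by
      refine intervalIntegral.integral_congr fun y hy => ?_
      rw [uIcc_of_le hs] at hy
      simp only [hm, max_eq_left hy.1]
    have h4 : 0 ≤ m s := hμ.nonneg _ (le_max_right _ _)
    have h5 : 0 ≤ 1 / 2 * (m s * ‖η s‖ ^ 2) := by positivity
    rw [h2] at h1
    simp only [F] at h1
    rw [← h3]
    linarith
  rw [hμ.integral_weight]
  refine ge_of_tendsto (intervalIntegral_tendsto_integral_Ioi 0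
    (hμ.integrable_weight_iff.1 hφi) tendsto_id) ?_
  filter_upwards [eventually_ge_atTop 0] with s hs
  exact hpos s hs

include hμ in
theorem exists_hasMemoryDeriv_of_continuous [CompleteSpace E] {h : ℝ → E} (hh : Continuous h)
    (hs : HasCompactSupport h) (hL : MemLp h 2 (weight μ)) :
    ∃ η : MemorySpace μ E, (∀ᵐ s ∂(weight μ), η s = ∫ y in (0 : ℝ)..s, h y) ∧
      δ / 2 * ‖η‖ ^ 2 ≤ inner ℝ η (hL.toLp h) := by
  obtain ⟨C, hC⟩ := hh.bounded_above_of_compact_support hs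
  have hi : Integrable h := hh.integrable_of_hasCompactSupport hs
  have hC' : ∀ s, ‖∫ y in (0 : ℝ)..s, h y‖ ≤ ∫ y, ‖h y‖ := fun s =>
    intervalIntegral.norm_integral_le_integral_norm_uIoc.trans
      (setIntegral_le_integral hi.norm (Eventually.of_forall fun _ => norm_nonneg _))
  have hc : Continuous fun s => ∫ y in (0 : ℝ)..s, h y :=
    continuous_iff_continuousAt.2 fun s => (hh.hasDerivAt_integral_zero s).continuousAt
  have hη := hμ.memLp_of_continuous hc hC'
  refine ⟨hη.toLp _, hη.coeFn_toLp, ?_⟩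
  have h1 := hμ.integral_inner_primitive_nonneg hh hC hC'
  have e1 : inner ℝ (hη.toLp _) (hL.toLp h)
      = ∫ s, inner ℝ (∫ y in (0 : ℝ)..s, h y) (h s) ∂(weight μ) := by
    rw [L2.inner_def]
    refine integral_congr_ae ?_
    filter_upwards [hη.coeFn_toLp, hL.coeFn_toLp] with s h1 h2
    rw [h1, h2]
  have e2 : ‖hη.toLp _‖ ^ 2 = ∫ s, ‖∫ y in (0 : ℝ)..s, h y‖ ^ 2 ∂(weight μ) := by
    rw [← real_inner_self_eq_norm_sq, L2.inner_def]
    refine integral_congr_ae ?_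
    filter_upwards [hη.coeFn_toLp] with s h1
    rw [h1, real_inner_self_eq_norm_sq]
  have i1 : Integrable (fun s => inner ℝ (∫ y in (0 : ℝ)..s, h y) (h s)) (weight μ) := by
    refine (L2.integrable_inner (𝕜 := ℝ) (hη.toLp _) (hL.toLp h)).congr ?_
    filter_upwards [hη.coeFn_toLp, hL.coeFn_toLp] with s h1 h2
    rw [h1, h2]
  have i2 : Integrable (fun s => ‖∫ y in (0 : ℝ)..s, h y‖ ^ 2) (weight μ) :=
    hη.integrable_norm_pow two_ne_zero
  rw [integral_sub i1 (i2.const_mul _), integral_const_mul, ← e1, ← e2] at h1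
  linarith

include hμ in
theorem norm_le_of_mul_sq_le_inner {X : Type*} [NormedAddCommGroup X] [InnerProductSpace ℝ X]
    {η ζ : X} (h : δ / 2 * ‖η‖ ^ 2 ≤ inner ℝ η ζ) : ‖η‖ ≤ 2 / δ * ‖ζ‖ := by
  have hδ := hμ.rate_pos
  rcases eq_or_lt_of_le (norm_nonneg η) with h0 | h0
  · rw [← h0]; positivity
  have h1 := h.trans (real_inner_le_norm η ζ)
  have h2 : δ / 2 * ‖η‖ ≤ ‖ζ‖ := by
    by_contra! h3
    nlinarith
  rw [div_mul_eq_mul_div, le_div_iff₀ hδ]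
  linarith

include hμ in
/-- Every element of the memory space has a primitive that vanishes at `0` in the memory space. -/
theorem exists_hasMemoryDeriv [CompleteSpace E] (ζ : MemorySpace μ E) :
    ∃ η : MemorySpace μ E, HasMemoryDeriv η ζ ∧ δ / 2 * ‖η‖ ^ 2 ≤ inner ℝ η ζ := by
  have := hμ.isFiniteMeasure
  have hδ := hμ.rate_pos
  choose h hsupp herr hcont hL using fun n : ℕ =>
    (Lp.memLp ζ).exists_hasCompactSupport_eLpNorm_sub_le (by norm_num)
      (ε := ENNReal.ofReal (1 / ((n : ℝ) + 1))) (by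
        rw [ne_eq, ENNReal.ofReal_eq_zero, not_le]; positivity)
  have herr' : ∀ n, (eLpNorm (⇑ζ - h n) 2 (weight μ)).toReal ≤ 1 / ((n : ℝ) + 1) := fun n => by
    refine (ENNReal.toReal_mono ENNReal.ofReal_ne_top (herr n)).trans_eq ?_
    rw [ENNReal.toReal_ofReal (by positivity)]
  have hlim0 : Tendsto (fun n => (eLpNorm (⇑ζ - h n) 2 (weight μ)).toReal) atTop (𝓝 0) :=
    squeeze_zero (fun _ => ENNReal.toReal_nonneg) herr' tendsto_one_div_add_atTop_nhds_zero_nat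
  choose η hη hηle using fun n => hμ.exists_hasMemoryDeriv_of_continuous (hcont n) (hsupp n) (hL n)
  set θ : ℕ → MemorySpace μ E := fun n => (hL n).toLp (h n) with hθ
  have hθlim : Tendsto θ atTop (𝓝 ζ) := by
    rw [tendsto_iff_norm_sub_tendsto_zero]
    refine hlim0.congr fun n => ?_
    have : ζ - θ n = ((Lp.memLp ζ).sub (hL n)).toLp (⇑ζ - h n) := by
      rw [MemLp.toLp_sub (Lp.memLp ζ) (hL n), Lp.toLp_coeFn]
    rw [norm_sub_rev, this, Lp.norm_toLp]
  -- The bound on primitives applies to differences of the approximants, so the map from `h` to its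
  -- primitive is Lipschitz with constant `2/δ`, and the primitives form a Cauchy sequence.
  have hdiff : ∀ n m, ‖η n - η m‖ ≤ 2 / δ * ‖θ n - θ m‖ := by
    intro n m
    obtain ⟨ξ, hξ, hle⟩ := hμ.exists_hasMemoryDeriv_of_continuous ((hcont n).sub (hcont m))
      ((hsupp n).sub (hsupp m)) ((hL n).sub (hL m))
    have e1 : ξ = η n - η m := by
      refine Lp.ext ?_
      filter_upwards [hξ, hη n, hη m, Lp.coeFn_sub (η n) (η m)] with s h1 h2 h3 h4
      rw [h1, h4, Pi.sub_apply, h2, h3]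
      exact intervalIntegral.integral_sub ((hcont n).intervalIntegrable _ _)
        ((hcont m).intervalIntegrable _ _)
    have e2 : ((hL n).sub (hL m)).toLp (h n - h m) = θ n - θ m := MemLp.toLp_sub _ _
    have h5 := hμ.norm_le_of_mul_sq_le_inner hle
    rwa [e1, e2] at h5
  have hcauchy : CauchySeq η := by
    rw [cauchySeq_iff_tendsto_dist_atTop_0]
    have h1 := cauchySeq_iff_tendsto_dist_atTop_0.1 hθlim.cauchySeq
    have h2 := h1.const_mul (2 / δ)
    rw [mul_zero] at h2
    refine squeeze_zero (fun _ => dist_nonneg) (fun q => ?_) h2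
    rw [dist_eq_norm, dist_eq_norm]
    exact hdiff _ _
  obtain ⟨ξ, hξ⟩ := cauchySeq_tendsto_of_complete hcauchy
  refine ⟨ξ, ?_, le_of_tendsto_of_tendsto' ((hξ.norm.pow 2).const_mul _) (hξ.inner hθlim) hηle⟩
  -- To identify the limit, compare almost everywhere convergence along a subsequence with the
  -- pointwise convergence of the primitives.
  obtain ⟨ns, hns, hae⟩ := (tendstoInMeasure_of_tendsto_Lp hξ).exists_seq_tendsto_ae
  unfold HasMemoryDeriv
  filter_upwards [hae, ae_all_iff.2 hη, hμ.ae_weight_pos] with s h1 h2 h3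
  refine tendsto_nhds_unique h1 ?_
  obtain ⟨K, hK⟩ := hμ.exists_norm_integral_le (E := E) h3.1 h3.2
  have h4 : Tendsto (fun n => K * (eLpNorm (⇑ζ - h n) 2 (weight μ)).toReal) atTop (𝓝 0) := by
    simpa using hlim0.const_mul K
  have h5 : Tendsto (fun n => η n s) atTop (𝓝 (∫ y in (0 : ℝ)..s, ζ y)) := by
    rw [tendsto_iff_norm_sub_tendsto_zero]
    refine squeeze_zero (fun _ => norm_nonneg _) (fun n => ?_) h4
    rw [h2 n, norm_sub_rev, ← intervalIntegral.integral_sub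
      (hμ.intervalIntegrable_of_memLp h3.1 h3.2 (Lp.memLp ζ))
      ((hcont n).intervalIntegrable _ _)]
    exact hK _ ((Lp.memLp ζ).sub (hL n))
  exact h5.comp hns.tendsto_atTop

/-- The Volterra operator `ζ ↦ ∫₀ˢ ζ` in the memory space. -/
noncomputable def volterra [CompleteSpace E] (hμ : IsMemoryKernel μ δ) :
    MemorySpace μ E →L[ℝ] MemorySpace μ E :=
  LinearMap.mkContinuous
    { toFun := fun ζ => (hμ.exists_hasMemoryDeriv ζ).choose
      map_add' := fun ζ ζ' => (hμ.exists_hasMemoryDeriv (ζ + ζ')).choose_spec.1.eq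
        (hμ.hasMemoryDeriv_add (hμ.exists_hasMemoryDeriv ζ).choose_spec.1
          (hμ.exists_hasMemoryDeriv ζ').choose_spec.1)
      map_smul' := fun c ζ => (hμ.exists_hasMemoryDeriv (c • ζ)).choose_spec.1.eq
        (hμ.hasMemoryDeriv_smul c (hμ.exists_hasMemoryDeriv ζ).choose_spec.1) }
    (2 / δ) fun ζ => hμ.norm_le_of_mul_sq_le_inner (hμ.exists_hasMemoryDeriv ζ).choose_spec.2

theorem hasMemoryDeriv_volterra [CompleteSpace E] (ζ : MemorySpace μ E) :
    HasMemoryDeriv (hμ.volterra ζ) ζ := (hμ.exists_hasMemoryDeriv ζ).choose_spec.1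

theorem mul_norm_volterra_sq_le [CompleteSpace E] (ζ : MemorySpace μ E) :
    δ / 2 * ‖hμ.volterra ζ‖ ^ 2 ≤ inner ℝ (hμ.volterra ζ) ζ :=
  (hμ.exists_hasMemoryDeriv ζ).choose_spec.2

/-- The unbounded operator `∂_s` with `η(0) = 0` becomes the inverse of a bounded operator: its
domain is the range of `volterra`. -/
theorem hasMemoryDeriv_iff [CompleteSpace E] {η ζ : MemorySpace μ E} :
    HasMemoryDeriv η ζ ↔ η = hμ.volterra ζ :=
  ⟨fun h => h.eq (hμ.hasMemoryDeriv_volterra ζ), fun h => h ▸ hμ.hasMemoryDeriv_volterra ζ⟩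

/-- The constant functions in the memory space. -/
noncomputable def const (E : Type*) [NormedAddCommGroup E] [InnerProductSpace ℝ E]
    (hμ : IsMemoryKernel μ δ) : E →L[ℝ] MemorySpace μ E :=
  have := hμ.isFiniteMeasure
  Lp.constL 2 (weight μ) ℝ

theorem coeFn_const (v : E) : ∀ᵐ s ∂(weight μ), hμ.const E v s = v :=
  have := hμ.isFiniteMeasure
  Lp.coeFn_const 2 (weight μ) v

/-- The embedding of constants is adjoint to the `μ`-weighted integral, so the memory force and the
transport source `w` or `v` become adjoint couplings, which cancel in the energy. -/
theorem inner_const [CompleteSpace E] (η : MemorySpace μ E) (v : E) :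
    inner ℝ η (hμ.const E v) = inner ℝ (∫ s, η s ∂(weight μ)) v := by
  have := hμ.isFiniteMeasure
  rw [real_inner_comm, real_inner_comm v, L2.inner_def, ← integral_inner]
  · refine integral_congr_ae ?_
    filter_upwards [hμ.coeFn_const v] with s hs
    rw [hs]
  · exact (Lp.memLp η).integrable one_le_two

theorem coeFn_volterra_const [CompleteSpace E] (v : E) :
    ∀ᵐ s ∂(weight μ), hμ.volterra (hμ.const E v) s = s • v := by
  filter_upwards [hμ.hasMemoryDeriv_volterra (hμ.const E v), hμ.ae_weight_pos] with s h1 h2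
  rw [h1, hμ.intervalIntegral_congr h2.1 h2.2 (g := fun _ => v) (hμ.coeFn_const v),
    intervalIntegral.integral_const, sub_zero]

/-- If the kernel does not vanish, the Volterra operator is bounded below on constants. -/
theorem exists_norm_volterra_const_ge [CompleteSpace E] (hne : ∃ s, 0 < s ∧ μ s ≠ 0) :
    ∃ c : ℝ, 0 < c ∧ ∀ v : E, c * ‖v‖ ≤ ‖hμ.volterra (hμ.const E v)‖ := by
  obtain ⟨s₀, hs₀, hne⟩ := hne
  have hμs : 0 < μ s₀ := lt_of_le_of_ne (hμ.nonneg s₀ hs₀.le) hne.symm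
  have := hμ.isFiniteMeasure
  -- Here `s ↦ s v` has norm at least `s₀ ‖v‖ / 2`, and `A` has positive weight because the kernel
  -- is at least `μ s₀` on it.
  set A : Set ℝ := Ioc (s₀ / 2) s₀ with hA
  have hAm : MeasurableSet A := measurableSet_Ioc
  have hApos : 0 < (weight μ).real A := by
    rw [measureReal_def, ENNReal.toReal_pos_iff]
    refine ⟨pos_iff_ne_zero.2 fun h0 => ?_, measure_lt_top _ _⟩
    have h1 := Measure.le_iff.1 (hμ.restrict_Ioc_le hμs) A hAm
    rw [Measure.smul_apply, h0, smul_zero, Measure.restrict_apply hAm,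
      inter_eq_left.2 (Ioc_subset_Ioc_left (by positivity)), Real.volume_Ioc] at h1
    have h2 := ENNReal.ofReal_eq_zero.1 (le_antisymm h1 bot_le)
    linarith
  refine ⟨s₀ / 2 * √((weight μ).real A), by positivity, fun v => ?_⟩
  set f := hμ.volterra (hμ.const E v) with hf
  have h1 : ‖f‖ ^ 2 = ∫ s, ‖f s‖ ^ 2 ∂(weight μ) := by
    rw [← real_inner_self_eq_norm_sq, L2.inner_def]
    simp only [real_inner_self_eq_norm_sq]
  have h2 : ∫ s, A.indicator (fun _ => (s₀ / 2 * ‖v‖) ^ 2) s ∂(weight μ)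
      ≤ ∫ s, ‖f s‖ ^ 2 ∂(weight μ) := by
    refine integral_mono_ae ((integrable_const _).indicator hAm)
      ((Lp.memLp f).integrable_norm_pow two_ne_zero) ?_
    filter_upwards [hμ.coeFn_volterra_const v] with s hs
    rw [hs]
    by_cases hsA : s ∈ A
    · rw [indicator_of_mem hsA, norm_smul]
      refine pow_le_pow_left₀ (by positivity) (mul_le_mul_of_nonneg_right ?_ (norm_nonneg v)) 2
      exact hsA.1.le.trans (le_abs_self s)
    · rw [indicator_of_notMem hsA]
      positivity
  rw [integral_indicator_const _ hAm, ← h1, smul_eq_mul] at h2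
  refine le_of_sq_le_sq (le_of_eq_of_le ?_ h2) (norm_nonneg f)
  rw [mul_pow, mul_pow, Real.sq_sqrt hApos.le]
  ring

end Hilbert

end IsMemoryKernel
-- Lax-Milgram for one and two components
section Coercive

variable {F G : Type*} [NormedAddCommGroup F] [InnerProductSpace ℝ F] [CompleteSpace F]
  [NormedAddCommGroup G] [InnerProductSpace ℝ G] [CompleteSpace G]

theorem exists_equiv_of_coercive (T : F →L[ℝ] F) {c : ℝ} (hc : 0 < c)
    (h : ∀ x, c * ‖x‖ ^ 2 ≤ inner ℝ (T x) x) : ∃ e : F ≃L[ℝ] F, ∀ x, e x = T x := by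
  let B : F →L[ℝ] F →L[ℝ] ℝ := (innerSL ℝ).comp T
  have hB : IsCoercive B := ⟨c, hc, fun x => by
    have := h x
    rw [pow_two, ← mul_assoc] at this
    exact this⟩
  exact ⟨hB.continuousLinearEquivOfBilin, fun x =>
    (hB.unique_continuousLinearEquivOfBilin fun _ => rfl).symm⟩

theorem exists_of_coercive_prod (T₁₁ : F →L[ℝ] F) (T₁₂ : G →L[ℝ] F) (T₂₁ : F →L[ℝ] G)
    (T₂₂ : G →L[ℝ] G) {c : ℝ} (hc : 0 < c)
    (h : ∀ a b, c * (‖a‖ ^ 2 + ‖b‖ ^ 2)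
      ≤ inner ℝ (T₁₁ a + T₁₂ b) a + inner ℝ (T₂₁ a + T₂₂ b) b) (f : F) (g : G) :
    ∃ a b, T₁₁ a + T₁₂ b = f ∧ T₂₁ a + T₂₂ b = g := by
  let p := WithLp.prodContinuousLinearEquiv 2 ℝ F G
  let T : WithLp 2 (F × G) →L[ℝ] WithLp 2 (F × G) := (p.symm : F × G →L[ℝ] WithLp 2 (F × G)).comp
    (((T₁₁.coprod T₁₂).prod (T₂₁.coprod T₂₂)).comp (p : WithLp 2 (F × G) →L[ℝ] F × G))
  obtain ⟨e, he⟩ := exists_equiv_of_coercive T hc fun x => by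
    rw [WithLp.prod_norm_sq_eq_of_L2, WithLp.prod_inner_apply]
    exact h _ _
  obtain ⟨x, hx⟩ := e.surjective (WithLp.toLp 2 (f, g))
  rw [he] at hx
  refine ⟨x.fst, x.snd, congrArg WithLp.fst hx, congrArg WithLp.snd hx⟩

end Coercive

/-! ### Fourier expansions in the scale of the operator -/

namespace SpectralOperator

variable {H : Type*} [NormedAddCommGroup H] [InnerProductSpace ℝ H] [CompleteSpace H]
  (D : SpectralOperator H)

theorem hasSum_coef_mul (x y : H) : HasSum (fun k => D.coef x k * D.coef y k) (inner ℝ x y) := by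
  refine (D.e.hasSum_inner_mul_inner x y).congr_fun ?_
  intro k
  rw [coef, coef, real_inner_comm]

theorem ext_coef {x y : H} (h : ∀ k, D.coef x k = D.coef y k) : x = y := by
  apply D.e.repr.injective
  ext k
  rw [← coef_eq, ← coef_eq, h k]

theorem toH_injective (s : ℝ) : Function.Injective (D.toH s) := Subtype.val_injective

theorem rpow_mul_norm_toH_le {s : ℝ} (hs : 0 ≤ s) (v : D.F s) :
    D.lam 0 ^ s * ‖D.toH s v‖ ≤ ‖v‖ := by
  have h0 := Real.rpow_pos_of_pos (D.lam_pos 0) s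
  refine le_of_sq_le_sq ?_ (norm_nonneg v)
  rw [mul_pow, ← real_inner_self_eq_norm_sq, ← real_inner_self_eq_norm_sq v, inner_F]
  refine hasSum_le (fun k => ?_) ((D.hasSum_coef_mul (D.toH s v) (D.toH s v)).mul_left _)
    (D.hasSum_coef_mul (D.pow s v) (D.pow s v))
  rw [coef_pow]
  have h1 : D.lam 0 ^ s ≤ D.lam k ^ s :=
    Real.rpow_le_rpow (D.lam_pos 0).le (D.lam_mono (Nat.zero_le k)) hs
  have h2 : (D.lam 0 ^ s) ^ 2 ≤ (D.lam k ^ s) ^ 2 := pow_le_pow_left₀ h0.le h1 2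
  nlinarith [mul_self_nonneg (D.coef (D.toH s v) k)]

/-- The inclusion `F_s ⊆ H` as a bounded operator. -/
noncomputable def toHL {s : ℝ} (hs : 0 ≤ s) : D.F s →L[ℝ] H :=
  (D.toH s).mkContinuous (D.lam 0 ^ s)⁻¹ fun v => by
    have h0 := Real.rpow_pos_of_pos (D.lam_pos 0) s
    rw [inv_mul_eq_div, le_div_iff₀ h0, mul_comm]
    exact D.rpow_mul_norm_toH_le hs v

@[simp]
theorem toHL_apply {s : ℝ} (hs : 0 ≤ s) (v : D.F s) : D.toHL hs v = D.toH s v := rfl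

/-- The operator `A^s : F_s → H` as a bounded operator. -/
noncomputable def powL (s : ℝ) : D.F s →L[ℝ] H :=
  (D.pow s).mkContinuous 1 fun v => by rw [one_mul, norm_F]

@[simp]
theorem powL_apply (s : ℝ) (v : D.F s) : D.powL s v = D.pow s v := rfl

theorem coef_e (k j : ℕ) : D.coef (D.e k) j = if j = k then 1 else 0 := by
  rw [coef]
  exact orthonormal_iff_ite.1 D.e.orthonormal j k

theorem e_mem_domPow (s : ℝ) (k : ℕ) : D.e k ∈ D.domPow s := by
  rw [mem_domPow]
  refine summable_of_ne_finset_zero (s := {k}) fun j hj => ?_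
  rw [coef_e, if_neg (by simpa using hj)]
  simp

/-- The eigenvector `e_k` as an element of `F_s`. -/
noncomputable def eF (s : ℝ) (k : ℕ) : D.F s := D.mkF s (D.e k) (D.e_mem_domPow s k)

theorem toH_eF (s : ℝ) (k : ℕ) : D.toH s (D.eF s k) = D.e k := rfl

theorem pow_eF (s : ℝ) (k : ℕ) : D.pow s (D.eF s k) = D.lam k ^ s • D.e k := by
  refine D.ext_coef fun j => ?_
  rw [coef_pow, toH_eF, coef_e]
  simp only [coef, inner_smul_right]
  have := D.coef_e k j
  rw [coef] at this
  rw [this]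
  split_ifs with h
  · rw [h]
  · simp

theorem inner_e (x : H) (k : ℕ) : inner ℝ x (D.e k) = D.coef x k := real_inner_comm _ _

theorem inner_pow_eF (s : ℝ) (x : H) (k : ℕ) :
    inner ℝ x (D.pow s (D.eF s k)) = D.lam k ^ s * D.coef x k := by
  rw [pow_eF, inner_smul_right, inner_e]

theorem inner_eF (s : ℝ) (x : D.F s) (k : ℕ) :
    inner ℝ x (D.eF s k) = D.lam k ^ s * (D.lam k ^ s * D.coef (D.toH s x) k) := by
  rw [inner_F, inner_pow_eF, coef_pow]

theorem hasSum_inner_F (s : ℝ) (x y : D.F s) :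
    HasSum (fun k => D.lam k ^ s * (D.lam k ^ s * D.coef (D.toH s x) k) * D.coef (D.toH s y) k)
      (inner ℝ x y) := by
  rw [inner_F]
  refine (D.hasSum_coef_mul (D.pow s x) (D.pow s y)).congr_fun ?_
  intro k
  rw [coef_pow, coef_pow]
  ring

theorem hasSum_inner_pow (s : ℝ) (x : H) (y : D.F s) :
    HasSum (fun k => D.lam k ^ s * D.coef x k * D.coef (D.toH s y) k) (inner ℝ x (D.pow s y)) := by
  refine (D.hasSum_coef_mul x (D.pow s y)).congr_fun ?_
  intro k
  rw [coef_pow]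
  ring

theorem rpow_half_mul_self (k : ℕ) (x : ℝ) :
    D.lam k ^ (1 / 2 : ℝ) * (D.lam k ^ (1 / 2 : ℝ) * x) = D.lam k * x := by
  rw [← mul_assoc, ← Real.rpow_add (D.lam_pos k)]
  norm_num

theorem rpow_one_mul_self (k : ℕ) (x : ℝ) :
    D.lam k ^ (1 : ℝ) * (D.lam k ^ (1 : ℝ) * x) = D.lam k ^ 2 * x := by
  rw [Real.rpow_one]
  ring

end SpectralOperator

/-! ### The linear operator in weak form -/

section Graph

variable {H : Type*} [NormedAddCommGroup H] [InnerProductSpace ℝ H] [CompleteSpace H]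
  {D : SpectralOperator H} {μ₁ μ₂ : ℝ → ℝ} {δ₁ δ₂ β ν ω : ℝ}

/-- The equation for the displacement velocity, tested with elements of `F_1`. -/
theorem displacement_weak_iff (u ξ : D.F 1) (v w' : H) :
    (∀ k, D.coef w' k = -β * (D.lam k ^ 2 * D.coef (D.toH 1 u) k)
        - D.lam k ^ 2 * D.coef (D.toH 1 ξ) k + ν * (D.lam k * D.coef v k)) ↔
      ∀ φ : D.F 1, inner ℝ w' (D.toH 1 φ)
        = -β * inner ℝ u φ - inner ℝ ξ φ + ν * inner ℝ v (D.pow 1 φ) := by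
  refine ⟨fun h φ => ?_, fun h k => ?_⟩
  · refine (D.hasSum_coef_mul w' (D.toH 1 φ)).unique ?_
    refine (((((D.hasSum_inner_F 1 u φ).mul_left (-β)).sub (D.hasSum_inner_F 1 ξ φ)).add
      ((D.hasSum_inner_pow 1 v φ).mul_left ν)).congr_fun ?_)
    intro k
    rw [h k, D.rpow_one_mul_self, D.rpow_one_mul_self, Real.rpow_one]
    ring
  · have := h (D.eF 1 k)
    rwa [D.inner_eF, D.inner_eF, D.inner_pow_eF, D.toH_eF, D.inner_e, D.rpow_one_mul_self,
      D.rpow_one_mul_self, Real.rpow_one] at this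

/-- The equation for the temperature, tested with elements of `F_{1/2}`. -/
theorem temperature_weak_iff (v ξ : D.F (1 / 2)) (w : D.F 1) (v' : H) :
    (∀ k, D.coef v' k = -ω * (D.lam k * D.coef (D.toH (1 / 2) v) k)
        - D.lam k * D.coef (D.toH (1 / 2) ξ) k - ν * (D.lam k * D.coef (D.toH 1 w) k)) ↔
      ∀ ψ : D.F (1 / 2), inner ℝ v' (D.toH (1 / 2) ψ)
        = -ω * inner ℝ v ψ - inner ℝ ξ ψ - ν * inner ℝ (D.pow 1 w) (D.toH (1 / 2) ψ) := by
  refine ⟨fun h ψ => ?_, fun h k => ?_⟩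
  · refine (D.hasSum_coef_mul v' (D.toH (1 / 2) ψ)).unique ?_
    refine (((((D.hasSum_inner_F (1 / 2) v ψ).mul_left (-ω)).sub
      (D.hasSum_inner_F (1 / 2) ξ ψ)).sub
      ((D.hasSum_coef_mul (D.pow 1 w) (D.toH (1 / 2) ψ)).mul_left ν)).congr_fun ?_)
    intro k
    rw [h k, D.rpow_half_mul_self, D.rpow_half_mul_self, D.coef_pow, Real.rpow_one]
    ring
  · have := h (D.eF (1 / 2) k)
    rwa [D.inner_eF, D.inner_eF, D.toH_eF, D.inner_e, D.inner_e, D.rpow_half_mul_self,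
      D.rpow_half_mul_self, D.coef_pow, Real.rpow_one] at this

/-- All unbounded objects are traded for bounded ones: coefficients become weak equations, and
histories become Volterra images. Every later use of `L` starts from here. -/
theorem lGraph_iff (hμ₁ : IsMemoryKernel μ₁ δ₁) (hμ₂ : IsMemoryKernel μ₂ δ₂) {u u' : D.F 1}
    {w v w' v' : H} {ηb ηb' : MemorySpace μ₁ (D.F 1)} {η η' : MemorySpace μ₂ (D.F (1 / 2))} :
    LGraph D μ₁ μ₂ β ν ω (u, w, v, ηb, η) (u', w', v', ηb', η') ↔
      ∃ (θ : D.F (1 / 2)) (ζb : MemorySpace μ₁ (D.F 1)) (ζ : MemorySpace μ₂ (D.F (1 / 2))),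
        w = D.toH 1 u' ∧ v = D.toH (1 / 2) θ ∧ ηb = hμ₁.volterra ζb ∧ η = hμ₂.volterra ζ ∧
        (∀ φ : D.F 1, inner ℝ w' (D.toH 1 φ)
          = -β * inner ℝ u φ - inner ℝ ηb (hμ₁.const _ φ) + ν * inner ℝ v (D.pow 1 φ)) ∧
        (∀ ψ : D.F (1 / 2), inner ℝ v' (D.toH (1 / 2) ψ)
          = -ω * inner ℝ θ ψ - inner ℝ η (hμ₂.const _ ψ)
            - ν * inner ℝ (D.pow 1 u') (D.toH (1 / 2) ψ)) ∧
        ηb' = -ζb + hμ₁.const _ u' ∧ η' = -ζ + hμ₂.const _ θ := by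
  have haux : ∀ {μ : ℝ → ℝ} {δ : ℝ} {E : Type _} [NormedAddCommGroup E] [InnerProductSpace ℝ E]
      (hμ : IsMemoryKernel μ δ) (ξ ζ : MemorySpace μ E) (c : E),
      (∀ᵐ s ∂(weight μ), ξ s = -ζ s + c) ↔ ξ = -ζ + hμ.const _ c := by
    intro μ δ E _ _ hμ ξ ζ c
    have h0 : ∀ᵐ s ∂(weight μ), (-ζ + hμ.const _ c) s = -ζ s + c := by
      filter_upwards [Lp.coeFn_add (-ζ) (hμ.const _ c), Lp.coeFn_neg ζ, hμ.coeFn_const c]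
        with s h1 h2 h3
      rw [h1, Pi.add_apply, h2, Pi.neg_apply, h3]
    constructor
    · intro h
      refine Lp.ext ?_
      filter_upwards [h, h0] with s h1 h2
      rw [h1, h2]
    · rintro rfl
      exact h0
  simp only [hμ₁.inner_const, hμ₂.inner_const]
  constructor
  · rintro ⟨hw, hv, ζb, ζ, h1, h2, rfl, h4, h5, h6, h7⟩
    exact ⟨D.mkF (1 / 2) v hv, ζb, ζ, rfl, rfl, hμ₁.hasMemoryDeriv_iff.1 h1,
      hμ₂.hasMemoryDeriv_iff.1 h2, (displacement_weak_iff u _ v w').1 h4,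
      (temperature_weak_iff (D.mkF (1 / 2) v hv) _ (D.mkF 1 w hw) v').1 h5,
      (haux hμ₁ _ _ _).1 h6, (haux hμ₂ _ _ _).1 h7⟩
  · rintro ⟨θ, ζb, ζ, rfl, rfl, h1, h2, h4, h5, h6, h7⟩
    exact ⟨u'.2, θ.2, ζb, ζ, hμ₁.hasMemoryDeriv_iff.2 h1, hμ₂.hasMemoryDeriv_iff.2 h2, rfl,
      (displacement_weak_iff u _ _ w').2 h4, (temperature_weak_iff θ _ u' v').2 h5,
      (haux hμ₁ _ _ _).2 h6, (haux hμ₂ _ _ _).2 h7⟩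

end Graph

/-! ### Dissipativity and range of the linear operator -/

section Graph

variable {H : Type*} [NormedAddCommGroup H] [InnerProductSpace ℝ H] [CompleteSpace H]
  {D : SpectralOperator H} {μ₁ μ₂ : ℝ → ℝ} {δ₁ δ₂ β ν ω : ℝ}

theorem lGraph_add (hμ₁ : IsMemoryKernel μ₁ δ₁) (hμ₂ : IsMemoryKernel μ₂ δ₂)
    {U V U' V' : Phase D μ₁ μ₂} (h : LGraph D μ₁ μ₂ β ν ω U V) (h' : LGraph D μ₁ μ₂ β ν ω U' V') :
    LGraph D μ₁ μ₂ β ν ω (U + U') (V + V') := by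
  obtain ⟨u, w, v, ηb, η⟩ := U
  obtain ⟨a, b, c, d, e⟩ := V
  obtain ⟨u', w', v', ηb', η'⟩ := U'
  obtain ⟨a', b', c', d', e'⟩ := V'
  obtain ⟨θ, ζb, ζ, rfl, rfl, rfl, rfl, h1, h2, rfl, rfl⟩ := (lGraph_iff hμ₁ hμ₂).1 h
  obtain ⟨θ', ζb', ζ', rfl, rfl, rfl, rfl, h1', h2', rfl, rfl⟩ := (lGraph_iff hμ₁ hμ₂).1 h'
  refine (lGraph_iff hμ₁ hμ₂).2 ⟨θ + θ', ζb + ζb', ζ + ζ', (map_add _ _ _).symm,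
    (map_add _ _ _).symm, (map_add _ _ _).symm, (map_add _ _ _).symm, fun φ => ?_, fun ψ => ?_,
    ?_, ?_⟩
  · change inner ℝ (b + b') _ = -β * inner ℝ (u + u') φ
      - inner ℝ (hμ₁.volterra ζb + hμ₁.volterra ζb') _
      + ν * inner ℝ (D.toH (1 / 2) θ + D.toH (1 / 2) θ') _
    simp only [inner_add_left]
    rw [h1, h1']
    ring
  · change inner ℝ (c + c') _ = -ω * inner ℝ (θ + θ') ψ
      - inner ℝ (hμ₂.volterra ζ + hμ₂.volterra ζ') _ - ν * inner ℝ (D.pow 1 (a + a')) _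
    simp only [inner_add_left, map_add]
    rw [h2, h2']
    ring
  · change -ζb + _ + (-ζb' + _) = _
    rw [map_add]
    abel
  · change -ζ + _ + (-ζ' + _) = _
    rw [map_add]
    abel

theorem lGraph_smul (hμ₁ : IsMemoryKernel μ₁ δ₁) (hμ₂ : IsMemoryKernel μ₂ δ₂) (r : ℝ)
    {U V : Phase D μ₁ μ₂} (h : LGraph D μ₁ μ₂ β ν ω U V) :
    LGraph D μ₁ μ₂ β ν ω (r • U) (r • V) := by
  obtain ⟨u, w, v, ηb, η⟩ := U
  obtain ⟨a, b, c, d, e⟩ := V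
  obtain ⟨θ, ζb, ζ, rfl, rfl, rfl, rfl, h1, h2, rfl, rfl⟩ := (lGraph_iff hμ₁ hμ₂).1 h
  refine (lGraph_iff hμ₁ hμ₂).2 ⟨r • θ, r • ζb, r • ζ, (map_smul _ _ _).symm,
    (map_smul _ _ _).symm, (map_smul _ _ _).symm, (map_smul _ _ _).symm, fun φ => ?_, fun ψ => ?_,
    ?_, ?_⟩
  · change inner ℝ (r • b) _ = -β * inner ℝ (r • u) φ - inner ℝ (r • hμ₁.volterra ζb) _
      + ν * inner ℝ (r • D.toH (1 / 2) θ) _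
    simp only [real_inner_smul_left]
    rw [h1]
    ring
  · change inner ℝ (r • c) _ = -ω * inner ℝ (r • θ) ψ
      - inner ℝ (r • hμ₂.volterra ζ) _ - ν * inner ℝ (D.pow 1 (r • a)) _
    simp only [real_inner_smul_left, map_smul]
    rw [h2]
    ring
  · change r • (-ζb + _) = _
    rw [map_smul]
    module
  · change r • (-ζ + _) = _
    rw [map_smul]
    module

theorem lGraph_unique (hμ₁ : IsMemoryKernel μ₁ δ₁) (hμ₂ : IsMemoryKernel μ₂ δ₂)
    {V : Phase D μ₁ μ₂} (h : LGraph D μ₁ μ₂ β ν ω 0 V) : V = 0 := by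
  obtain ⟨a, b, c, d, e⟩ := V
  obtain ⟨θ, ζb, ζ, h1, h2, h3, h4, h5, h6, rfl, rfl⟩ := (lGraph_iff hμ₁ hμ₂).1 h
  have ha : a = 0 := D.toH_injective 1 (h1.symm.trans (map_zero _).symm)
  have hθ : θ = 0 := D.toH_injective _ (h2.symm.trans (map_zero _).symm)
  have hζb : ζb = 0 := hμ₁.eq_zero_of_hasMemoryDeriv_zero (hμ₁.hasMemoryDeriv_iff.2 h3)
  have hζ : ζ = 0 := hμ₂.eq_zero_of_hasMemoryDeriv_zero (hμ₂.hasMemoryDeriv_iff.2 h4)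
  subst ha hθ hζb hζ
  have hb : b = 0 := D.ext_coef fun k => by
    have := h5 (D.eF 1 k)
    change inner ℝ b (D.toH 1 (D.eF 1 k)) = -β * inner ℝ (0 : D.F 1) _
      - inner ℝ (0 : MemorySpace μ₁ (D.F 1)) _ + ν * inner ℝ (0 : H) _ at this
    rw [D.toH_eF, D.inner_e] at this
    rw [this]
    simp [SpectralOperator.coef]
  have hc : c = 0 := D.ext_coef fun k => by
    have := h6 (D.eF (1 / 2) k)
    change inner ℝ c (D.toH (1 / 2) (D.eF (1 / 2) k)) = -ω * inner ℝ (0 : D.F (1 / 2)) _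
      - inner ℝ (0 : MemorySpace μ₂ (D.F (1 / 2))) _ - ν * inner ℝ (D.pow 1 0) _ at this
    rw [D.toH_eF, D.inner_e] at this
    rw [this]
    simp [SpectralOperator.coef]
  subst hb hc
  simp

/-- The inner product of the phase space that belongs to `normSq`. -/
noncomputable def energyInner (D : SpectralOperator H) (μ₁ μ₂ : ℝ → ℝ) (β : ℝ)
    (U V : Phase D μ₁ μ₂) : ℝ :=
  β * inner ℝ U.1 V.1 + inner ℝ U.2.1 V.2.1 + inner ℝ U.2.2.1 V.2.2.1
    + inner ℝ U.2.2.2.1 V.2.2.2.1 + inner ℝ U.2.2.2.2 V.2.2.2.2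

/-- A lower bound of the energy that is dissipated per unit of time. -/
noncomputable def dissipation (D : SpectralOperator H) (μ₁ μ₂ : ℝ → ℝ) (δ₁ δ₂ ω : ℝ)
    (U : Phase D μ₁ μ₂) : ℝ :=
  ω * D.lam 0 * ‖U.2.2.1‖ ^ 2 + δ₁ / 2 * ‖U.2.2.2.1‖ ^ 2 + δ₂ / 2 * ‖U.2.2.2.2‖ ^ 2

theorem lam_mul_norm_toH_sq_le (θ : D.F (1 / 2)) :
    D.lam 0 * ‖D.toH (1 / 2) θ‖ ^ 2 ≤ ‖θ‖ ^ 2 := by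
  have h := D.rpow_mul_norm_toH_le (by norm_num : (0 : ℝ) ≤ 1 / 2) θ
  have h2 := pow_le_pow_left₀ (mul_nonneg (Real.rpow_nonneg (D.lam_pos 0).le _) (norm_nonneg _)) h 2
  have e : (D.lam 0 ^ (1 / 2 : ℝ)) ^ 2 = D.lam 0 := by
    have := D.rpow_half_mul_self 0 1
    rwa [mul_one, mul_one, ← pow_two] at this
  rwa [mul_pow, e] at h2

/-- Testing the weak equations with the velocities themselves cancels the couplings. What is left is
bounded by the Volterra inequality and by `λ₀ ‖v‖² ≤ ‖A^{1/2} v‖²`. -/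
theorem lGraph_dissip (hμ₁ : IsMemoryKernel μ₁ δ₁) (hμ₂ : IsMemoryKernel μ₂ δ₂) (hω : 0 ≤ ω)
    {U V : Phase D μ₁ μ₂} (h : LGraph D μ₁ μ₂ β ν ω U V) :
    energyInner D μ₁ μ₂ β U V ≤ -dissipation D μ₁ μ₂ δ₁ δ₂ ω U := by
  obtain ⟨u, w, v, ηb, η⟩ := U
  obtain ⟨a, b, c, d, e⟩ := V
  obtain ⟨θ, ζb, ζ, rfl, rfl, rfl, rfl, h1, h2, rfl, rfl⟩ := (lGraph_iff hμ₁ hμ₂).1 h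
  have h3 := hμ₁.mul_norm_volterra_sq_le ζb
  have h4 := hμ₂.mul_norm_volterra_sq_le ζ
  have h5 := mul_le_mul_of_nonneg_left (lam_mul_norm_toH_sq_le θ) hω
  simp only [energyInner, dissipation, inner_add_right, inner_neg_right]
  rw [real_inner_comm b, real_inner_comm c, h1, h2, real_inner_self_eq_norm_sq,
    real_inner_comm (D.toH (1 / 2) θ) (D.pow 1 a)]
  linarith

/-- The operator `K = V (1 + z V)⁻¹` of the memory with Volterra operator `V`. -/
theorem IsMemoryKernel.exists_inverse {μ : ℝ → ℝ} {δ : ℝ} {E : Type*} [NormedAddCommGroup E]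
    [InnerProductSpace ℝ E] [CompleteSpace E] (hμ : IsMemoryKernel μ δ) {z : ℝ} (hz : 0 < z) :
    ∃ e : MemorySpace μ E ≃L[ℝ] MemorySpace μ E, (∀ ζ, e ζ = ζ + z • hμ.volterra ζ) ∧
      ∀ g, z * ‖hμ.volterra (e.symm g)‖ ^ 2 ≤ inner ℝ (hμ.volterra (e.symm g)) g := by
  have hδ := hμ.rate_pos
  have hnn : ∀ ζ : MemorySpace μ E, 0 ≤ inner ℝ (hμ.volterra ζ) ζ := fun ζ =>
    le_trans (by positivity) (hμ.mul_norm_volterra_sq_le ζ)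
  obtain ⟨e, he⟩ := exists_equiv_of_coercive
    (ContinuousLinearMap.id ℝ (MemorySpace μ E) + z • hμ.volterra) one_pos fun ζ => by
      change 1 * ‖ζ‖ ^ 2 ≤ inner ℝ (ζ + z • hμ.volterra ζ) ζ
      rw [inner_add_left, real_inner_smul_left, real_inner_self_eq_norm_sq, one_mul]
      exact le_add_of_nonneg_right (mul_nonneg hz.le (hnn ζ))
  have he' : ∀ ζ, e ζ = ζ + z • hμ.volterra ζ := he
  refine ⟨e, he', fun g => ?_⟩
  have h1 : g = e.symm g + z • hμ.volterra (e.symm g) := by rw [← he', e.apply_symm_apply]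
  calc z * ‖hμ.volterra (e.symm g)‖ ^ 2
      ≤ inner ℝ (hμ.volterra (e.symm g)) (e.symm g)
        + z * ‖hμ.volterra (e.symm g)‖ ^ 2 := le_add_of_nonneg_left (hnn _)
    _ = inner ℝ (hμ.volterra (e.symm g)) (e.symm g + z • hμ.volterra (e.symm g)) := by
        rw [inner_add_right, real_inner_smul_right, real_inner_self_eq_norm_sq]
    _ = inner ℝ (hμ.volterra (e.symm g)) g := by rw [← h1]

/-- Solution of the system that the resolvent equation leaves for the two velocities. -/
theorem exists_resolvent_velocities {F G H M N : Type*}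
    [NormedAddCommGroup F] [InnerProductSpace ℝ F] [CompleteSpace F]
    [NormedAddCommGroup G] [InnerProductSpace ℝ G] [CompleteSpace G]
    [NormedAddCommGroup H] [InnerProductSpace ℝ H] [CompleteSpace H]
    [NormedAddCommGroup M] [InnerProductSpace ℝ M] [CompleteSpace M]
    [NormedAddCommGroup N] [InnerProductSpace ℝ N] [CompleteSpace N]
    (i₁ P : F →L[ℝ] H) (i₂ : G →L[ℝ] H) (C₁ : F →L[ℝ] M) (C₂ : G →L[ℝ] N) (K₁ : M →L[ℝ] M)
    (K₂ : N →L[ℝ] N) {z k ν ω c : ℝ} (hz : 0 < z) (hk : 0 < k) (hc : 0 < c)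
    (hK₁ : ∀ a, 0 ≤ inner ℝ (K₁ (C₁ a)) (C₁ a))
    (hK₂ : ∀ b, c * ‖b‖ ^ 2 ≤ ω * ‖b‖ ^ 2 + inner ℝ (K₂ (C₂ b)) (C₂ b))
    (g₁ : F) (g₂ g₃ : H) (g₄ : M) (g₅ : N) :
    ∃ a b, (∀ φ, z * inner ℝ (i₁ a) (i₁ φ) - inner ℝ g₂ (i₁ φ)
        = -(k * (inner ℝ a φ + inner ℝ g₁ φ)) - inner ℝ (K₁ (g₄ + C₁ a)) (C₁ φ)
          + ν * inner ℝ (i₂ b) (P φ)) ∧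
      ∀ ψ, z * inner ℝ (i₂ b) (i₂ ψ) - inner ℝ g₃ (i₂ ψ)
        = -ω * inner ℝ b ψ - inner ℝ (K₂ (g₅ + C₂ b)) (C₂ ψ) - ν * inner ℝ (P a) (i₂ ψ) := by
  -- The blocks of the bilinear form. `T₁₂` is minus the adjoint of `T₂₁`, so the two disappear from
  -- the quadratic form.
  let T₁₁ : F →L[ℝ] F := z • (i₁.adjoint.comp i₁)
    + k • ContinuousLinearMap.id ℝ F + C₁.adjoint.comp (K₁.comp C₁)
  let T₁₂ : G →L[ℝ] F := -(ν • (P.adjoint.comp i₂))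
  let T₂₁ : F →L[ℝ] G := ν • (i₂.adjoint.comp P)
  let T₂₂ : G →L[ℝ] G := z • (i₂.adjoint.comp i₂)
    + ω • ContinuousLinearMap.id ℝ G + C₂.adjoint.comp (K₂.comp C₂)
  have h1 : ∀ a b φ, inner ℝ (T₁₁ a + T₁₂ b) φ = z * inner ℝ (i₁ a) (i₁ φ)
      + k * inner ℝ a φ + inner ℝ (K₁ (C₁ a)) (C₁ φ) - ν * inner ℝ (i₂ b) (P φ) := by
    intro a b φ
    change inner ℝ (z • i₁.adjoint (i₁ a) + k • a + C₁.adjoint (K₁ (C₁ a))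
      + -(ν • P.adjoint (i₂ b))) φ = _
    simp only [inner_add_left, inner_neg_left, real_inner_smul_left,
      ContinuousLinearMap.adjoint_inner_left]
    ring
  have h2 : ∀ a b ψ, inner ℝ (T₂₁ a + T₂₂ b) ψ = ν * inner ℝ (P a) (i₂ ψ)
      + z * inner ℝ (i₂ b) (i₂ ψ) + ω * inner ℝ b ψ + inner ℝ (K₂ (C₂ b)) (C₂ ψ) := by
    intro a b ψ
    change inner ℝ (ν • i₂.adjoint (P a) + (z • i₂.adjoint (i₂ b) + ω • b
      + C₂.adjoint (K₂ (C₂ b)))) ψ = _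
    simp only [inner_add_left, real_inner_smul_left, ContinuousLinearMap.adjoint_inner_left]
    ring
  obtain ⟨a, b, ha, hb⟩ := exists_of_coercive_prod T₁₁ T₁₂ T₂₁ T₂₂
    (c := min k c) (by positivity) (fun a b => by
      rw [h1, h2, real_inner_comm (P a) (i₂ b)]
      have e1 := hK₁ a
      have e2 := hK₂ b
      have e4 : min k c * ‖a‖ ^ 2 ≤ k * ‖a‖ ^ 2 :=
        mul_le_mul_of_nonneg_right (min_le_left _ _) (sq_nonneg _)
      have e5 : min k c * ‖b‖ ^ 2 ≤ c * ‖b‖ ^ 2 :=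
        mul_le_mul_of_nonneg_right (min_le_right _ _) (sq_nonneg _)
      have e6 : 0 ≤ z * inner ℝ (i₁ a) (i₁ a) := mul_nonneg hz.le real_inner_self_nonneg
      have e7 : 0 ≤ z * inner ℝ (i₂ b) (i₂ b) := mul_nonneg hz.le real_inner_self_nonneg
      rw [real_inner_self_eq_norm_sq a, real_inner_self_eq_norm_sq b]
      linarith)
    (i₁.adjoint g₂ - k • g₁ - C₁.adjoint (K₁ g₄)) (i₂.adjoint g₃ - C₂.adjoint (K₂ g₅))
  refine ⟨a, b, fun φ => ?_, fun ψ => ?_⟩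
  · have h3 := h1 a b φ
    rw [ha, inner_sub_left, inner_sub_left, real_inner_smul_left,
      ContinuousLinearMap.adjoint_inner_left, ContinuousLinearMap.adjoint_inner_left] at h3
    rw [map_add, inner_add_left]
    linarith
  · have h3 := h2 a b ψ
    rw [hb, inner_sub_left, ContinuousLinearMap.adjoint_inner_left,
      ContinuousLinearMap.adjoint_inner_left] at h3
    rw [map_add, inner_add_left]
    linarith

/-- If `ω > 0`, take `c = ω`. If `ω = 0`, let `(1 + zV) x` be the constant `b`. Then `V` applied to
this constant is `(1 + zV) V x`, and being bounded below on constants it yields `‖V x‖ ≥ const ‖b‖`.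
The memory term is at least `z ‖V x‖²`. -/
theorem IsMemoryKernel.exists_coercive {μ : ℝ → ℝ} {δ : ℝ} {E : Type*} [NormedAddCommGroup E]
    [InnerProductSpace ℝ E] [CompleteSpace E] (hμ : IsMemoryKernel μ δ) {z : ℝ} (hz : 0 < z)
    (hω : 0 ≤ ω) (hnd : ω = 0 → ∃ s, 0 < s ∧ μ s ≠ 0)
    {e : MemorySpace μ E ≃L[ℝ] MemorySpace μ E} (he : ∀ ζ, e ζ = ζ + z • hμ.volterra ζ)
    (hp : ∀ g, z * ‖hμ.volterra (e.symm g)‖ ^ 2 ≤ inner ℝ (hμ.volterra (e.symm g)) g) :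
    ∃ c, 0 < c ∧ ∀ b : E, c * ‖b‖ ^ 2 ≤ ω * ‖b‖ ^ 2
      + inner ℝ (hμ.volterra (e.symm (hμ.const E b))) (hμ.const E b) := by
  rcases hω.eq_or_lt with h0 | h0
  · obtain ⟨c, hc, hcb⟩ := hμ.exists_norm_volterra_const_ge (E := E) (hnd h0.symm)
    set n := 1 + z * ‖hμ.volterra (E := E)‖ with hn
    have hn0 : 0 < n := by positivity
    refine ⟨z * (c / n) ^ 2, by positivity, fun b => ?_⟩
    set x := e.symm (hμ.const E b) with hx
    have h1 : hμ.volterra (hμ.const E b) = hμ.volterra x + z • hμ.volterra (hμ.volterra x) := by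
      rw [← map_smul, ← map_add, ← he, hx, e.apply_symm_apply]
    have h2 : ‖hμ.volterra (hμ.const E b)‖ ≤ n * ‖hμ.volterra x‖ := by
      rw [h1, hn, add_mul, one_mul]
      refine (norm_add_le _ _).trans (add_le_add_right ?_ _)
      rw [norm_smul, Real.norm_of_nonneg hz.le, mul_assoc]
      exact mul_le_mul_of_nonneg_left (ContinuousLinearMap.le_opNorm _ _) hz.le
    have h3 : c / n * ‖b‖ ≤ ‖hμ.volterra x‖ := by
      rw [div_mul_eq_mul_div, div_le_iff₀ hn0, mul_comm _ n]
      exact (hcb b).trans h2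
    have h4 := pow_le_pow_left₀ (by positivity) h3 2
    have h5 := (mul_le_mul_of_nonneg_left h4 hz.le).trans (hp (hμ.const E b))
    rw [← h0, zero_mul, zero_add]
    refine le_of_eq_of_le ?_ h5
    ring
  · exact ⟨ω, h0, fun b => le_add_of_nonneg_right (le_trans (by positivity) (hp _))⟩

theorem lGraph_range (hμ₁ : IsMemoryKernel μ₁ δ₁) (hμ₂ : IsMemoryKernel μ₂ δ₂) (hβ : 0 < β)
    (hω : 0 ≤ ω) (hnd : ω = 0 → ∃ s, 0 < s ∧ μ₂ s ≠ 0) {z : ℝ} (hz : 0 < z)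
    (G : Phase D μ₁ μ₂) : ∃ U V, LGraph D μ₁ μ₂ β ν ω U V ∧ z • U - V = G := by
  obtain ⟨g₁, g₂, g₃, g₄, g₅⟩ := G
  obtain ⟨e₁, he₁, hp₁⟩ := hμ₁.exists_inverse (E := D.F 1) hz
  obtain ⟨e₂, he₂, hp₂⟩ := hμ₂.exists_inverse (E := D.F (1 / 2)) hz
  obtain ⟨c, hc, hcoer⟩ := hμ₂.exists_coercive hz hω hnd he₂ hp₂
  obtain ⟨a, b, ha, hb⟩ := exists_resolvent_velocities (D.toHL zero_le_one) (D.powL 1)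
    (D.toHL (by norm_num)) (hμ₁.const (D.F 1)) (hμ₂.const (D.F (1 / 2)))
    (hμ₁.volterra.comp (e₁.symm : MemorySpace μ₁ (D.F 1) →L[ℝ] MemorySpace μ₁ (D.F 1)))
    (hμ₂.volterra.comp
      (e₂.symm : MemorySpace μ₂ (D.F (1 / 2)) →L[ℝ] MemorySpace μ₂ (D.F (1 / 2))))
    (ν := ν) hz (div_pos hβ hz) hc (fun a => le_trans (by positivity) (hp₁ _)) hcoer g₁ g₂ g₃ g₄ g₅
  have heb : e₁ (e₁.symm (g₄ + hμ₁.const _ a)) = g₄ + hμ₁.const _ a := e₁.apply_symm_apply _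
  have heη : e₂ (e₂.symm (g₅ + hμ₂.const _ b)) = g₅ + hμ₂.const _ b := e₂.apply_symm_apply _
  simp only [ContinuousLinearMap.comp_apply, ContinuousLinearEquiv.coe_coe,
    SpectralOperator.toHL_apply, SpectralOperator.powL_apply] at ha hb
  generalize e₁.symm (g₄ + hμ₁.const _ a) = ζb at ha heb
  generalize e₂.symm (g₅ + hμ₂.const _ b) = ζ at hb heη
  rw [he₁] at heb
  rw [he₂] at heη
  -- The displacement comes from `z u - a = g₁`, and the histories are `V ζ` with `(1 + zV) ζ` equal
  -- to the datum plus the constant velocity.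
  refine ⟨(z⁻¹ • (a + g₁), D.toH 1 a, D.toH (1 / 2) b, hμ₁.volterra ζb, hμ₂.volterra ζ),
    (a, z • D.toH 1 a - g₂, z • D.toH (1 / 2) b - g₃, -ζb + hμ₁.const _ a, -ζ + hμ₂.const _ b),
    (lGraph_iff hμ₁ hμ₂).2 ⟨b, ζb, ζ, rfl, rfl, rfl, rfl, fun φ => ?_, fun ψ => ?_, rfl, rfl⟩, ?_⟩
  · rw [inner_sub_left, real_inner_smul_left, real_inner_smul_left, inner_add_left, ha φ]
    ring
  · rw [inner_sub_left, real_inner_smul_left, hb ψ]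
  · simp only [Prod.smul_mk, Prod.mk_sub_mk, Prod.mk.injEq]
    refine ⟨?_, by abel, by abel, ?_, ?_⟩
    · rw [smul_smul, mul_inv_cancel₀ hz.ne', one_smul]
      abel
    · rw [neg_add_eq_sub, sub_sub_eq_add_sub, add_comm, heb, add_sub_cancel_right]
    · rw [neg_add_eq_sub, sub_sub_eq_add_sub, add_comm, heη, add_sub_cancel_right]

end Graph

/-! ### Transport of semigroups and solutions along an isomorphism -/

section Transfer

variable {X Y : Type*} [NormedAddCommGroup X] [NormedSpace ℝ X] [NormedAddCommGroup Y]
  [NormedSpace ℝ Y] (T : Y ≃L[ℝ] X)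

/-- The family of operators on `Y` that corresponds to `E` on the isomorphic space `X`. -/
noncomputable def pullback (E : ℝ → X →L[ℝ] X) (t : ℝ) : Y →L[ℝ] Y :=
  (T.symm : X →L[ℝ] Y).comp ((E t).comp (T : Y →L[ℝ] X))

theorem pullback_apply (E : ℝ → X →L[ℝ] X) (t : ℝ) (y : Y) :
    pullback T E t y = T.symm (E t (T y)) := rfl

theorem HasGenerator.pullback {E : ℝ → X →L[ℝ] X} {graph : Y → Y → Prop}
    (h : HasGenerator E fun x y => graph (T.symm x) (T.symm y)) :
    HasGenerator (pullback T E) graph := by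
  intro x y
  have h1 := h (T x) (T y)
  simp only [T.symm_apply_apply] at h1
  rw [h1]
  have e : (fun t : ℝ => t⁻¹ • (BergerPlate.pullback T E t x - x))
      = fun t => T.symm (t⁻¹ • (E t (T x) - T x)) := by
    funext t
    rw [map_smul, map_sub, T.symm_apply_apply, pullback_apply]
  rw [e]
  constructor
  · intro h2
    have := (T.symm.continuous.tendsto _).comp h2
    rwa [T.symm_apply_apply] at this
  · intro h2
    have := (T.continuous.tendsto _).comp h2
    simpa [Function.comp_def] using this

/-- A continuous linear equivalence commutes with the Bochner integral without any integrability
assumption. -/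
theorem isMildSolution_pullback_iff [CompleteSpace X] [CompleteSpace Y] {E : ℝ → X →L[ℝ] X}
    {f : Y → Y} {U₀ : Y} {t : ℝ} {U : ℝ → Y} :
    IsMildSolution (pullback T E) f U₀ t U ↔
      IsMildSolution E (fun x => T (f (T.symm x))) (T U₀) t (fun t => T (U t)) := by
  unfold IsMildSolution
  refine and_congr ⟨fun h => T.continuous.comp_continuousOn h, fun h => ?_⟩
    (forall₂_congr fun r _ => ?_)
  · have := T.symm.continuous.comp_continuousOn h
    simpa [Function.comp_def] using this
  · have e : T (∫ τ in (0 : ℝ)..r, pullback T E (r - τ) (f (U τ)))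
        = ∫ τ in (0 : ℝ)..r, E (r - τ) (T (f (T.symm (T (U τ))))) := by
      rw [intervalIntegral, intervalIntegral, map_sub, ← T.integral_comp_comm,
        ← T.integral_comp_comm]
      simp only [pullback_apply, T.apply_symm_apply, T.symm_apply_apply]
    rw [← e, ← T.apply_symm_apply (E r (T U₀)), ← map_add, T.injective.eq_iff, pullback_apply]

theorem IsDynamicalSystem.pullback {S : ℝ → X → X} (h : IsDynamicalSystem S) :
    IsDynamicalSystem fun t y => T.symm (S t (T y)) where
  zero y := by rw [h.zero, T.symm_apply_apply]
  add s t hs ht y := by rw [h.add s t hs ht, T.apply_symm_apply]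
  continuousOn := by
    refine T.symm.continuous.comp_continuousOn (h.continuousOn.comp
      (continuous_fst.prodMk (T.continuous.comp continuous_snd)).continuousOn fun q hq => ?_)
    exact ⟨hq.1, mem_univ _⟩

end Transfer

/-! ### The phase space with its energy norm -/

section EnergySpace

variable {H : Type*} [NormedAddCommGroup H] [InnerProductSpace ℝ H] [CompleteSpace H]

/-- The phase space with the Hilbert norm `normSq`; the displacement is rescaled by `√β`. -/
abbrev EnergySpace (D : SpectralOperator H) (μ₁ μ₂ : ℝ → ℝ) : Type _ :=
  WithLp 2 (D.F 1 × WithLp 2 (H × WithLp 2 (H ×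
    WithLp 2 (MemorySpace μ₁ (D.F 1) × MemorySpace μ₂ (D.F (1 / 2))))))

/-- The isomorphism of the phase space and the energy space. -/
noncomputable def toEnergy (D : SpectralOperator H) (μ₁ μ₂ : ℝ → ℝ) {β : ℝ} (hβ : 0 < β) :
    Phase D μ₁ μ₂ ≃L[ℝ] EnergySpace D μ₁ μ₂ where
  toFun U := WithLp.toLp 2 (√β • U.1, WithLp.toLp 2 (U.2.1, WithLp.toLp 2 (U.2.2.1,
    WithLp.toLp 2 (U.2.2.2.1, U.2.2.2.2))))
  invFun x := ((√β)⁻¹ • x.fst, x.snd.fst, x.snd.snd.fst, x.snd.snd.snd.fst, x.snd.snd.snd.snd)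
  map_add' U V := by
    simp only [Prod.fst_add, Prod.snd_add, smul_add]
    rfl
  map_smul' c U := by
    simp only [Prod.smul_fst, Prod.smul_snd, smul_comm (√β) c]
    rfl
  left_inv U := by
    change ((√β)⁻¹ • √β • U.1, U.2) = U
    rw [smul_smul, inv_mul_cancel₀ (Real.sqrt_pos.2 hβ).ne', one_smul]
  right_inv x := by
    simp only [smul_smul, mul_inv_cancel₀ (Real.sqrt_pos.2 hβ).ne', one_smul]
    rfl
  continuous_toFun := by fun_prop
  continuous_invFun := by fun_prop

variable {D : SpectralOperator H} {μ₁ μ₂ : ℝ → ℝ} {δ₁ δ₂ β ν ω : ℝ}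

theorem inner_toEnergy (hβ : 0 < β) (U V : Phase D μ₁ μ₂) :
    inner ℝ (toEnergy D μ₁ μ₂ hβ U) (toEnergy D μ₁ μ₂ hβ V) = energyInner D μ₁ μ₂ β U V := by
  change inner ℝ (WithLp.toLp 2 (√β • U.1, WithLp.toLp 2 (U.2.1, WithLp.toLp 2 (U.2.2.1,
    WithLp.toLp 2 (U.2.2.2.1, U.2.2.2.2)))) : EnergySpace D μ₁ μ₂)
    (WithLp.toLp 2 (√β • V.1, WithLp.toLp 2 (V.2.1, WithLp.toLp 2 (V.2.2.1,
    WithLp.toLp 2 (V.2.2.2.1, V.2.2.2.2)))) : EnergySpace D μ₁ μ₂) = _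
  simp only [WithLp.prod_inner_apply, real_inner_smul_left, real_inner_smul_right, ← mul_assoc,
    Real.mul_self_sqrt hβ.le]
  rw [energyInner]
  ring

theorem norm_toEnergy_sq (hβ : 0 < β) (U : Phase D μ₁ μ₂) :
    ‖toEnergy D μ₁ μ₂ hβ U‖ ^ 2 = normSq D μ₁ μ₂ β U := by
  obtain ⟨u, w, v, ηb, η⟩ := U
  rw [← real_inner_self_eq_norm_sq, inner_toEnergy]
  simp only [energyInner, normSq, real_inner_self_eq_norm_sq, D.norm_F]

/-- The graph of `L` in the energy space. -/
def EnergyGraph (D : SpectralOperator H) (μ₁ μ₂ : ℝ → ℝ) {β : ℝ} (hβ : 0 < β) (ν ω : ℝ)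
    (x y : EnergySpace D μ₁ μ₂) : Prop :=
  LGraph D μ₁ μ₂ β ν ω ((toEnergy D μ₁ μ₂ hβ).symm x) ((toEnergy D μ₁ μ₂ hβ).symm y)

theorem isMaxDissipative_energyGraph (hβ : 0 < β) (hω : 0 ≤ ω) (hμ₁ : IsMemoryKernel μ₁ δ₁)
    (hμ₂ : IsMemoryKernel μ₂ δ₂) (hnd : ω = 0 → ∃ s, 0 < s ∧ μ₂ s ≠ 0) :
    IsMaxDissipative (EnergyGraph D μ₁ μ₂ hβ ν ω) where
  add h h' := by
    unfold EnergyGraph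
    rw [map_add, map_add]
    exact lGraph_add hμ₁ hμ₂ h h'
  smul c _ _ h := by
    unfold EnergyGraph
    rw [map_smul, map_smul]
    exact lGraph_smul hμ₁ hμ₂ c h
  dissip {x y} h := by
    have h1 := lGraph_dissip hμ₁ hμ₂ hω h
    rw [← inner_toEnergy hβ, ContinuousLinearEquiv.apply_symm_apply,
      ContinuousLinearEquiv.apply_symm_apply] at h1
    refine h1.trans (neg_nonpos.2 ?_)
    have := D.lam_pos 0
    have := hμ₁.rate_pos
    have := hμ₂.rate_pos
    unfold dissipation
    positivity
  range z hz g := by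
    obtain ⟨U, V, h, he⟩ := lGraph_range (ν := ν) hμ₁ hμ₂ hβ hω hnd hz
      ((toEnergy D μ₁ μ₂ hβ).symm g)
    refine ⟨toEnergy D μ₁ μ₂ hβ U, toEnergy D μ₁ μ₂ hβ V, ?_, ?_⟩
    · unfold EnergyGraph
      rwa [ContinuousLinearEquiv.symm_apply_apply, ContinuousLinearEquiv.symm_apply_apply]
    · rw [← map_smul, ← map_sub, he, ContinuousLinearEquiv.apply_symm_apply]
  unique {y} h := by
    unfold EnergyGraph at h
    rw [map_zero] at h
    have := lGraph_unique hμ₁ hμ₂ h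
    exact (map_eq_zero_iff _ (toEnergy D μ₁ μ₂ hβ).symm.injective).1 this

end EnergySpace

/-! ### Restoring force and potential energy -/

theorem continuous_comp_max {M : ℝ → ℝ} (hM : ContinuousOn M (Ici 0)) :
    Continuous fun z => M (max z 0) :=
  hM.comp_continuous (continuous_id.max continuous_const) fun _ => mem_Ici.2 (le_max_right _ _)

theorem primitive_eq {M : ℝ → ℝ} {z : ℝ} (hz : 0 ≤ z) :
    primitive M z = ∫ ξ in (0 : ℝ)..z, M (max ξ 0) := by
  refine intervalIntegral.integral_congr fun ξ hξ => ?_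
  rw [uIcc_of_le hz] at hξ
  simp only [max_eq_left hξ.1]

theorem IsLocallyLipschitz.conj {X Y : Type*} [NormedAddCommGroup X] [NormedSpace ℝ X]
    [NormedAddCommGroup Y] [NormedSpace ℝ Y] (T : Y ≃L[ℝ] X) {f : Y → Y}
    (hf : IsLocallyLipschitz f) : IsLocallyLipschitz fun x => T (f (T.symm x)) := by
  intro r
  set A := ‖(T : Y →L[ℝ] X)‖
  set B := ‖(T.symm : X →L[ℝ] Y)‖
  have hB : ∀ x, ‖T.symm x‖ ≤ B * ‖x‖ := (T.symm : X →L[ℝ] Y).le_opNorm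
  have hA : ∀ y, ‖T y‖ ≤ A * ‖y‖ := (T : Y →L[ℝ] X).le_opNorm
  obtain ⟨K, hK, h⟩ := hf (B * r)
  refine ⟨A * (K * B), by positivity, fun x y hx hy => ?_⟩
  rw [← map_sub]
  refine (hA _).trans ?_
  rw [mul_assoc, mul_assoc]
  refine mul_le_mul_of_nonneg_left ((h _ _ ((hB x).trans ?_) ((hB y).trans ?_)).trans ?_)
    (norm_nonneg _)
  · exact mul_le_mul_of_nonneg_left hx (norm_nonneg _)
  · exact mul_le_mul_of_nonneg_left hy (norm_nonneg _)
  · rw [← map_sub]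
    exact mul_le_mul_of_nonneg_left (hB _) hK

section Potential

variable {H : Type*} [NormedAddCommGroup H] [InnerProductSpace ℝ H] [CompleteSpace H]
  (D : SpectralOperator H)

namespace SpectralOperator

theorem toH_mkF (s : ℝ) (v : H) (hv : v ∈ D.domPow s) : D.toH s (D.mkF s v hv) = v := rfl

theorem toH_incl (u : D.F 1) : D.toH (1 / 2) (D.incl u) = D.toH 1 u :=
  D.toH_mkF (1 / 2) (D.toH 1 u) (D.domPow_mono u.2)

theorem norm_pow_half_sq (u : D.F 1) :
    ‖D.pow (1 / 2) (D.incl u)‖ ^ 2 = inner ℝ (D.toH 1 u) (D.pow 1 u) := by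
  rw [← real_inner_self_eq_norm_sq]
  refine (D.hasSum_coef_mul _ _).unique ?_
  refine (D.hasSum_inner_pow 1 (D.toH 1 u) u).congr_fun ?_
  intro k
  rw [coef_pow, toH_incl, Real.rpow_one, ← D.rpow_half_mul_self k (D.coef _ _)]
  ring

theorem inner_toH_pow_comm (u v : D.F 1) :
    inner ℝ (D.toH 1 u) (D.pow 1 v) = inner ℝ (D.toH 1 v) (D.pow 1 u) := by
  refine (D.hasSum_inner_pow 1 (D.toH 1 u) v).unique ?_
  refine (D.hasSum_inner_pow 1 (D.toH 1 v) u).congr_fun ?_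
  intro k
  ring

/-- By symmetry of `A`, a difference of squares in which the difference of the displacements is
measured only in `H`. It gives the Lipschitz bound of the force and the chain rule for the
potential. -/
theorem norm_pow_half_sq_sub (u v : D.F 1) :
    ‖D.pow (1 / 2) (D.incl u)‖ ^ 2 - ‖D.pow (1 / 2) (D.incl v)‖ ^ 2
      = inner ℝ (D.toH 1 u - D.toH 1 v) (D.pow 1 u + D.pow 1 v) := by
  rw [norm_pow_half_sq, norm_pow_half_sq, inner_sub_left, inner_add_right, inner_add_right,
    D.inner_toH_pow_comm u v]
  ring

theorem lam_mul_norm_toH_le (u : D.F 1) : D.lam 0 * ‖D.toH 1 u‖ ≤ ‖u‖ := by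
  have := D.rpow_mul_norm_toH_le zero_le_one u
  rwa [Real.rpow_one] at this

theorem norm_pow_half_sq_le (u : D.F 1) :
    ‖D.pow (1 / 2) (D.incl u)‖ ^ 2 ≤ ‖D.toH 1 u‖ * ‖u‖ := by
  rw [norm_pow_half_sq]
  exact real_inner_le_norm _ _

theorem lam_mul_norm_pow_half_sq_le (u : D.F 1) :
    D.lam 0 * ‖D.pow (1 / 2) (D.incl u)‖ ^ 2 ≤ ‖u‖ ^ 2 := by
  have h1 := mul_le_mul_of_nonneg_left (D.norm_pow_half_sq_le u) (D.lam_pos 0).le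
  have h2 := mul_le_mul_of_nonneg_right (D.lam_mul_norm_toH_le u) (norm_nonneg u)
  nlinarith

theorem continuous_norm_pow_half_sq :
    Continuous fun u : D.F 1 => ‖D.pow (1 / 2) (D.incl u)‖ ^ 2 := by
  simp only [norm_pow_half_sq]
  exact (D.toHL zero_le_one).continuous.inner (D.powL 1).continuous

end SpectralOperator

variable {D} {μ₁ μ₂ : ℝ → ℝ} {M : ℝ → ℝ} {p : H}

/-- The restoring force `-M(‖A^{1/2}u‖²) A u + p`. -/
noncomputable def force (D : SpectralOperator H) (M : ℝ → ℝ) (p : H) (u : D.F 1) : H :=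
  -(M (‖D.pow (1 / 2) (D.incl u)‖ ^ 2)) • D.pow 1 u + p

theorem nonlin_apply (U : Phase D μ₁ μ₂) :
    nonlin D μ₁ μ₂ M p U = (0, force D M p U.1, 0, 0, 0) := rfl

/-- The potential energy `½ ∫₀^{‖A^{1/2}u‖²} M - (p, u)`. -/
noncomputable def potential (D : SpectralOperator H) (M : ℝ → ℝ) (p : H) (u : D.F 1) : ℝ :=
  1 / 2 * primitive M (‖D.pow (1 / 2) (D.incl u)‖ ^ 2) - inner ℝ p (D.toH 1 u)

theorem lyapunov_eq {β : ℝ} (U : Phase D μ₁ μ₂) :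
    lyapunov D μ₁ μ₂ β M p U = 1 / 2 * normSq D μ₁ μ₂ β U + potential D M p U.1 := by
  rw [lyapunov, potential]
  ring

/-- On a ball of `F_1` the argument of `M` stays in a compact interval, where `M` is bounded and
Lipschitz, and the argument is itself Lipschitz in `u`. -/
theorem exists_norm_force_sub_le (hM : ContDiffOn ℝ 2 M (Ici 0)) (r : ℝ) :
    ∃ K : ℝ, 0 ≤ K ∧ ∀ u v : D.F 1, ‖u‖ ≤ r → ‖v‖ ≤ r →
      ‖force D M p u - force D M p v‖ ≤ K * ‖u - v‖ := by
  have h0 := D.lam_pos 0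
  set N : D.F 1 → ℝ := fun u => ‖D.pow (1 / 2) (D.incl u)‖ ^ 2 with hN
  set Z := (D.lam 0)⁻¹ * r ^ 2 with hZ
  have hNZ : ∀ u : D.F 1, ‖u‖ ≤ r → N u ∈ Icc 0 Z := fun u hu => by
    refine ⟨by positivity, ?_⟩
    rw [hZ, inv_mul_eq_div, le_div_iff₀ h0, mul_comm]
    exact (D.lam_mul_norm_pow_half_sq_le u).trans (pow_le_pow_left₀ (norm_nonneg u) hu 2)
  obtain ⟨L, hL⟩ := (hM.mono (fun _ hx => mem_Ici.2 hx.1 : Icc 0 Z ⊆ Ici 0)).exists_lipschitzOnWith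
    two_ne_zero
    (convex_Icc 0 Z) isCompact_Icc
  obtain ⟨B, hB⟩ := isCompact_Icc.exists_bound_of_continuousOn
    (hM.continuousOn.mono (fun _ hx => mem_Ici.2 hx.1 : Icc 0 Z ⊆ Ici 0))
  refine ⟨|B| + L * ((D.lam 0)⁻¹ * (2 * |r|)) * |r|, by positivity, fun u v hu hv => ?_⟩
  have hr : |r| = r := abs_of_nonneg ((norm_nonneg u).trans hu)
  have e : force D M p u - force D M p v
      = -(M (N u)) • D.pow 1 (u - v) - (M (N u) - M (N v)) • D.pow 1 v := by
    simp only [force, map_sub, hN]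
    module
  have h1 : ‖-(M (N u)) • D.pow 1 (u - v)‖ ≤ |B| * ‖u - v‖ := by
    rw [norm_smul, norm_neg, ← D.norm_F]
    exact mul_le_mul_of_nonneg_right ((hB _ (hNZ u hu)).trans (le_abs_self B)) (norm_nonneg _)
  have h2 : |N u - N v| ≤ (D.lam 0)⁻¹ * ‖u - v‖ * (2 * |r|) := by
    simp only [hN]
    rw [D.norm_pow_half_sq_sub, ← map_sub, ← map_add]
    refine (abs_real_inner_le_norm _ _).trans (mul_le_mul ?_ ?_ (norm_nonneg _) (by positivity))
    · rw [inv_mul_eq_div, le_div_iff₀ h0, mul_comm]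
      exact D.lam_mul_norm_toH_le _
    · rw [← D.norm_F, hr]
      exact (norm_add_le _ _).trans (by linarith)
  have h3 : ‖(M (N u) - M (N v)) • D.pow 1 v‖
      ≤ L * ((D.lam 0)⁻¹ * ‖u - v‖ * (2 * |r|)) * |r| := by
    rw [norm_smul, ← D.norm_F]
    refine mul_le_mul ?_ (hv.trans (le_abs_self r)) (norm_nonneg _) (by positivity)
    have := hL.dist_le_mul _ (hNZ u hu) _ (hNZ v hv)
    rw [dist_eq_norm, Real.dist_eq] at this
    exact this.trans (mul_le_mul_of_nonneg_left h2 L.2)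
  rw [e]
  refine (norm_sub_le _ _).trans ((add_le_add h1 h3).trans_eq ?_)
  ring

theorem isLocallyLipschitz_nonlin (hM : ContDiffOn ℝ 2 M (Ici 0)) :
    IsLocallyLipschitz (nonlin D μ₁ μ₂ M p) := by
  intro r
  obtain ⟨K, hK, h⟩ := exists_norm_force_sub_le (D := D) (p := p) hM r
  refine ⟨K, hK, fun U V hU hV => ?_⟩
  have e : ‖nonlin D μ₁ μ₂ M p U - nonlin D μ₁ μ₂ M p V‖
      = ‖force D M p U.1 - force D M p V.1‖ := by
    rw [nonlin_apply, nonlin_apply]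
    simp [Prod.norm_def]
  rw [e]
  refine (h _ _ ((norm_fst_le U).trans hU) ((norm_fst_le V).trans hV)).trans ?_
  exact mul_le_mul_of_nonneg_left (norm_fst_le (U - V)) hK

theorem continuous_potential (hM : ContinuousOn M (Ici 0)) : Continuous (potential D M p) := by
  have h1 : ∀ u, potential D M p u
      = 1 / 2 * (∫ ξ in (0 : ℝ)..‖D.pow (1 / 2) (D.incl u)‖ ^ 2, M (max ξ 0))
        - inner ℝ p (D.toHL zero_le_one u) := fun u => by
    rw [potential, primitive_eq (sq_nonneg _)]
    rfl
  have h2 : Continuous fun z => ∫ ξ in (0 : ℝ)..z, M (max ξ 0) :=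
    continuous_iff_continuousAt.2 fun z =>
      ((continuous_comp_max hM).hasDerivAt_integral_zero z).continuousAt
  rw [show potential D M p = _ from funext h1]
  exact (continuous_const.mul (h2.comp D.continuous_norm_pow_half_sq)).sub
    (continuous_const.inner (D.toHL zero_le_one).continuous)

theorem exists_potential_le (hM : ContinuousOn M (Ici 0)) (r : ℝ) :
    ∃ B, ∀ u : D.F 1, ‖u‖ ≤ r → potential D M p u ≤ B := by
  have h0 := D.lam_pos 0
  set Z := (D.lam 0)⁻¹ * r ^ 2 with hZ
  have h2 : Continuous fun z => ∫ ξ in (0 : ℝ)..z, M (max ξ 0) :=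
    continuous_iff_continuousAt.2 fun z =>
      ((continuous_comp_max hM).hasDerivAt_integral_zero z).continuousAt
  obtain ⟨B, hB⟩ := (isCompact_Icc (a := (0 : ℝ)) (b := Z)).exists_bound_of_continuousOn
    h2.continuousOn
  refine ⟨1 / 2 * B + ‖p‖ * ((D.lam 0)⁻¹ * r), fun u hu => ?_⟩
  have hN : ‖D.pow (1 / 2) (D.incl u)‖ ^ 2 ∈ Icc 0 Z := by
    refine ⟨by positivity, ?_⟩
    rw [hZ, inv_mul_eq_div, le_div_iff₀ h0, mul_comm]
    exact (D.lam_mul_norm_pow_half_sq_le u).trans (pow_le_pow_left₀ (norm_nonneg u) hu 2)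
  have h3 := (le_abs_self _).trans (hB _ hN)
  have h4 : ‖D.toH 1 u‖ ≤ (D.lam 0)⁻¹ * r := by
    rw [inv_mul_eq_div, le_div_iff₀ h0, mul_comm]
    exact (D.lam_mul_norm_toH_le u).trans hu
  have h5 := (neg_abs_le _).trans' (neg_le_neg (abs_real_inner_le_norm p (D.toH 1 u)))
  have h6 := mul_le_mul_of_nonneg_left h4 (norm_nonneg p)
  rw [potential, primitive_eq hN.1]
  linarith

theorem potential_ge {a b : ℝ} (hMab : ∀ z, 0 ≤ z → -a * z - b ≤ primitive M z) (u : D.F 1) :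
    -(a / 2) * ‖D.pow (1 / 2) (D.incl u)‖ ^ 2 - b / 2 - ‖p‖ * ‖D.toH 1 u‖
      ≤ potential D M p u := by
  have h1 := hMab _ (sq_nonneg ‖D.pow (1 / 2) (D.incl u)‖)
  have h2 := real_inner_le_norm p (D.toH 1 u)
  rw [potential]
  linarith

/-- The rate of change of the potential energy along a motion with velocity `w`. -/
theorem hasDerivAt_potential (hM : ContinuousOn M (Ici 0)) {u : ℝ → D.F 1} {w : H} {t : ℝ}
    (hu : ContinuousAt u t) (hw : HasDerivAt (fun t => D.toH 1 (u t)) w t) :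
    HasDerivAt (fun t => potential D M p (u t)) (-inner ℝ w (force D M p (u t))) t := by
  have hN : HasDerivAt (fun r => ‖D.pow (1 / 2) (D.incl (u r))‖ ^ 2)
      (inner ℝ w (D.pow 1 (u t) + D.pow 1 (u t))) t := by
    -- The difference quotient of `‖A^{1/2} u‖²` is the quotient of `u` in `H` paired with `A (u(r)
    -- + u(t))`. So differentiability in `H` and continuity in `F_1` are enough.
    rw [hasDerivAt_iff_tendsto_slope] at hw ⊢
    have hp : Tendsto (fun r => D.pow 1 (u r) + D.pow 1 (u t)) (𝓝[≠] t)
        (𝓝 (D.pow 1 (u t) + D.pow 1 (u t))) :=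
      ((((D.powL 1).continuous.tendsto _).comp hu).mono_left nhdsWithin_le_nhds).add_const _
    refine (hw.inner hp).congr fun r => ?_
    rw [slope_def_module, slope_def_module, D.norm_pow_half_sq_sub, real_inner_smul_left,
      smul_eq_mul]
  have h1 := (continuous_comp_max hM).hasDerivAt_integral_zero
    (‖D.pow (1 / 2) (D.incl (u t))‖ ^ 2)
  have h2 := ((h1.comp t hN).const_mul (1 / 2)).sub
    ((hasDerivAt_const t p).inner ℝ hw)
  refine (h2.congr_deriv ?_).congr_of_eventuallyEq (Eventually.of_forall fun r => ?_)
  · rw [max_eq_left (sq_nonneg _), inner_zero_left, add_zero, real_inner_comm w p, force,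
      inner_add_right, inner_add_right, real_inner_smul_right]
    ring
  · simp only [potential]
    rw [primitive_eq (sq_nonneg _)]
    rfl

end Potential

theorem eq_zero_of_integral_eq_zero {X : Type*} [NormedAddCommGroup X] [InnerProductSpace ℝ X]
    [CompleteSpace X] {h : ℝ → X} (hh : Continuous h) {T : ℝ} (hT : 0 < T)
    (h0 : ∀ t ∈ Icc 0 T, ∫ s in (0 : ℝ)..t, h s = 0) : ∀ t ∈ Icc 0 T, h t = 0 := by
  have h1 : EqOn h (fun _ => 0) (Ioo 0 T) := fun t ht => by
    refine (hh.hasDerivAt_integral_zero t).unique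
      ((hasDerivAt_const t (0 : X)).congr_of_eventuallyEq ?_)
    filter_upwards [isOpen_Ioo.mem_nhds ht] with s hs
    exact h0 s (Ioo_subset_Icc_self hs)
  have h2 := h1.closure hh continuous_const
  rw [closure_Ioo hT.ne] at h2
  exact h2

/-! ### Motions: energy inequality and rigidity at constant energy -/

section Dynamics

variable {H : Type*} [NormedAddCommGroup H] [InnerProductSpace ℝ H] [CompleteSpace H]
  {D : SpectralOperator H} {μ₁ μ₂ : ℝ → ℝ} {δ₁ δ₂ β ν ω : ℝ} {M : ℝ → ℝ} {p : H}

/-- The nonlinearity in the energy space. -/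
noncomputable def energyNonlin (D : SpectralOperator H) (μ₁ μ₂ : ℝ → ℝ) {β : ℝ} (hβ : 0 < β)
    (M : ℝ → ℝ) (p : H) (x : EnergySpace D μ₁ μ₂) : EnergySpace D μ₁ μ₂ :=
  toEnergy D μ₁ μ₂ hβ (nonlin D μ₁ μ₂ M p ((toEnergy D μ₁ μ₂ hβ).symm x))

theorem energyGraph_toEnergy {hβ : 0 < β} {U V : Phase D μ₁ μ₂} :
    EnergyGraph D μ₁ μ₂ hβ ν ω (toEnergy D μ₁ μ₂ hβ U) (toEnergy D μ₁ μ₂ hβ V) ↔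
      LGraph D μ₁ μ₂ β ν ω U V := by
  rw [EnergyGraph, ContinuousLinearEquiv.symm_apply_apply, ContinuousLinearEquiv.symm_apply_apply]

/-- A motion of the plate: a mild solution on `[0, T]` that is continuously extended to `ℝ`. -/
structure IsMotion (D : SpectralOperator H) (μ₁ μ₂ : ℝ → ℝ) {β : ℝ} (hβ : 0 < β) {ν ω : ℝ}
    (hR : IsMaxDissipative (EnergyGraph D μ₁ μ₂ hβ ν ω)) (M : ℝ → ℝ) (p : H)
    (U₀ : Phase D μ₁ μ₂) (T : ℝ) (U : ℝ → Phase D μ₁ μ₂) : Prop where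
  isExtendedSolution : IsExtendedSolution hR.semigroup (energyNonlin D μ₁ μ₂ hβ M p)
    (toEnergy D μ₁ μ₂ hβ U₀) T (fun t => toEnergy D μ₁ μ₂ hβ (U t))

namespace IsMotion

variable {hβ : 0 < β} {hR : IsMaxDissipative (EnergyGraph D μ₁ μ₂ hβ ν ω)}
  {U₀ : Phase D μ₁ μ₂} {T : ℝ} {U : ℝ → Phase D μ₁ μ₂}
  (hU : IsMotion D μ₁ μ₂ hβ hR M p U₀ T U)

include hU

theorem continuous : Continuous U := by
  have := (toEnergy D μ₁ μ₂ hβ).symm.continuous.comp hU.isExtendedSolution.continuous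
  simpa [Function.comp_def] using this

theorem apply_zero (hT : 0 ≤ T) : U 0 = U₀ :=
  (toEnergy D μ₁ μ₂ hβ).injective
    (IsForcedSolution.apply_zero hR.isContractionSemigroup hU.isExtendedSolution hT)

theorem integral_energyNonlin (t : ℝ) :
    IntervalIntegrable (fun s => nonlin D μ₁ μ₂ M p (U s)) volume 0 t ∧
    (∫ s in (0 : ℝ)..t, energyNonlin D μ₁ μ₂ hβ M p (toEnergy D μ₁ μ₂ hβ (U s)))
      = toEnergy D μ₁ μ₂ hβ (∫ s in (0 : ℝ)..t, nonlin D μ₁ μ₂ M p (U s)) := by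
  have hgc : Continuous fun s => energyNonlin D μ₁ μ₂ hβ M p (toEnergy D μ₁ μ₂ hβ (U s)) :=
    hU.isExtendedSolution.continuous_forcing
  simp only [energyNonlin, ContinuousLinearEquiv.symm_apply_apply] at hgc ⊢
  have hn : Continuous fun s => nonlin D μ₁ μ₂ M p (U s) :=
    ((toEnergy D μ₁ μ₂ hβ).symm.continuous.comp hgc).congr fun s =>
      (toEnergy D μ₁ μ₂ hβ).symm_apply_apply _
  exact ⟨hn.intervalIntegrable 0 t, (toEnergy D μ₁ μ₂ hβ : Phase D μ₁ μ₂ →L[ℝ]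
    EnergySpace D μ₁ μ₂).intervalIntegral_comp_comm (hn.intervalIntegrable 0 t)⟩

omit hU in
theorem integral_nonlin_fst {t : ℝ}
    (hn : IntervalIntegrable (fun s => nonlin D μ₁ μ₂ M p (U s)) volume 0 t) :
    (∫ s in (0 : ℝ)..t, nonlin D μ₁ μ₂ M p (U s)).1 = 0 := by
  refine ((ContinuousLinearMap.fst ℝ (D.F 1) (H × H × MemorySpace μ₁ (D.F 1) ×
    MemorySpace μ₂ (D.F (1 / 2)))).intervalIntegral_comp_comm hn).symm.trans ?_
  refine (intervalIntegral.integral_congr (g := fun _ => 0) fun s _ => ?_).trans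
    intervalIntegral.integral_zero
  simp only [nonlin_apply]
  rfl

omit hU in
theorem integral_nonlin_snd {t : ℝ}
    (hn : IntervalIntegrable (fun s => nonlin D μ₁ μ₂ M p (U s)) volume 0 t) :
    (∫ s in (0 : ℝ)..t, nonlin D μ₁ μ₂ M p (U s)).2.2 = 0 := by
  refine (((ContinuousLinearMap.snd ℝ H
    (H × MemorySpace μ₁ (D.F 1) × MemorySpace μ₂ (D.F (1 / 2)))).comp
    (ContinuousLinearMap.snd ℝ (D.F 1) (H × H × MemorySpace μ₁ (D.F 1) ×
    MemorySpace μ₂ (D.F (1 / 2))))).intervalIntegral_comp_comm hn).symm.trans ?_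
  refine (intervalIntegral.integral_congr (g := fun _ => 0) fun s _ => ?_).trans
    intervalIntegral.integral_zero
  simp only [nonlin_apply]
  rfl

/-- The force acts only on the velocity `w`, so its time integral drops out of all other components
of `L ∫ U`. -/
theorem lGraph_integral {t : ℝ} (ht : t ∈ Icc 0 T) :
    ∃ V : Phase D μ₁ μ₂, LGraph D μ₁ μ₂ β ν ω (∫ s in (0 : ℝ)..t, U s) V ∧
      V.1 = (U t).1 - U₀.1 ∧ V.2.2 = (U t).2.2 - U₀.2.2 := by
  have h := hR.integral_mem hU.isExtendedSolution ht
  have e1 : (∫ s in (0 : ℝ)..t, toEnergy D μ₁ μ₂ hβ (U s))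
      = toEnergy D μ₁ μ₂ hβ (∫ s in (0 : ℝ)..t, U s) :=
    (toEnergy D μ₁ μ₂ hβ : Phase D μ₁ μ₂ →L[ℝ] EnergySpace D μ₁ μ₂).intervalIntegral_comp_comm
      (hU.continuous.intervalIntegrable 0 t)
  obtain ⟨hn, e2⟩ := hU.integral_energyNonlin t
  have e3 := integral_nonlin_fst hn
  have e4 := integral_nonlin_snd hn
  rw [e1, e2] at h
  generalize (∫ s in (0 : ℝ)..t, nonlin D μ₁ μ₂ M p (U s)) = N at h e3 e4
  generalize (∫ s in (0 : ℝ)..t, U s) = Y at h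
  rw [← map_sub, ← map_sub, energyGraph_toEnergy] at h
  refine ⟨_, h, ?_, ?_⟩
  · rw [Prod.fst_sub, Prod.fst_sub, e3, sub_zero]
  · rw [Prod.snd_sub, Prod.snd_sub, Prod.snd_sub, Prod.snd_sub, e4, sub_zero]

omit hU in
theorem integral_snd_fst (hc : Continuous U) (t : ℝ) :
    (∫ s in (0 : ℝ)..t, U s).2.1 = ∫ s in (0 : ℝ)..t, (U s).2.1 :=
  (((ContinuousLinearMap.fst ℝ H
      (H × MemorySpace μ₁ (D.F 1) × MemorySpace μ₂ (D.F (1 / 2)))).comp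
      (ContinuousLinearMap.snd ℝ (D.F 1)
      (H × H × MemorySpace μ₁ (D.F 1) × MemorySpace μ₂ (D.F (1 / 2))))).intervalIntegral_comp_comm
      (hc.intervalIntegrable 0 t)).symm

omit hU in
theorem integral_snd_snd (hc : Continuous U) (t : ℝ) :
    (∫ s in (0 : ℝ)..t, U s).2.2 = ∫ s in (0 : ℝ)..t, (U s).2.2 :=
  (((ContinuousLinearMap.snd ℝ H
      (H × MemorySpace μ₁ (D.F 1) × MemorySpace μ₂ (D.F (1 / 2)))).comp
      (ContinuousLinearMap.snd ℝ (D.F 1)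
      (H × H × MemorySpace μ₁ (D.F 1) × MemorySpace μ₂ (D.F (1 / 2))))).intervalIntegral_comp_comm
      (hc.intervalIntegrable 0 t)).symm

/-- The first row of `L ∫ U` reads `u(t) - u(0) = ∫ w`. It replaces the equation `u' = w`, which a
mild solution satisfies only in `H`. -/
theorem toH_eq (hμ₁ : IsMemoryKernel μ₁ δ₁) (hμ₂ : IsMemoryKernel μ₂ δ₂) {t : ℝ}
    (ht : t ∈ Icc 0 T) :
    D.toH 1 (U t).1 = D.toH 1 U₀.1 + ∫ s in (0 : ℝ)..t, (U s).2.1 := by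
  obtain ⟨V, hV, h1, -⟩ := hU.lGraph_integral ht
  rw [← integral_snd_fst hU.continuous]
  generalize (∫ s in (0 : ℝ)..t, U s) = Y at hV
  obtain ⟨θ, ζb, ζ, h2, -⟩ := (lGraph_iff hμ₁ hμ₂ (u := Y.1) (w := Y.2.1) (v := Y.2.2.1)
    (ηb := Y.2.2.2.1) (η := Y.2.2.2.2) (u' := V.1) (w' := V.2.1) (v' := V.2.2.1)
    (ηb' := V.2.2.2.1) (η' := V.2.2.2.2)).1 hV
  rw [h2, h1, map_sub]
  abel

/-- In the energy product only the pairing of `w` with the force survives, and this is minus the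
time derivative of the potential. -/
theorem integral_power (hμ₁ : IsMemoryKernel μ₁ δ₁) (hμ₂ : IsMemoryKernel μ₂ δ₂)
    (hM : ContinuousOn M (Ici 0)) {t : ℝ} (ht : t ∈ Icc 0 T) :
    (∫ s in (0 : ℝ)..t, inner ℝ (toEnergy D μ₁ μ₂ hβ (U s))
      (energyNonlin D μ₁ μ₂ hβ M p (toEnergy D μ₁ μ₂ hβ (U s))))
      = potential D M p U₀.1 - potential D M p (U t).1 := by
  have hc := hU.continuous
  have hi : Continuous fun s => inner ℝ (toEnergy D μ₁ μ₂ hβ (U s))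
      (energyNonlin D μ₁ μ₂ hβ M p (toEnergy D μ₁ μ₂ hβ (U s))) :=
    Continuous.inner (𝕜 := ℝ) hU.isExtendedSolution.continuous
      hU.isExtendedSolution.continuous_forcing
  have he : ∀ s, inner ℝ (toEnergy D μ₁ μ₂ hβ (U s))
      (energyNonlin D μ₁ μ₂ hβ M p (toEnergy D μ₁ μ₂ hβ (U s)))
      = inner ℝ (U s).2.1 (force D M p (U s).1) := fun s => by
    rw [energyNonlin, ContinuousLinearEquiv.symm_apply_apply, inner_toEnergy, nonlin_apply]
    simp [energyInner]
  have h1 := intervalIntegral.integral_eq_sub_of_hasDerivAt_of_le ht.1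
    (f := fun s => potential D M p (U s).1)
    (f' := fun s => -inner ℝ (toEnergy D μ₁ μ₂ hβ (U s))
      (energyNonlin D μ₁ μ₂ hβ M p (toEnergy D μ₁ μ₂ hβ (U s))))
    ((continuous_potential hM).comp (continuous_fst.comp hc)).continuousOn
    (fun s hs => by
      rw [he]
      refine hasDerivAt_potential hM (continuous_fst.comp hc).continuousAt ?_
      have h2 : Continuous fun s => (U s).2.1 := continuous_fst.comp (continuous_snd.comp hc)
      refine ((h2.hasDerivAt_integral_zero s).const_add (D.toH 1 U₀.1)).congr_of_eventuallyEq ?_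
      filter_upwards [isOpen_Ioo.mem_nhds hs] with r hr
      exact hU.toH_eq hμ₁ hμ₂ ⟨hr.1.le, hr.2.le.trans ht.2⟩)
    (hi.neg.intervalIntegrable _ _)
  rw [intervalIntegral.integral_neg, hU.apply_zero (ht.1.trans ht.2)] at h1
  linarith

omit hU in
theorem continuous_dissipation : Continuous (dissipation D μ₁ μ₂ δ₁ δ₂ ω) := by
  unfold dissipation
  fun_prop

omit hU in
theorem dissipation_nonneg (hδ₁ : 0 < δ₁) (hδ₂ : 0 < δ₂) (hω : 0 ≤ ω) (V : Phase D μ₁ μ₂) :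
    0 ≤ dissipation D μ₁ μ₂ δ₁ δ₂ ω V := by
  have := D.lam_pos 0
  unfold dissipation
  positivity

omit hU in
theorem dissipation_le (hβ : 0 < β) (hδ₁ : 0 < δ₁) (hδ₂ : 0 < δ₂) (hω : 0 ≤ ω)
    (V : Phase D μ₁ μ₂) : dissipation D μ₁ μ₂ δ₁ δ₂ ω V
      ≤ (ω * D.lam 0 + δ₁ / 2 + δ₂ / 2) * normSq D μ₁ μ₂ β V := by
  obtain ⟨u, w, v, ηb, η⟩ := V
  have h0 := mul_nonneg hω (D.lam_pos 0).le
  simp only [dissipation, normSq]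
  have e : ∀ {k a s : ℝ}, 0 ≤ k → a ≤ s → k * a ≤ k * s := fun hk h =>
    mul_le_mul_of_nonneg_left h hk
  set s := β * ‖D.pow 1 u‖ ^ 2 + ‖w‖ ^ 2 + ‖v‖ ^ 2 + ‖ηb‖ ^ 2 + ‖η‖ ^ 2
  have a1 : 0 ≤ β * ‖D.pow 1 u‖ ^ 2 := by positivity
  have a2 := sq_nonneg ‖w‖
  have a3 := sq_nonneg ‖v‖
  have a4 := sq_nonneg ‖ηb‖
  have a5 := sq_nonneg ‖η‖
  have b1 := e h0 (show ‖v‖ ^ 2 ≤ s by linarith)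
  have b2 := e (half_pos hδ₁).le (show ‖ηb‖ ^ 2 ≤ s by linarith)
  have b3 := e (half_pos hδ₂).le (show ‖η‖ ^ 2 ≤ s by linarith)
  linarith

/-- The energy inequality. -/
theorem lyapunov_add_integral_le (hμ₁ : IsMemoryKernel μ₁ δ₁) (hμ₂ : IsMemoryKernel μ₂ δ₂)
    (hω : 0 ≤ ω) (hM : ContinuousOn M (Ici 0)) {t : ℝ} (ht : t ∈ Icc 0 T) :
    lyapunov D μ₁ μ₂ β M p (U t) + (∫ s in (0 : ℝ)..t, dissipation D μ₁ μ₂ δ₁ δ₂ ω (U s))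
      ≤ lyapunov D μ₁ μ₂ β M p U₀ := by
  set τ := toEnergy D μ₁ μ₂ hβ with hτ
  have h1 := hR.energy_le hU.isExtendedSolution
    (q := fun x => dissipation D μ₁ μ₂ δ₁ δ₂ ω (τ.symm x))
    (continuous_dissipation.comp τ.symm.continuous) (fun {x y} h => by
      have h2 := lGraph_dissip hμ₁ hμ₂ hω h
      rwa [← inner_toEnergy hβ, ContinuousLinearEquiv.apply_symm_apply,
        ContinuousLinearEquiv.apply_symm_apply] at h2)
    (C := ω * D.lam 0 + δ₁ / 2 + δ₂ / 2) (fun x => by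
      rw [abs_of_nonneg (dissipation_nonneg hμ₁.rate_pos hμ₂.rate_pos hω _)]
      refine (dissipation_le hβ hμ₁.rate_pos hμ₂.rate_pos hω _).trans_eq ?_
      rw [← norm_toEnergy_sq hβ, ← hτ, τ.apply_symm_apply]) ht
  simp only [← hτ, τ.symm_apply_apply] at h1
  have h2 := hU.integral_power hμ₁ hμ₂ hM ht
  rw [← hτ] at h2
  rw [h2, norm_toEnergy_sq, norm_toEnergy_sq] at h1
  rw [lyapunov_eq, lyapunov_eq]
  linarith

/-- Constant energy leaves no room for dissipation, so the histories vanish. The remaining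
components are shown to be at rest one after another (`v`, then `u`, then `w`), each from a row of
`L ∫ U`. -/
theorem eq_of_lyapunov_eq (hμ₁ : IsMemoryKernel μ₁ δ₁) (hμ₂ : IsMemoryKernel μ₂ δ₂)
    (hω : 0 ≤ ω) (hν : 0 < ν) (hnd : ω = 0 → ∃ s, 0 < s ∧ μ₂ s ≠ 0)
    (hM : ContinuousOn M (Ici 0)) (hT : 0 < T)
    (hΦ : ∀ t ∈ Ioc 0 T, lyapunov D μ₁ μ₂ β M p (U t) = lyapunov D μ₁ μ₂ β M p U₀) :
    ∀ t ∈ Icc 0 T, U t = U₀ := by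
  have hδ₁ := hμ₁.rate_pos
  have hδ₂ := hμ₂.rate_pos
  have hc := hU.continuous
  have h0 := hU.apply_zero hT.le
  have h0T : (0 : ℝ) ∈ Icc 0 T := left_mem_Icc.2 hT.le
  have hnn := fun s => dissipation_nonneg (D := D) hδ₁ hδ₂ hω (U s)
  have hdiss : ∀ t ∈ Icc 0 T, dissipation D μ₁ μ₂ δ₁ δ₂ ω (U t) = 0 := by
    refine eq_zero_of_integral_eq_zero (continuous_dissipation.comp hc) hT fun t ht => ?_
    rcases ht.1.eq_or_lt with rfl | htpos
    · simp
    refine le_antisymm ?_ (intervalIntegral.integral_nonneg ht.1 fun s _ => hnn s)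
    have h1 := hU.lyapunov_add_integral_le hμ₁ hμ₂ hω hM ht
    rw [hΦ t ⟨htpos, ht.2⟩] at h1
    exact (add_le_iff_nonpos_right _).1 h1
  have hη : ∀ t ∈ Icc 0 T, (U t).2.2.2.1 = 0 ∧ (U t).2.2.2.2 = 0 ∧
      (0 < ω → (U t).2.2.1 = 0) := fun t ht => by
    have h1 := hdiss t ht
    have hl := D.lam_pos 0
    unfold dissipation at h1
    have a1 : 0 ≤ ω * D.lam 0 * ‖(U t).2.2.1‖ ^ 2 := by positivity
    have a2 : 0 ≤ δ₁ / 2 * ‖(U t).2.2.2.1‖ ^ 2 := by positivity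
    have a3 : 0 ≤ δ₂ / 2 * ‖(U t).2.2.2.2‖ ^ 2 := by positivity
    have z : ∀ {k r : ℝ}, 0 < k → k * r ^ 2 = 0 → r = 0 := fun hk h =>
      pow_eq_zero_iff two_ne_zero |>.1 ((mul_eq_zero.1 h).resolve_left hk.ne')
    refine ⟨norm_eq_zero.1 (z (half_pos hδ₁) (by linarith)),
      norm_eq_zero.1 (z (half_pos hδ₂) (by linarith)), fun hω' =>
      norm_eq_zero.1 (z (mul_pos hω' hl) (by linarith))⟩
  have hint22 := integral_snd_snd (D := D) (μ₁ := μ₁) (μ₂ := μ₂) hc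
  have hcv : Continuous fun s => (U s).2.2 := continuous_snd.comp (continuous_snd.comp hc)
  have hIv : ∀ t, (∫ s in (0 : ℝ)..t, U s).2.2.1 = ∫ s in (0 : ℝ)..t, (U s).2.2.1 := fun t => by
    rw [hint22]
    exact ((ContinuousLinearMap.fst ℝ H
      (MemorySpace μ₁ (D.F 1) × MemorySpace μ₂ (D.F (1 / 2)))).intervalIntegral_comp_comm
      (hcv.intervalIntegrable 0 t)).symm
  have hIη : ∀ t ∈ Icc 0 T, (∫ s in (0 : ℝ)..t, U s).2.2.2.2 = 0 := fun t ht => by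
    rw [hint22]
    refine (((ContinuousLinearMap.snd ℝ (MemorySpace μ₁ (D.F 1))
      (MemorySpace μ₂ (D.F (1 / 2)))).comp (ContinuousLinearMap.snd ℝ H
      (MemorySpace μ₁ (D.F 1) × MemorySpace μ₂ (D.F (1 / 2))))).intervalIntegral_comp_comm
      (hcv.intervalIntegrable 0 t)).symm.trans ?_
    refine (intervalIntegral.integral_congr (g := fun _ => 0) fun s hs => ?_).trans (by simp)
    rw [uIcc_of_le ht.1] at hs
    exact (hη s ⟨hs.1, hs.2.trans ht.2⟩).2.1
  have hθ : ∀ t ∈ Icc 0 T, ∃ V : Phase D μ₁ μ₂, V.1 = (U t).1 - U₀.1 ∧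
      V.2.2 = (U t).2.2 - U₀.2.2 ∧ (∫ s in (0 : ℝ)..t, (U s).2.2.1) = 0 ∧
      (∫ s in (0 : ℝ)..t, (U s).2.1) = D.toH 1 V.1 ∧
      ∀ ψ, inner ℝ V.2.2.1 (D.toH (1 / 2) ψ)
        = -ν * inner ℝ (D.pow 1 V.1) (D.toH (1 / 2) ψ) := by
    intro t ht
    obtain ⟨V, hV, h1, h2⟩ := hU.lGraph_integral ht
    have e1 := hIv t
    have e2 := hIη t ht
    have e3 := integral_snd_fst (D := D) (μ₁ := μ₁) (μ₂ := μ₂) hc t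
    generalize (∫ s in (0 : ℝ)..t, U s) = Y at hV e1 e2 e3
    obtain ⟨θ, ζb, ζ, h3, h4, h5, h6, h7, h8, h9, h10⟩ :=
      (lGraph_iff hμ₁ hμ₂ (u := Y.1) (w := Y.2.1) (v := Y.2.2.1)
      (ηb := Y.2.2.2.1) (η := Y.2.2.2.2) (u' := V.1) (w' := V.2.1) (v' := V.2.2.1)
      (ηb' := V.2.2.2.1) (η' := V.2.2.2.2)).1 hV
    have hζ : ζ = 0 := hμ₂.eq_zero_of_hasMemoryDeriv_zero
      (hμ₂.hasMemoryDeriv_iff.2 (e2.symm.trans h6))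
    have hη' : V.2.2.2.2 = 0 := by
      rw [h2, Prod.snd_sub, Prod.snd_sub, (hη t ht).2.1, ← h0, (hη 0 h0T).2.1, sub_zero]
    rw [hη', hζ, neg_zero, zero_add] at h10
    -- Here `θ` is `∫ v` in `F_{1/2}`. With zero histories, the last row says that the constant `θ`
    -- vanishes in the memory space. If `ω = 0`, the nonzero kernel makes this conclusive; if `ω >
    -- 0`, already `v = 0`.
    have hθ0 : θ = 0 := by
      rcases hω.eq_or_lt with hω0 | hω0
      · obtain ⟨c, hc0, hcb⟩ := hμ₂.exists_norm_volterra_const_ge (E := D.F (1 / 2)) (hnd hω0.symm)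
        have := hcb θ
        rw [← h10, map_zero, norm_zero] at this
        exact norm_le_zero_iff.1 (nonpos_of_mul_nonpos_right this hc0)
      · refine D.toH_injective _ ?_
        rw [← h4, e1, map_zero]
        refine (intervalIntegral.integral_congr (g := fun _ => 0) fun s hs => ?_).trans (by simp)
        rw [uIcc_of_le ht.1] at hs
        exact (hη s ⟨hs.1, hs.2.trans ht.2⟩).2.2 hω0
    refine ⟨V, h1, h2, ?_, ?_, fun ψ => ?_⟩
    · rw [← e1, h4, hθ0, map_zero]
    · rw [← e3, h3]
    · rw [h8 ψ, e2, hθ0, inner_zero_left, inner_zero_left]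
      ring
  have hv : ∀ t ∈ Icc 0 T, (U t).2.2.1 = 0 :=
    eq_zero_of_integral_eq_zero (continuous_fst.comp hcv) hT fun t ht => by
      obtain ⟨V, -, -, h, -⟩ := hθ t ht
      exact h
  have hu : ∀ t ∈ Icc 0 T, (U t).1 = U₀.1 ∧ (∫ s in (0 : ℝ)..t, (U s).2.1) = 0 := by
    intro t ht
    obtain ⟨V, h1, h2, -, h3, h4⟩ := hθ t ht
    have hVv : V.2.2.1 = 0 := by
      rw [h2, Prod.fst_sub, hv t ht, ← h0, hv 0 h0T, sub_zero]
    -- With `v`, `θ` and `η` gone, the temperature row is `ν A (u(t) - u(0)) = 0`, so `ν > 0` stops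
    -- the displacement.
    have hV1 : V.1 = 0 := by
      refine D.pow_injective 1 (D.ext_coef fun k => ?_)
      have h5 := h4 (D.eF (1 / 2) k)
      rw [hVv, inner_zero_left, D.toH_eF, D.inner_e] at h5
      have h6 : D.coef (D.pow 1 V.1) k = 0 :=
        (mul_eq_zero.1 h5.symm).resolve_left (neg_ne_zero.2 hν.ne')
      rw [h6, map_zero]
      simp [SpectralOperator.coef]
    rw [hV1] at h1 h3
    exact ⟨(sub_eq_zero.1 h1.symm), by rw [h3, map_zero]⟩
  have hw : ∀ t ∈ Icc 0 T, (U t).2.1 = 0 :=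
    eq_zero_of_integral_eq_zero (continuous_fst.comp (continuous_snd.comp hc)) hT
      fun t ht => (hu t ht).2
  intro t ht
  rw [← h0]
  refine Prod.ext ((hu t ht).1.trans (hu 0 h0T).1.symm) (Prod.ext ((hw t ht).trans (hw 0 h0T).symm)
    (Prod.ext ((hv t ht).trans (hv 0 h0T).symm) (Prod.ext ((hη t ht).1.trans (hη 0 h0T).1.symm)
    ((hη t ht).2.1.trans (hη 0 h0T).2.1.symm))))

end IsMotion

end Dynamics

/-! ### Bounds from the energy -/

section Bounds

variable {H : Type*} [NormedAddCommGroup H] [InnerProductSpace ℝ H] [CompleteSpace H]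
  {D : SpectralOperator H} {μ₁ μ₂ : ℝ → ℝ} {δ₁ δ₂ β ν ω a b : ℝ} {M : ℝ → ℝ} {p : H}

theorem norm_fst_le_norm_toEnergy (hβ : 0 < β) (U : Phase D μ₁ μ₂) :
    ‖U.1‖ ≤ (√β)⁻¹ * ‖toEnergy D μ₁ μ₂ hβ U‖ := by
  have hs := Real.sqrt_pos.2 hβ
  rw [inv_mul_eq_div, le_div_iff₀ hs]
  refine (sq_le_sq₀ (by positivity) (norm_nonneg _)).1 ?_
  obtain ⟨u, w, v, ηb, η⟩ := U
  rw [norm_toEnergy_sq, mul_pow, Real.sq_sqrt hβ.le, normSq, D.norm_F]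
  have := sq_nonneg ‖w‖
  have := sq_nonneg ‖v‖
  have := sq_nonneg ‖ηb‖
  have := sq_nonneg ‖η‖
  simp only
  linarith

theorem norm_snd_fst_le_norm_toEnergy (hβ : 0 < β) (U : Phase D μ₁ μ₂) :
    ‖U.2.1‖ ≤ ‖toEnergy D μ₁ μ₂ hβ U‖ := by
  refine (sq_le_sq₀ (by positivity) (norm_nonneg _)).1 ?_
  obtain ⟨u, w, v, ηb, η⟩ := U
  rw [norm_toEnergy_sq, normSq]
  have := mul_nonneg hβ.le (sq_nonneg ‖D.pow 1 u‖)
  have := sq_nonneg ‖v‖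
  have := sq_nonneg ‖ηb‖
  have := sq_nonneg ‖η‖
  simp only
  linarith

theorem lyapunov_eq_norm (hβ : 0 < β) (U : Phase D μ₁ μ₂) :
    lyapunov D μ₁ μ₂ β M p U
      = 1 / 2 * ‖toEnergy D μ₁ μ₂ hβ U‖ ^ 2 + potential D M p U.1 := by
  rw [lyapunov_eq, norm_toEnergy_sq]

theorem continuous_lyapunov (hβ : 0 < β) (hM : ContinuousOn M (Ici 0)) :
    Continuous (lyapunov D μ₁ μ₂ β M p) := by
  rw [show lyapunov D μ₁ μ₂ β M p = _ from funext (lyapunov_eq_norm hβ)]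
  exact (continuous_const.mul ((toEnergy D μ₁ μ₂ hβ).continuous.norm.pow 2)).add
    ((continuous_potential hM).comp continuous_fst)

theorem exists_lyapunov_le (hβ : 0 < β) (hM : ContinuousOn M (Ici 0)) (r : ℝ) :
    ∃ B, ∀ U : Phase D μ₁ μ₂, ‖toEnergy D μ₁ μ₂ hβ U‖ ≤ r →
      lyapunov D μ₁ μ₂ β M p U ≤ B := by
  obtain ⟨B, hB⟩ := exists_potential_le (D := D) (p := p) hM ((√β)⁻¹ * r)
  refine ⟨1 / 2 * r ^ 2 + B, fun U hU => ?_⟩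
  rw [lyapunov_eq_norm hβ]
  have h1 := pow_le_pow_left₀ (norm_nonneg _) hU 2
  have h2 := hB U.1 ((norm_fst_le_norm_toEnergy hβ U).trans
    (mul_le_mul_of_nonneg_left hU (inv_nonneg.2 (Real.sqrt_nonneg β))))
  linarith

theorem bddAbove_lyapunov_image (hβ : 0 < β) (hM : ContinuousOn M (Ici 0))
    {B : Set (Phase D μ₁ μ₂)} (hB : Bornology.IsBounded B) :
    BddAbove (lyapunov D μ₁ μ₂ β M p '' B) := by
  obtain ⟨r, hr⟩ := isBounded_iff_forall_norm_le.1 hB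
  obtain ⟨C, hC⟩ := exists_lyapunov_le (D := D) (μ₁ := μ₁) (μ₂ := μ₂) (p := p) hβ hM
    (‖(toEnergy D μ₁ μ₂ hβ : Phase D μ₁ μ₂ →L[ℝ] EnergySpace D μ₁ μ₂)‖ * r)
  refine ⟨C, ?_⟩
  rintro _ ⟨U, hU, rfl⟩
  refine hC U (((toEnergy D μ₁ μ₂ hβ :
    Phase D μ₁ μ₂ →L[ℝ] EnergySpace D μ₁ μ₂).le_opNorm U).trans ?_)
  exact mul_le_mul_of_nonneg_left (hr U hU) (norm_nonneg _)

theorem isBounded_lyapunov_le (hβ : 0 < β) (ha : 0 < a)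
    (hMab : ∀ z, 0 ≤ z → -a * z - b ≤ primitive M z) (haβ : a < β * D.lam 0) (R : ℝ) :
    Bornology.IsBounded {U : Phase D μ₁ μ₂ | lyapunov D μ₁ μ₂ β M p U ≤ R} := by
  have h0 := D.lam_pos 0
  -- Since `a ‖A^{1/2} u‖² ≤ a / (β λ₀)` times the squared energy norm, this fraction of the
  -- quadratic energy survives the negative part of the potential; it is positive exactly because `a
  -- < β λ₀`.
  set κ := 1 - a / (β * D.lam 0) with hκ
  have hκ0 : 0 < κ := sub_pos.2 ((div_lt_one (by positivity)).2 haβ)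
  set m := 2 * (‖p‖ * ((D.lam 0)⁻¹ * (√β)⁻¹)) with hm
  have hm0 : 0 ≤ m := by positivity
  refine isBounded_iff_forall_norm_le.2 ⟨‖((toEnergy D μ₁ μ₂ hβ).symm :
    EnergySpace D μ₁ μ₂ →L[ℝ] Phase D μ₁ μ₂)‖ * ((|2 * R + b| + m) / κ + 1), fun U hU => ?_⟩
  have h1 := ((toEnergy D μ₁ μ₂ hβ).symm :
    EnergySpace D μ₁ μ₂ →L[ℝ] Phase D μ₁ μ₂).le_opNorm (toEnergy D μ₁ μ₂ hβ U)
  rw [ContinuousLinearEquiv.coe_coe, ContinuousLinearEquiv.symm_apply_apply] at h1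
  refine h1.trans (mul_le_mul_of_nonneg_left ?_ (norm_nonneg _))
  replace hU : lyapunov D μ₁ μ₂ β M p U ≤ R := hU
  rw [lyapunov_eq_norm hβ] at hU
  have h2 := potential_ge (p := p) hMab U.1
  have h3 := norm_fst_le_norm_toEnergy hβ U
  set y := ‖toEnergy D μ₁ μ₂ hβ U‖
  have hy : 0 ≤ y := norm_nonneg _
  have h4 : a * ‖D.pow (1 / 2) (D.incl U.1)‖ ^ 2 ≤ a / (β * D.lam 0) * y ^ 2 := by
    have h5 : D.lam 0 * ‖D.pow (1 / 2) (D.incl U.1)‖ ^ 2 ≤ β⁻¹ * y ^ 2 := by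
      refine (D.lam_mul_norm_pow_half_sq_le U.1).trans ?_
      refine (pow_le_pow_left₀ (norm_nonneg _) h3 2).trans_eq ?_
      rw [mul_pow, inv_pow, Real.sq_sqrt hβ.le]
    rw [div_mul_eq_mul_div, le_div_iff₀ (by positivity)]
    have h6 := mul_le_mul_of_nonneg_left h5 (mul_nonneg ha.le hβ.le)
    have h7 : a * β * (β⁻¹ * y ^ 2) = a * y ^ 2 := by
      field_simp
    linarith
  have h5 : 2 * (‖p‖ * ‖D.toH 1 U.1‖) ≤ m * y := by
    have h6 : ‖D.toH 1 U.1‖ ≤ (D.lam 0)⁻¹ * ((√β)⁻¹ * y) := by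
      refine le_trans ?_ (mul_le_mul_of_nonneg_left h3 (inv_nonneg.2 h0.le))
      rw [inv_mul_eq_div, le_div_iff₀ h0, mul_comm]
      exact D.lam_mul_norm_toH_le U.1
    have h7 := mul_le_mul_of_nonneg_left h6 (norm_nonneg p)
    rw [hm]
    linarith
  have h6 : κ * y ^ 2 ≤ |2 * R + b| + m * y := by
    have := le_abs_self (2 * R + b)
    rw [hκ, sub_mul]
    linarith
  -- From `κ y² ≤ |2R + b| + m y`: for `y > 1` the constant is at most itself times `y`, and one
  -- factor `y` cancels. The summand `1` in the bound covers `y ≤ 1`.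
  rcases le_or_gt y 1 with h7 | h7
  · exact h7.trans (le_add_of_nonneg_left (by positivity))
  · refine le_trans ?_ (le_add_of_nonneg_right zero_le_one)
    rw [le_div_iff₀ hκ0]
    have h8 : |2 * R + b| ≤ |2 * R + b| * y := le_mul_of_one_le_right (abs_nonneg _) h7.le
    refine le_of_mul_le_mul_right ?_ (zero_lt_one.trans h7)
    linarith

/-- Interpolation makes the negative part of the potential linear in the energy norm, so half of the
square absorbs it for any `a > 0`. The price is a multiple of `‖u‖_H`. -/
theorem norm_toEnergy_le_of_lyapunov_le (hβ : 0 < β) (ha : 0 < a)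
    (hMab : ∀ z, 0 ≤ z → -a * z - b ≤ primitive M z) {B : ℝ} {U : Phase D μ₁ μ₂}
    (hU : lyapunov D μ₁ μ₂ β M p U ≤ B) :
    ‖toEnergy D μ₁ μ₂ hβ U‖ ≤ √(4 * |B| + 2 * |b| + 2 * ‖p‖ ^ 2)
      + (a * (√β)⁻¹ + 2) * ‖D.toH 1 U.1‖ := by
  have hs := inv_pos.2 (Real.sqrt_pos.2 hβ)
  rw [lyapunov_eq_norm hβ] at hU
  have h2 := potential_ge (p := p) hMab U.1
  have h3 := norm_fst_le_norm_toEnergy hβ U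
  have h4 := D.norm_pow_half_sq_le U.1
  set y := ‖toEnergy D μ₁ μ₂ hβ U‖
  set n := ‖D.toH 1 U.1‖
  have hy : 0 ≤ y := norm_nonneg _
  have hn : 0 ≤ n := norm_nonneg _
  set c := a * (√β)⁻¹ with hc
  have hc0 : 0 ≤ c := by positivity
  set Q := 4 * |B| + 2 * |b| + 2 * ‖p‖ ^ 2
  have hQ0 : 0 ≤ Q := by positivity
  have h5 : a * ‖D.pow (1 / 2) (D.incl U.1)‖ ^ 2 ≤ c * n * y := by
    have h6 := mul_le_mul_of_nonneg_left (h4.trans (mul_le_mul_of_nonneg_left h3 hn)) ha.le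
    refine h6.trans_eq ?_
    rw [hc]
    ring
  have h6 : y ^ 2 ≤ Q + (c ^ 2 + 2) * n ^ 2 := by
    have := le_abs_self B
    have := le_abs_self b
    have := sq_nonneg (y - c * n)
    have := sq_nonneg (‖p‖ - n)
    linarith
  have hQ := Real.sqrt_nonneg Q
  refine (sq_le_sq₀ hy (by positivity)).1 (h6.trans ?_)
  have h7 := Real.sq_sqrt hQ0
  have h8 : 0 ≤ 2 * √Q * ((c + 2) * n) := by positivity
  have h9 : 0 ≤ (4 * c + 2) * n ^ 2 := by positivity
  linarith

theorem isLocallyLipschitz_energyNonlin (hβ : 0 < β) (hM : ContDiffOn ℝ 2 M (Ici 0)) :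
    IsLocallyLipschitz (energyNonlin D μ₁ μ₂ hβ M p) :=
  (isLocallyLipschitz_nonlin hM).conj (toEnergy D μ₁ μ₂ hβ)

theorem isMotion_symm {hβ : 0 < β} {hR : IsMaxDissipative (EnergyGraph D μ₁ μ₂ hβ ν ω)}
    {x : EnergySpace D μ₁ μ₂} {T : ℝ} {X : ℝ → EnergySpace D μ₁ μ₂}
    (hX : IsExtendedSolution hR.semigroup (energyNonlin D μ₁ μ₂ hβ M p) x T X) :
    IsMotion D μ₁ μ₂ hβ hR M p ((toEnergy D μ₁ μ₂ hβ).symm x) T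
      (fun t => (toEnergy D μ₁ μ₂ hβ).symm (X t)) :=
  ⟨by simpa only [ContinuousLinearEquiv.apply_symm_apply] using hX⟩

theorem IsMotion.lyapunov_le {hβ : 0 < β}
    {hR : IsMaxDissipative (EnergyGraph D μ₁ μ₂ hβ ν ω)} {U₀ : Phase D μ₁ μ₂} {T : ℝ}
    {U : ℝ → Phase D μ₁ μ₂} (hU : IsMotion D μ₁ μ₂ hβ hR M p U₀ T U)
    (hμ₁ : IsMemoryKernel μ₁ δ₁) (hμ₂ : IsMemoryKernel μ₂ δ₂)
    (hω : 0 ≤ ω) (hM : ContinuousOn M (Ici 0)) {t : ℝ} (ht : t ∈ Icc 0 T) :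
    lyapunov D μ₁ μ₂ β M p (U t) ≤ lyapunov D μ₁ μ₂ β M p U₀ :=
  (le_add_of_nonneg_right (intervalIntegral.integral_nonneg ht.1 fun _ _ =>
    dissipation_nonneg hμ₁.rate_pos hμ₂.rate_pos hω _)).trans
    (hU.lyapunov_add_integral_le hμ₁ hμ₂ hω hM ht)

/-- The norm of `u` in `H` is at most its initial value plus `∫ ‖w‖`, and `‖w‖` is part of the
energy norm. Thus the bound by `‖u‖_H` becomes an integral inequality for the energy norm alone. -/
theorem hasAprioriBounds_energyNonlin (hβ : 0 < β)
    (hR : IsMaxDissipative (EnergyGraph D μ₁ μ₂ hβ ν ω)) (hμ₁ : IsMemoryKernel μ₁ δ₁)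
    (hμ₂ : IsMemoryKernel μ₂ δ₂) (hω : 0 ≤ ω) (hM : ContinuousOn M (Ici 0)) (ha : 0 < a)
    (hMab : ∀ z, 0 ≤ z → -a * z - b ≤ primitive M z) :
    HasAprioriBounds hR.semigroup (energyNonlin D μ₁ μ₂ hβ M p) := by
  intro T r
  have h0 := D.lam_pos 0
  obtain ⟨B, hB⟩ := exists_lyapunov_le (D := D) (μ₁ := μ₁) (μ₂ := μ₂) (p := p) hβ hM r
  set q := √(4 * |B| + 2 * |b| + 2 * ‖p‖ ^ 2)
  set K := a * (√β)⁻¹ + 2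
  have hq : 0 ≤ q := Real.sqrt_nonneg _
  have hK : 0 ≤ K := by positivity
  set A := q + K * ((D.lam 0)⁻¹ * ((√β)⁻¹ * |r|))
  have hA : 0 ≤ A := by positivity
  refine ⟨A * Real.exp (K * |T|), fun x hx T' X hT' hX t ht => ?_⟩
  have hU := isMotion_symm hX
  set τ := toEnergy D μ₁ μ₂ hβ with hτ
  have hL : lyapunov D μ₁ μ₂ β M p (τ.symm x) ≤ B :=
    hB _ (by rwa [τ.apply_symm_apply])
  have hn0 : ‖D.toH 1 (τ.symm x).1‖ ≤ (D.lam 0)⁻¹ * ((√β)⁻¹ * |r|) := by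
    have h1 := norm_fst_le_norm_toEnergy hβ (τ.symm x)
    rw [← hτ, τ.apply_symm_apply] at h1
    have h2 : ‖(τ.symm x).1‖ ≤ (√β)⁻¹ * |r| := h1.trans
      (mul_le_mul_of_nonneg_left (hx.trans (le_abs_self r)) (inv_nonneg.2 (Real.sqrt_nonneg β)))
    refine le_trans ?_ (mul_le_mul_of_nonneg_left h2 (inv_nonneg.2 h0.le))
    rw [inv_mul_eq_div, le_div_iff₀ h0, mul_comm]
    exact D.lam_mul_norm_toH_le _
  have hXc : Continuous fun s => ‖X s‖ := hX.continuous.norm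
  have key : ∀ s ∈ Icc 0 T', ‖X s‖ ≤ A + K * ∫ s in (0 : ℝ)..s, ‖X s‖ := fun s hs => by
    have h1 := norm_toEnergy_le_of_lyapunov_le hβ ha hMab
      ((hU.lyapunov_le hμ₁ hμ₂ hω hM hs).trans hL)
    rw [← hτ, τ.apply_symm_apply] at h1
    have h2 : ‖D.toH 1 (τ.symm (X s)).1‖
        ≤ (D.lam 0)⁻¹ * ((√β)⁻¹ * |r|) + ∫ s in (0 : ℝ)..s, ‖X s‖ := by
      rw [hU.toH_eq hμ₁ hμ₂ hs]
      refine (norm_add_le _ _).trans (add_le_add hn0 ?_)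
      refine intervalIntegral.norm_integral_le_of_norm_le hs.1
        (Eventually.of_forall fun z _ => ?_) (hXc.intervalIntegrable 0 s)
      have h3 := norm_snd_fst_le_norm_toEnergy hβ (τ.symm (X z))
      rwa [← hτ, τ.apply_symm_apply] at h3
    have h3 := mul_le_mul_of_nonneg_left h2 hK
    rw [mul_add] at h3
    exact h1.trans (by linarith)
  refine (le_mul_exp_of_le_add_mul_integral hXc hK key ht).trans ?_
  refine mul_le_mul_of_nonneg_left (Real.exp_le_exp.2 (mul_le_mul_of_nonneg_left ?_ hK)) hA
  exact (ht.2.trans hT').trans (le_abs_self T)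

end Bounds

/-! ### Return to the phase space and conclusion -/

theorem IsContractionSemigroup.isC0Semigroup_pullback {X Y : Type*} [NormedAddCommGroup X]
    [InnerProductSpace ℝ X] [NormedAddCommGroup Y] [NormedSpace ℝ Y] (T : Y ≃L[ℝ] X)
    {E : ℝ → X →L[ℝ] X} (hE : IsContractionSemigroup E) : IsC0Semigroup (pullback T E) where
  zero := by
    ext y
    rw [pullback_apply, hE.zero 0 le_rfl]
    exact T.symm_apply_apply y
  add s t hs ht := by
    ext y
    rw [ContinuousLinearMap.comp_apply, pullback_apply, pullback_apply, pullback_apply,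
      T.apply_symm_apply, hE.add s t hs ht]
  tendsto y := by
    have h1 : Continuous fun t => pullback T E t y :=
      T.symm.continuous.comp (hE.continuous (T y))
    have h2 := (h1.tendsto 0).mono_left (nhdsWithin_le_nhds (s := Ioi 0))
    rwa [pullback_apply, hE.zero 0 le_rfl, ContinuousLinearMap.id_apply,
      T.symm_apply_apply] at h2

theorem IsMildSolution.congr {X : Type*} [NormedAddCommGroup X] [NormedSpace ℝ X]
    {E : ℝ → X →L[ℝ] X} {f : X → X} {x : X} {T : ℝ} {U V : ℝ → X}
    (h : IsMildSolution E f x T U) (hUV : ∀ t ∈ Icc 0 T, V t = U t) :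
    IsMildSolution E f x T V := by
  refine ⟨h.1.congr hUV, fun t ht => ?_⟩
  rw [hUV t ht, h.2 t ht]
  congr 1
  refine intervalIntegral.integral_congr fun s hs => ?_
  rw [uIcc_of_le ht.1] at hs
  simp only [hUV s ⟨hs.1, hs.2.trans ht.2⟩]

end BergerPlate

open BergerPlate in
theorem theorem2p9 {H : Type*} [NormedAddCommGroup H] [InnerProductSpace ℝ H] [CompleteSpace H]
    (D : BergerPlate.SpectralOperator H)
    (β ν ω : ℝ) (hβ : 0 < β) (hν : 0 < ν) (hω : 0 ≤ ω)
    (μ₁ μ₂ : ℝ → ℝ) (δ₁ δ₂ : ℝ)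
    (hμ₁ : BergerPlate.IsMemoryKernel μ₁ δ₁) (hμ₂ : BergerPlate.IsMemoryKernel μ₂ δ₂)
    (hnd : ω = 0 → ∃ s, 0 < s ∧ μ₂ s ≠ 0)
    (M : ℝ → ℝ) (hM : ContDiffOn ℝ 2 M (Set.Ici 0))
    (a b : ℝ) (ha : 0 < a) (ha' : a < D.lam 0)
    (hMab : ∀ z, 0 ≤ z → -a * z - b ≤ BergerPlate.primitive M z)
    (p : H) :
    ∃ (E : ℝ → BergerPlate.Phase D μ₁ μ₂ →L[ℝ] BergerPlate.Phase D μ₁ μ₂)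
      (S : ℝ → BergerPlate.Phase D μ₁ μ₂ → BergerPlate.Phase D μ₁ μ₂),
      -- `E` is the linear semigroup generated by `L`
      BergerPlate.IsC0Semigroup E ∧
      BergerPlate.HasGenerator E (BergerPlate.LGraph D μ₁ μ₂ β ν ω) ∧
      -- `S_t U₀` is the unique mild solution with initial value `U₀`
      (∀ U₀ T, 0 < T →
        BergerPlate.IsMildSolution E (BergerPlate.nonlin D μ₁ μ₂ M p) U₀ T (fun t => S t U₀) ∧
        ∀ U, BergerPlate.IsMildSolution E (BergerPlate.nonlin D μ₁ μ₂ M p) U₀ T U →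
          ∀ t ∈ Set.Icc 0 T, U t = S t U₀) ∧
      -- the system is gradient with `Φ` as a strict Lyapunov function
      BergerPlate.IsGradient S ∧
      BergerPlate.IsStrictLyapunov S (BergerPlate.lyapunov D μ₁ μ₂ β M p) ∧
      -- `Φ` is bounded above on bounded sets, and its sublevel sets are bounded
      (∀ B : Set (BergerPlate.Phase D μ₁ μ₂), Bornology.IsBounded B →
        BddAbove (BergerPlate.lyapunov D μ₁ μ₂ β M p '' B)) ∧
      (a < β * D.lam 0 → ∀ R : ℝ,
        Bornology.IsBounded {U | BergerPlate.lyapunov D μ₁ μ₂ β M p U ≤ R}) := by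
  have hMc := hM.continuousOn
  have hR := isMaxDissipative_energyGraph (D := D) (ν := ν) hβ hω hμ₁ hμ₂ hnd
  have hE := hR.isContractionSemigroup
  have hf := isLocallyLipschitz_energyNonlin (D := D) (μ₁ := μ₁) (μ₂ := μ₂) (p := p) hβ hM
  obtain ⟨S, hS, hdyn⟩ := exists_dynamicalSystem hE hf
    (hasAprioriBounds_energyNonlin hβ hR hμ₁ hμ₂ hω hMc ha hMab)
  have hmot : ∀ (U₀ : Phase D μ₁ μ₂) (T : ℝ), 0 ≤ T → ∃ U, IsMotion D μ₁ μ₂ hβ hR M p U₀ T U ∧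
      ∀ t ∈ Icc 0 T, U t = (toEnergy D μ₁ μ₂ hβ).symm (S t (toEnergy D μ₁ μ₂ hβ U₀)) := by
    intro U₀ T hT
    obtain ⟨X, hX, hXS⟩ := hS (toEnergy D μ₁ μ₂ hβ U₀) T hT
    have h1 := isMotion_symm hX
    rw [ContinuousLinearEquiv.symm_apply_apply] at h1
    exact ⟨_, h1, fun t ht => by rw [hXS t ht]⟩
  have hdyn' := hdyn.pullback (toEnergy D μ₁ μ₂ hβ)
  have hL : IsStrictLyapunov
      (fun t U => (toEnergy D μ₁ μ₂ hβ).symm (S t (toEnergy D μ₁ μ₂ hβ U)))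
      (lyapunov D μ₁ μ₂ β M p) :=
    { continuous := continuous_lyapunov hβ hMc
      nonincreasing := fun x s hs t _ hst => by
        have hle : ∀ y r, 0 ≤ r → lyapunov D μ₁ μ₂ β M p
            ((toEnergy D μ₁ μ₂ hβ).symm (S r (toEnergy D μ₁ μ₂ hβ y)))
            ≤ lyapunov D μ₁ μ₂ β M p y := fun y r hr => by
          obtain ⟨U, hU, hUS⟩ := hmot y r hr
          rw [← hUS r (right_mem_Icc.2 hr)]
          exact hU.lyapunov_le hμ₁ hμ₂ hω hMc (right_mem_Icc.2 hr)
        have h1 := hdyn'.add (t - s) s (sub_nonneg.2 hst) hs x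
        rw [sub_add_cancel] at h1
        simp only [h1]
        exact hle _ _ (sub_nonneg.2 hst)
      strict := fun x hx t ht => by
        -- The longer interval has positive length even for `t = 0`, as the rigidity argument
        -- requires.
        have hT : 0 < t + 1 := by positivity
        obtain ⟨U, hU, hUS⟩ := hmot x (t + 1) hT.le
        have ht' : t ∈ Icc 0 (t + 1) := ⟨ht, (lt_add_one t).le⟩
        simp only [← hUS t ht']
        refine hU.eq_of_lyapunov_eq hμ₁ hμ₂ hω hν hnd hMc hT (fun r hr => ?_) t ht'
        rw [hUS r ⟨hr.1.le, hr.2⟩]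
        exact hx r hr.1 }
  refine ⟨pullback (toEnergy D μ₁ μ₂ hβ) hR.semigroup, _,
    hE.isC0Semigroup_pullback _, HasGenerator.pullback _ hR.hasGenerator, fun U₀ T hT => ?_,
    ⟨hdyn', _, hL⟩, hL, fun B hB => bddAbove_lyapunov_image hβ hMc hB,
    fun haβ R => isBounded_lyapunov_le hβ ha hMab haβ R⟩
  obtain ⟨X, hX, hXS⟩ := hS (toEnergy D μ₁ μ₂ hβ U₀) T hT.le
  refine ⟨(isMildSolution_pullback_iff _).2 (hX.isMildSolution.congr fun t ht => ?_),
    fun U hU t ht => ?_⟩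
  · rw [ContinuousLinearEquiv.apply_symm_apply, hXS t ht]
  · obtain ⟨V, hV, hVU⟩ := ((isMildSolution_pullback_iff _).1 hU).exists_extension
      hf.continuous hT.le
    simp only [← hXS t ht]
    rw [IsExtendedSolution.eq_of_eq hE hf hX hV ht, hVU t ht,
      ContinuousLinearEquiv.symm_apply_apply]
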